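/- Fix integers $k,m\ge 1$ and $y\in\mathbb{R}$, and let $p=p(n)\in(0,1)$ satisfy, as $n\to\infty$, $$p^k\gg\frac{\ln^3 n}{n},\qquad 1-p\gg\sqrt{\frac{\ln\ln n}{\ln n}},$$ where $f(n)\gg g(n)$ means $g(n)=o(f(n))$. Let $G(n,p)$ be the binomial random graph on $\{1,\dots,n\}$, in which each pair of distinct vertices is an edge independently with probability $p$. A common neighbour of a $k$-element set $U$ of vertices is a vertex adjacent to every vertex of $U$. Let $\Delta^m_{k;n}$ be the $m$-th largest (counted with multiplicity) among the $\binom nk$ numbers of common neighbours of the $k$-element subsets of $\{1,\dots,n\}$ in $G(n,p)$; this is defined for all large $n$. Put $$a_{k;n}=np^k+\sqrt{2kp^k(1-p^k)n\ln n}\left(1-\frac{\ln(k!)}{2k\ln n}-\frac{\ln(4\pi k\ln n)}{4k\ln n}\right),\qquad \sigma_{k;n}=\sqrt{\frac{p^k(1-p^k)n}{2k\ln n}}.$$ Then $$\mathsf{P}\left(\frac{\Delta^m_{k;n}-a_{k;n}}{\sigma_{k;n}}\le y\right)\longrightarrow e^{-e^{-y}}\sum_{i=0}^{m-1}\frac{e^{-yi}}{i!}\qquad\text{as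 }n\to\infty.$$ In particular, for $m=1$ the limit is $e^{-e^{-y}}$, the distribution function of the standard Gumbel law. -/

import Mathlib

open Filter Topology Asymptotics MeasureTheory

noncomputable section

namespace CommonNeighbors

open Classical in
/-- The common neighbours in `G` of the vertices in `U`. For nonempty `U` no vertex of `U` is one of
them, since adjacency is irreflexive. -/
def commonNbrs {V : Type*} [Fintype V] (G : SimpleGraph V) (U : Finset V) : Finset V :=
  {u : V | ∀ v ∈ U, G.Adj u v}

/-- The `m`-th largest value, for `m ≥ 1` and counted with multiplicity, of the family `f` over the
finite index set `S`: the largest `t` for which at least `m` indices `i ∈ S` satisfy `t ≤ f i`.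
(It is `0` when `S` has fewer than `m` elements.) -/
def mthLargest {ι : Type*} (m : ℕ) (S : Finset ι) (f : ι → ℕ) : ℕ :=
  sSup {t : ℕ | m ≤ (S.filter fun i => t ≤ f i).card}

/-- The `m`-th largest number of common neighbours among the `k`-element sets of vertices of `G`. -/
def mthMaxCommonNbrs {V : Type*} [Fintype V] (k m : ℕ) (G : SimpleGraph V) : ℕ :=
  mthLargest m ((Finset.univ : Finset V).powersetCard k) fun U => (commonNbrs G U).card

/-- The centring `a_{k;n}`, as a function of `k`, `n` and the edge probability `p`. -/
def centring (k n : ℕ) (p : ℝ) : ℝ :=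
  n * p ^ k + √(2 * k * p ^ k * (1 - p ^ k) * n * Real.log n) *
    (1 - Real.log (k.factorial : ℝ) / (2 * k * Real.log n)
      - Real.log (4 * Real.pi * k * Real.log n) / (4 * k * Real.log n))

/-- The scaling `σ_{k;n}`, as a function of `k`, `n` and the edge probability `p`. -/
def scaling (k n : ℕ) (p : ℝ) : ℝ :=
  √(p ^ k * (1 - p ^ k) * n / (2 * k * Real.log n))

end CommonNeighbors

end

namespace CommonNeighbors

open Finset

/-! Fix `t = a + σ y` and let `X` be the number of `k`-sets with more than `t` common neighbours.
The `m`-th largest count is at most `t` exactly when `X < m`, so it suffices that `X` converges in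
law to a Poisson variable with mean `exp (-y)`.

Mean. The number of common neighbours of one `k`-set is binomial with `n - k` trials and success
probability `p ^ k`. A moderate-deviation estimate (`tendsto_binTail`: Stirling for one point,
geometric comparison for the tail) gives the tail as `exp (-w² / 2) / (w √(2π))`, where `w` is the
height of `t` in standard deviations. The centring and scaling make `w²` equal to `2 k log n - 2
correction + o(1)`, whence the expected number of exceedances tends to `exp (-y)`
(`tendsto_choose_mul_binTail`). The estimate requires `w³` to be small against the standard
deviation; this is the role of `log³ n / n = o(p ^ k)`.

Poisson law. Let `A_U` be the event that `U` exceeds. Then `(i + 1) P(X = i + 1) = ∑_U P(A_U, X = i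
+ 1)`. Let `X_U` count the sets disjoint from `U` that exceed using only vertices outside `U`. It
depends only on pairs that do not meet `U`, so it is independent of `A_U`. Replacing `X` by `X_U +
1` on `A_U`, and then `X_U` by `X`, gives `(i + 1) P(X = i + 1) ≈ E X * P(X = i)`
(`abs_mul_bprob_exceedances_sub_le`). Together with the tightness supplied by Markov's inequality,
this recursion forces the Poisson limit (`tendsto_poisson_of_recursion`).

Errors. Disjoint sets matter only if their count lies within `k` of `t`, which is negligible since
the tail asymptotics do not see a bounded shift. The delicate case is a second exceedance at `D`
with `#(U ∩ D) = r`, `1 ≤ r < k`. The counts of `U` and `D` have correlation `ρ = (p ^ (k - r) - p ^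
k) / (1 - p ^ k)`. One first truncates the number of common neighbours of `W = U ∩ D` near its
conditional mean given `A_U` (`bprob_truncation_le`). Given the pairs at `U`, the count of `D` is
then controlled by a binomial variable, and the exponential Markov inequality bounds its exceedance
probability by roughly `exp (-(1 - ρ) k log n)` (`bprob_pair_le`, `pair_mgf_le`). Without the
truncation the Gaussian exponent would lose a factor `1 + ρ`.

There are at most `n ^ (k - r)` such `D` for each `W`, so what is needed is `r - k ρ > 0` with room
to spare. By `overlap_gap` this gap is at least `(1 - p) / k`; it closes as `p` tends to `1`. The
accumulated errors have order `√(log n * log log n)`, and the assumption on `1 - p` says precisely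
that the gap times `log n` dominates them. -/

open Classical in
/-- The indicator of a proposition, as a real number. -/
noncomputable def ind (Q : Prop) : ℝ := if Q then 1 else 0

lemma ind_of {Q : Prop} (h : Q) : ind Q = 1 := if_pos h

lemma ind_of_not {Q : Prop} (h : ¬ Q) : ind Q = 0 := if_neg h

lemma ind_nonneg (Q : Prop) : 0 ≤ ind Q := by
  unfold ind; split_ifs <;> norm_num

lemma ind_le_one (Q : Prop) : ind Q ≤ 1 := by
  unfold ind; split_ifs <;> norm_num

lemma ind_mono {Q R : Prop} (h : Q → R) : ind Q ≤ ind R := by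
  by_cases hQ : Q
  · rw [ind_of hQ, ind_of (h hQ)]
  · rw [ind_of_not hQ]; exact ind_nonneg R

lemma ind_and (Q R : Prop) : ind (Q ∧ R) = ind Q * ind R := by
  by_cases hQ : Q <;> by_cases hR : R <;> simp [ind, hQ, hR]

/-! ### Random subsets with independent elements. -/

section Bernoulli

variable {α : Type*}

/-- The expectation of `f S`, for `S` the random subset of `A` that contains each element
independently with probability `p`. -/
def bexp (p : ℝ) (A : Finset α) (f : Finset α → ℝ) : ℝ :=
  ∑ S ∈ A.powerset, p ^ #S * (1 - p) ^ (#A - #S) * f S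

/-- The probability of `Q S`, for `S` the random subset of `A` that contains each element
independently with probability `p`. -/
noncomputable def bprob (p : ℝ) (A : Finset α) (Q : Finset α → Prop) : ℝ :=
  bexp p A fun S => ind (Q S)

variable {p : ℝ} {A B : Finset α} {f g : Finset α → ℝ} {Q R : Finset α → Prop}

lemma bexp_congr (h : ∀ S ⊆ A, f S = g S) : bexp p A f = bexp p A g :=
  sum_congr rfl fun S hS => by rw [h S (mem_powerset.1 hS)]

lemma bexp_empty : bexp p (∅ : Finset α) f = f ∅ := by simp [bexp]

lemma bexp_add : bexp p A (fun S => f S + g S) = bexp p A f + bexp p A g := by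
  simp [bexp, mul_add, sum_add_distrib]

lemma bexp_sub : bexp p A (fun S => f S - g S) = bexp p A f - bexp p A g := by
  simp [bexp, mul_sub, sum_sub_distrib]

lemma bexp_const_mul (c : ℝ) : bexp p A (fun S => c * f S) = c * bexp p A f := by
  simp only [bexp, mul_sum]
  exact sum_congr rfl fun S _ => by ring

lemma bexp_mul_const (c : ℝ) : bexp p A (fun S => f S * c) = bexp p A f * c := by
  simp only [bexp, sum_mul]
  exact sum_congr rfl fun S _ => by ring

lemma bexp_sum {ι : Type*} (s : Finset ι) (F : ι → Finset α → ℝ) :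
    bexp p A (fun S => ∑ i ∈ s, F i S) = ∑ i ∈ s, bexp p A (F i) := by
  simp only [bexp, mul_sum]
  exact sum_comm

lemma bexp_mono (h0 : 0 ≤ p) (h1 : p ≤ 1) (h : ∀ S ⊆ A, f S ≤ g S) : bexp p A f ≤ bexp p A g :=
  sum_le_sum fun S hS => mul_le_mul_of_nonneg_left (h S (mem_powerset.1 hS))
    (mul_nonneg (pow_nonneg h0 _) (pow_nonneg (sub_nonneg.2 h1) _))

lemma bprob_mono (h0 : 0 ≤ p) (h1 : p ≤ 1) (h : ∀ S ⊆ A, Q S → R S) :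
    bprob p A Q ≤ bprob p A R :=
  bexp_mono h0 h1 fun S hS => ind_mono (h S hS)

lemma bprob_or_le (h0 : 0 ≤ p) (h1 : p ≤ 1) :
    bprob p A (fun S => Q S ∨ R S) ≤ bprob p A Q + bprob p A R := by
  unfold bprob
  rw [← bexp_add]
  refine bexp_mono h0 h1 fun S _ => ?_
  by_cases hQ : Q S <;> by_cases hR : R S <;> simp [ind, hQ, hR]

lemma bprob_exists_le {ι : Type*} (s : Finset ι) (F : ι → Finset α → Prop)
    (h0 : 0 ≤ p) (h1 : p ≤ 1) :
    bprob p A (fun S => ∃ i ∈ s, F i S) ≤ ∑ i ∈ s, bprob p A (F i) := by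
  unfold bprob
  rw [← bexp_sum]
  refine bexp_mono h0 h1 fun S _ => ?_
  by_cases h : ∃ i ∈ s, F i S
  · obtain ⟨i, hi, hF⟩ := h
    rw [ind_of ⟨i, hi, hF⟩, ← ind_of hF]
    exact single_le_sum (f := fun i => ind (F i S)) (fun _ _ => ind_nonneg _) hi
  · rw [ind_of_not h]
    exact sum_nonneg fun _ _ => ind_nonneg _

variable [DecidableEq α]

/-- Condition on whether `a` is chosen. Total mass one and the product structure over disjoint
ground sets follow from this by induction. -/
lemma bexp_insert {a : α} (ha : a ∉ A) :
    bexp p (insert a A) f =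
      p * bexp p A (fun S => f (insert a S)) + (1 - p) * bexp p A f := by
  unfold bexp
  rw [sum_powerset_insert ha, mul_sum, mul_sum, add_comm, card_insert_of_notMem ha]
  congr 1
  · refine sum_congr rfl fun S hS => ?_
    have hS' := mem_powerset.1 hS
    rw [card_insert_of_notMem (fun h => ha (hS' h)), Nat.add_sub_add_right]
    ring
  · refine sum_congr rfl fun S hS => ?_
    have := card_le_card (mem_powerset.1 hS)
    rw [Nat.sub_add_comm this]
    ring

lemma bexp_const (c : ℝ) : bexp p A (fun _ => c) = c := by
  induction A using Finset.induction_on with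
  | empty => exact bexp_empty
  | insert a A ha ih => rw [bexp_insert ha, ih]; ring

lemma bexp_nonneg (h0 : 0 ≤ p) (h1 : p ≤ 1) (h : ∀ S ⊆ A, 0 ≤ f S) : 0 ≤ bexp p A f :=
  (bexp_const (p := p) (A := A) 0).symm.le.trans (bexp_mono h0 h1 h)

lemma bexp_union (h : Disjoint A B) :
    bexp p (A ∪ B) f = bexp p A fun S => bexp p B fun T => f (S ∪ T) := by
  induction A using Finset.induction_on generalizing f with
  | empty => simp [bexp_empty]
  | insert a A ha ih =>
    have hd : Disjoint A B := disjoint_of_subset_left (subset_insert a A) h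
    have haB : a ∉ A ∪ B := by
      rw [mem_union, not_or]
      exact ⟨ha, disjoint_left.1 h (mem_insert_self a A)⟩
    rw [insert_union, bexp_insert haB, bexp_insert ha, ih hd, ih hd]
    simp only [insert_union]

lemma bexp_restrict (hAB : A ⊆ B) (hf : ∀ S, f S = f (S ∩ A)) : bexp p B f = bexp p A f := by
  have hB : B = A ∪ (B \ A) := (union_sdiff_of_subset hAB).symm
  rw [hB, bexp_union disjoint_sdiff]
  refine bexp_congr fun S hS => ?_
  rw [← bexp_const (p := p) (A := B \ A) (f S)]
  refine bexp_congr fun T hT => ?_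
  rw [hf (S ∪ T), hf S]
  congr 1
  grind

lemma bexp_mul_of_disjoint (hA : A ⊆ B) (hf : ∀ S, f S = f (S ∩ A))
    (hg : ∀ S, g S = g (S \ A)) : bexp p B (fun S => f S * g S) = bexp p B f * bexp p B g := by
  have hB : B = A ∪ (B \ A) := (union_sdiff_of_subset hA).symm
  have hgB : bexp p B g = bexp p (B \ A) g := by
    conv_lhs => rw [hB, union_comm, bexp_union disjoint_sdiff.symm]
    refine bexp_congr fun S hS => ?_
    rw [← bexp_const (p := p) (A := A) (g S)]
    refine bexp_congr fun T hT => ?_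
    rw [hg (S ∪ T), hg S]
    congr 1
    grind
  rw [bexp_restrict hA hf, hgB, ← bexp_mul_const]
  conv_lhs => rw [hB, bexp_union disjoint_sdiff]
  refine bexp_congr fun S hS => ?_
  rw [← bexp_const_mul]
  refine bexp_congr fun T hT => ?_
  rw [hf (S ∪ T), hf S, hg (S ∪ T), hg T]
  have e1 : (S ∪ T) ∩ A = S ∩ A := by grind
  have e2 : (S ∪ T) \ A = T \ A := by grind
  rw [e1, e2]

/-- Independence of finitely many factors that look at disjoint blocks `A i`: the factor of one
index splits off because the remaining ones do not see its block. -/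
lemma bexp_prod {ι : Type*} (O : Finset ι) (E : Finset α) (A : ι → Finset α)
    (hA : ∀ i ∈ O, A i ⊆ E) (hd : ∀ i ∈ O, ∀ j ∈ O, i ≠ j → Disjoint (A i) (A j))
    (F : ι → Finset α → ℝ) (hF : ∀ i ∈ O, ∀ S, F i S = F i (S ∩ A i)) :
    bexp p E (fun S => ∏ i ∈ O, F i S) = ∏ i ∈ O, bexp p E (F i) := by
  classical
  induction O using Finset.induction_on with
  | empty => simp [bexp_const]
  | insert a O ha ih =>
    simp only [prod_insert ha]
    rw [bexp_mul_of_disjoint (hA a (mem_insert_self a O)) (hF a (mem_insert_self a O)),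
      ih (fun i hi => hA i (mem_insert_of_mem hi))
        (fun i hi j hj => hd i (mem_insert_of_mem hi) j (mem_insert_of_mem hj))
        (fun i hi => hF i (mem_insert_of_mem hi))]
    intro S
    refine prod_congr rfl fun i hi => ?_
    rw [hF i (mem_insert_of_mem hi) S, hF i (mem_insert_of_mem hi) (S \ A a)]
    have := hd i (mem_insert_of_mem hi) a (mem_insert_self a O) (fun h => ha (h ▸ hi))
    congr 1
    ext x
    have hx : x ∈ A i → x ∉ A a := fun h => Finset.disjoint_left.1 this h
    grind

lemma bprob_subset (hA : A ⊆ B) : bprob p B (fun S => A ⊆ S) = p ^ #A := by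
  unfold bprob
  induction A using Finset.induction_on with
  | empty => simp [bexp_const, ind]
  | insert a A ha ih =>
    have haB : a ∈ B := hA (mem_insert_self a A)
    have h1 : ∀ S : Finset α, ind (insert a A ⊆ S) = ind (a ∈ S) * ind (A ⊆ S) := fun S => by
      rw [← ind_and, insert_subset_iff]
    simp only [h1]
    rw [bexp_mul_of_disjoint (A := {a}) (singleton_subset_iff.2 haB),
      ih ((subset_insert a A).trans hA),
      bexp_restrict (singleton_subset_iff.2 haB), card_insert_of_notMem ha, pow_succ', mul_eq_mul_right_iff]
    · left
      rw [← insert_empty_eq, bexp_insert (notMem_empty a), bexp_empty, bexp_empty]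
      simp [ind]
    · intro S; simp
    · intro S; simp
    · intro S
      congr 1
      simp only [eq_iff_iff]
      grind

lemma bprob_nonneg (h0 : 0 ≤ p) (h1 : p ≤ 1) : 0 ≤ bprob p A Q :=
  bexp_nonneg h0 h1 fun _ _ => ind_nonneg _

end Bernoulli

/-! ### Graphs as random sets of pairs. -/

section Graph

variable {V : Type*} [DecidableEq V]

/-- The pairs that join `w` to the vertices in `U`. -/
def star (w : V) (U : Finset V) : Finset (Sym2 V) := U.image fun u => s(w, u)

/-- The vertices in `O` that are joined to all vertices of `U` by pairs in `S`. -/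
def cn (S : Finset (Sym2 V)) (U O : Finset V) : Finset V := {w ∈ O | star w U ⊆ S}

/-- The pairs of distinct vertices. -/
def pairs (V : Type*) [DecidableEq V] [Fintype V] : Finset (Sym2 V) := {e | ¬ e.IsDiag}

/-- The pairs of distinct vertices that meet `U`. -/
def pairsAt [Fintype V] (U : Finset V) : Finset (Sym2 V) := {e ∈ pairs V | ∃ u ∈ U, u ∈ e}

variable {U W O : Finset V} {S : Finset (Sym2 V)} {p : ℝ}

lemma mem_cn {w : V} : w ∈ cn S U O ↔ w ∈ O ∧ star w U ⊆ S := by simp [cn]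

lemma cn_subset : cn S U O ⊆ O := filter_subset _ _

lemma star_subset_iff {w : V} : star w U ⊆ S ↔ ∀ u ∈ U, s(w, u) ∈ S := by
  simp [star, image_subset_iff]

lemma card_star (w : V) (U : Finset V) : #(star w U) = #U :=
  card_image_of_injective _ fun _ _ h => by
    simp only [Sym2.eq_iff] at h
    grind

lemma star_mono {w : V} (h : W ⊆ U) : star w W ⊆ star w U := image_subset_image h

/-- The source of independence between candidate common neighbours: a pair lying in both stars would
put `w'` into `U`. -/
lemma disjoint_star {w w' : V} (hw : w' ∉ U) (h : w ≠ w') :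
    Disjoint (star w U) (star w' U) := by
  rw [Finset.disjoint_left]
  intro e he he'
  simp only [star, Finset.mem_image] at he he'
  obtain ⟨u, hu, rfl⟩ := he
  obtain ⟨u', hu', h'⟩ := he'
  rw [Sym2.eq_iff] at h'
  rcases h' with ⟨h1, h2⟩ | ⟨h1, h2⟩
  · exact h h1.symm
  · exact hw (h1 ▸ hu)

lemma star_subset_pairs [Fintype V] {w : V} (hw : w ∉ U) : star w U ⊆ pairs V := by
  rw [star_subset_iff]
  intro u hu
  simp only [pairs, mem_filter_univ, Sym2.mk_isDiag_iff]
  exact fun h => hw (h ▸ hu)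

lemma commonNbrs_fromEdgeSet [Fintype V] (hS : S ⊆ pairs V) :
    commonNbrs (SimpleGraph.fromEdgeSet (S : Set (Sym2 V))) U = cn S U Uᶜ := by
  ext w
  have hd : ∀ e ∈ S, ¬ e.IsDiag := fun e he => by simpa [pairs] using hS he
  simp only [commonNbrs, mem_filter_univ, SimpleGraph.fromEdgeSet_adj, mem_cn, star_subset_iff,
    mem_compl, mem_coe]
  constructor
  · intro h
    refine ⟨fun hw => (h w hw).2 rfl, fun u hu => ?_⟩
    rw [Sym2.eq_swap]
    have := (h u hu).1
    rwa [Sym2.eq_swap]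
  · rintro ⟨hw, h⟩ u hu
    exact ⟨h u hu, fun e => hw (e ▸ hu)⟩

/-- Transfers the measure-theoretic model to a finite weighted sum: a graph corresponds to its edge
set, whose mass is the Bernoulli weight of a subset of `pairs V`. -/
lemma binomialRandom_real_eq [Fintype V] (p : unitInterval) (Q : SimpleGraph V → Prop) :
    (SimpleGraph.binomialRandom V p).real {G | Q G} =
      bprob (p : ℝ) (pairs V) fun S => Q (SimpleGraph.fromEdgeSet (S : Set (Sym2 V))) := by
  classical
  have hsing : ∀ G : SimpleGraph V, MeasurableSet {G} := fun G => by
    rw [← SimpleGraph.measurableEmbedding_edgeSet.measurableSet_image, Set.image_singleton]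
    exact MeasurableSet.singleton _
  have hpairs : ((pairs V : Finset (Sym2 V)) : Set (Sym2 V)) = Sym2.diagSetᶜ := by
    ext e; simp [pairs]
  have h1 : (SimpleGraph.binomialRandom V p).real {G | Q G} =
      ∑ G : SimpleGraph V, ind (Q G) * (SimpleGraph.binomialRandom V p).real {G} := by
    have : {G | Q G} = ⋃ G ∈ (univ.filter Q : Finset (SimpleGraph V)), ({G} : Set _) := by
      ext G; simp
    rw [this, measureReal_biUnion_finset (by intro a _ b _ h; simpa [Function.onFun] using h)
      (fun G _ => hsing G), sum_filter]
    refine sum_congr rfl fun G _ => ?_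
    by_cases h : Q G <;> simp [ind, h]
  rw [h1]
  unfold bprob bexp
  symm
  refine sum_bij (fun S _ => SimpleGraph.fromEdgeSet (S : Set (Sym2 V))) (fun _ _ => mem_univ _)
    ?_ ?_ ?_
  · intro S hS T hT h
    have := congrArg SimpleGraph.edgeSet h
    simp only [SimpleGraph.edgeSet_fromEdgeSet] at this
    ext e
    have he := Set.ext_iff.1 this e
    have h2 := fun h => mem_filter.1 (mem_powerset.1 hS h : e ∈ pairs V)
    have h3 := fun h => mem_filter.1 (mem_powerset.1 hT h : e ∈ pairs V)
    simp only [Set.mem_sdiff, mem_coe, Sym2.mem_diagSet] at he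
    tauto
  · intro G _
    refine ⟨G.edgeFinset, ?_, by simp⟩
    rw [mem_powerset]
    intro e he
    simp only [pairs, mem_filter_univ]
    exact G.not_isDiag_of_mem_edgeSet (SimpleGraph.mem_edgeFinset.1 he)
  · intro S hS
    have hS' : S ⊆ pairs V := mem_powerset.1 hS
    have hed : (SimpleGraph.fromEdgeSet (S : Set (Sym2 V))).edgeSet = S := by
      rw [SimpleGraph.edgeSet_fromEdgeSet, sdiff_eq_left, Set.disjoint_left]
      intro e he hd
      have : e ∈ pairs V := hS' he
      simp [pairs] at this
      exact this hd
    rw [mul_comm]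
    congr 1
    rw [measureReal_def, SimpleGraph.binomialRandom_apply', Set.image_singleton, hed,
      ← measureReal_def, ProbabilityTheory.setBernoulli_real_singleton, Set.ncard_coe_finset,
      ← hpairs, ← coe_sdiff, Set.ncard_coe_finset, card_sdiff_of_subset hS']
    · rw [← hpairs]; exact_mod_cast hS'
    · exact Set.toFinite _

end Graph

/-! ### Joint law of the common neighbours of a set and of a subset of it. -/

section Law

variable {V : Type*} [DecidableEq V] {U W O : Finset V} {p : ℝ}

/-- Both sides factor over `w ∈ O`. A vertex of `R` must see all of `U`, hence also `W`, and
contributes `z`. A vertex outside `R` must miss part of `U`; it contributes `z` if it still sees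
`W`, and `1` otherwise. -/
lemma ind_cn_mul_pow (hWU : W ⊆ U) {R : Finset V} (hR : R ⊆ O) (z : ℝ) (S : Finset (Sym2 V)) :
    ind (cn S U O = R) * z ^ #(cn S W O) =
      ∏ w ∈ O, if w ∈ R then z * ind (star w U ⊆ S) else
        z * (ind (star w W ⊆ S) - ind (star w U ⊆ S)) + (1 - ind (star w W ⊆ S)) := by
  by_cases h : cn S U O = R
  · have hz : z ^ #(cn S W O) = ∏ w ∈ O, if star w W ⊆ S then z else 1 := by
      rw [prod_ite, prod_const, prod_const_one, mul_one]; rfl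
    rw [ind_of h, one_mul, hz]
    refine prod_congr rfl fun w hw => ?_
    have hm : w ∈ R ↔ star w U ⊆ S := by rw [← h, mem_cn]; simp [hw]
    have hm' := fun h => (star_mono (w := w) hWU).trans (h : star w U ⊆ S)
    by_cases h1 : star w U ⊆ S
    · simp [ind, hm, h1, hm' h1]
    · by_cases h2 : star w W ⊆ S <;> simp [ind, hm, h1, h2]
  · rw [ind_of_not h, zero_mul]
    symm
    have : ∃ w ∈ O, ¬ (w ∈ R ↔ star w U ⊆ S) := by
      by_contra! hc
      refine h (Finset.ext fun w => ?_)
      rw [mem_cn]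
      exact ⟨fun hw => (hc w hw.1).2 hw.2, fun hw => ⟨hR hw, (hc w (hR hw)).1 hw⟩⟩
    obtain ⟨w, hw, hw'⟩ := this
    refine prod_eq_zero hw ?_
    by_cases h1 : star w U ⊆ S
    · have h2 := (star_mono (w := w) hWU).trans h1
      have : w ∉ R := by tauto
      simp [this, ind, h1, h2]
    · have : w ∈ R := by tauto
      simp [this, ind, h1]

lemma star_subset_inter {w : V} {A S : Finset (Sym2 V)} (h : star w W ⊆ A) :
    (star w W ⊆ S ∩ A) = (star w W ⊆ S) := by
  simp [subset_inter_iff, h]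

variable [Fintype V]

lemma bprob_star {w : V} (hw : w ∉ U) :
    bexp p (pairs V) (fun S => ind (star w U ⊆ S)) = p ^ #U := by
  rw [← card_star w U]
  exact bprob_subset (star_subset_pairs hw)

/-- The stars of distinct `w ∈ O` are disjoint, so the factors are independent. Each `w` sees `U`,
sees `W` but not `U`, or does not see `W`, with probabilities `p ^ #U`, `p ^ #W - p ^ #U` and `1 - p
^ #W`. -/
lemma bexp_ind_cn_mul_pow (hWU : W ⊆ U) (hUO : Disjoint U O) {R : Finset V} (hR : R ⊆ O) (z : ℝ) :
    bexp p (pairs V) (fun S => ind (cn S U O = R) * z ^ #(cn S W O)) =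
      (z * p ^ #U) ^ #R * (z * (p ^ #W - p ^ #U) + (1 - p ^ #W)) ^ (#O - #R) := by
  have hO : ∀ w ∈ O, w ∉ U := fun w hw h => Finset.disjoint_left.1 hUO h hw
  simp only [ind_cn_mul_pow hWU hR]
  rw [bexp_prod O (pairs V) (fun w => star w U) (fun w hw => star_subset_pairs (hO w hw))
    (fun w _ w' hw' h => disjoint_star (hO w' hw') h)]
  · have : ∀ w ∈ O, bexp p (pairs V) (fun S => if w ∈ R then z * ind (star w U ⊆ S) else
        z * (ind (star w W ⊆ S) - ind (star w U ⊆ S)) + (1 - ind (star w W ⊆ S))) =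
        if w ∈ R then z * p ^ #U else z * (p ^ #W - p ^ #U) + (1 - p ^ #W) := by
      intro w hw
      have h1 := bprob_star (p := p) (hO w hw)
      have h2 := bprob_star (p := p) (fun h => hO w hw (hWU h))
      split_ifs
      · rw [bexp_const_mul, h1]
      · rw [bexp_add, bexp_const_mul, bexp_sub, bexp_sub, bexp_const, h1, h2]
    rw [prod_congr rfl this, prod_ite, prod_const, prod_const]
    have e1 : {x ∈ O | x ∈ R} = R := by grind
    have e2 : {x ∈ O | x ∉ R} = O \ R := by grind
    rw [e1, e2, card_sdiff_of_subset hR]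
  · intro w hw S
    rw [star_subset_inter (A := star w U) (star_mono hWU), star_subset_inter (A := star w U) subset_rfl]

lemma bexp_cn (hUO : Disjoint U O) (f : Finset V → ℝ) :
    bexp p (pairs V) (fun S => f (cn S U O)) = bexp (p ^ #U) O f := by
  have h1 : ∀ S : Finset (Sym2 V), f (cn S U O) =
      ∑ R ∈ O.powerset, f R * (ind (cn S U O = R) * 1 ^ #(cn S U O)) := by
    intro S
    rw [sum_eq_single_of_mem (cn S U O) (mem_powerset.2 cn_subset)]
    · simp [ind]
    · intro R _ hR
      simp [ind, hR.symm]
  simp only [h1]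
  rw [bexp_sum]
  refine sum_congr rfl fun R hR => ?_
  rw [bexp_const_mul, bexp_ind_cn_mul_pow subset_rfl hUO (mem_powerset.1 hR)]
  simp; ring

/-- The probability that a binomial variable with parameters `N` and `P` exceeds `x`. -/
noncomputable def binTail (N : ℕ) (P x : ℝ) : ℝ :=
  ∑ j ∈ range (N + 1) with x < (j : ℕ), N.choose j * P ^ j * (1 - P) ^ (N - j)

lemma bprob_lt_card_cn (hUO : Disjoint U O) (x : ℝ) :
    bprob p (pairs V) (fun S => x < #(cn S U O)) = binTail #O (p ^ #U) x := by
  unfold bprob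
  rw [bexp_cn hUO (fun R => ind (x < #R))]
  unfold bexp
  rw [sum_powerset_apply_card (fun j => (p ^ #U) ^ j * (1 - p ^ #U) ^ (#O - j) * ind (x < (j : ℕ))),
    binTail, sum_filter]
  refine sum_congr rfl fun j _ => ?_
  by_cases h : x < j <;> simp [ind, h, mul_assoc]

/-- Either the count of `U` exceeds `T`, or it lies in `(t, T]` and Markov's inequality applies to
`z ^ (#(cn S W O) - b)`. The assumption `hδ` compares, for each size `j` of the set for `U`, the
tilted weight with the original one; summing recovers the tail beyond `t` with the factor `δ`. -/
lemma bprob_large_subset_le (h0 : 0 ≤ p) (h1 : p ≤ 1) (hWU : W ⊆ U) (hUO : Disjoint U O)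
    {t T b z δ : ℝ} (hz : 1 ≤ z) (hδ0 : 0 ≤ δ)
    (hδ : ∀ j : ℕ, j ≤ #O → t < j → (j : ℝ) ≤ T →
      (z * p ^ #U) ^ j * (z * (p ^ #W - p ^ #U) + (1 - p ^ #W)) ^ (#O - j) * z ^ (-b) ≤
        δ * ((p ^ #U) ^ j * (1 - p ^ #U) ^ (#O - j))) :
    bprob p (pairs V) (fun S => t < #(cn S U O) ∧ b < #(cn S W O)) ≤
      binTail #O (p ^ #U) T + δ * binTail #O (p ^ #U) t := by
  classical
  have hz0 : 0 < z := by linarith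
  have hpow : ∀ n, 0 ≤ p ^ n ∧ p ^ n ≤ 1 := fun n => ⟨pow_nonneg h0 n, pow_le_one₀ h0 h1⟩
  set D : Finset (Finset V) := {R ∈ O.powerset | t < (#R : ℝ) ∧ (#R : ℝ) ≤ T} with hD
  have hstep : ∀ S : Finset (Sym2 V), ind (t < #(cn S U O) ∧ b < #(cn S W O)) ≤
      ind (T < #(cn S U O)) +
        ∑ R ∈ D, z ^ (-b) * (ind (cn S U O = R) * z ^ #(cn S W O)) := by
    intro S
    have hnn : ∀ R ∈ D, 0 ≤ z ^ (-b) * (ind (cn S U O = R) * z ^ #(cn S W O)) := fun R _ => by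
      have := ind_nonneg (cn S U O = R)
      positivity
    by_cases hT : T < #(cn S U O)
    · rw [ind_of hT]
      linarith [ind_le_one (t < #(cn S U O) ∧ b < #(cn S W O)), sum_nonneg hnn]
    by_cases h : t < #(cn S U O) ∧ b < #(cn S W O)
    · rw [ind_of h, ind_of_not hT, zero_add]
      have hmem : cn S U O ∈ D := by
        simp only [hD, mem_filter, mem_powerset]
        exact ⟨cn_subset, h.1, not_lt.1 hT⟩
      refine le_trans ?_ (single_le_sum hnn hmem)
      rw [ind_of rfl, one_mul, ← Real.rpow_natCast, ← Real.rpow_add hz0]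
      exact Real.one_le_rpow hz (by linarith)
    · rw [ind_of_not h]
      exact add_nonneg (ind_nonneg _) (sum_nonneg hnn)
  refine (bexp_mono h0 h1 fun S _ => hstep S).trans ?_
  rw [bexp_add, bexp_sum]
  refine add_le_add (bprob_lt_card_cn hUO T).le ?_
  rw [← bprob_lt_card_cn hUO t]
  unfold bprob
  rw [bexp_cn hUO (fun R => ind (t < #R)), bexp, mul_sum]
  have hsub : D ⊆ O.powerset := filter_subset _ _
  refine le_trans ?_ (sum_le_sum_of_subset_of_nonneg hsub ?_)
  · refine sum_le_sum fun R hR => ?_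
    simp only [hD, mem_filter, mem_powerset] at hR
    rw [bexp_const_mul, bexp_ind_cn_mul_pow hWU hUO hR.1, ind_of hR.2.1, mul_one, mul_comm]
    exact hδ #R (card_le_card hR.1) hR.2.1 hR.2.2
  · intro R hR hRD
    have := ind_nonneg (t < (#R : ℝ))
    have := (hpow #U).1
    have := sub_nonneg.2 (hpow #U).2
    positivity

end Law

/-! ### Two sets of vertices: conditioning on the pairs that meet the first. -/

section Pairs

variable {V : Type*} [DecidableEq V] [Fintype V] {U W O D : Finset V} {p : ℝ}
  {S : Finset (Sym2 V)}

lemma pairsAt_subset : pairsAt U ⊆ pairs V := filter_subset _ _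

lemma star_subset_pairsAt {w : V} (hw : w ∉ U) : star w U ⊆ pairsAt U := by
  intro e he
  refine mem_filter.2 ⟨star_subset_pairs hw he, ?_⟩
  simp only [star, Finset.mem_image] at he
  obtain ⟨u, hu, rfl⟩ := he
  exact ⟨u, hu, Sym2.mem_mk_right _ _⟩

lemma disjoint_star_pairsAt {w : V} (hw : w ∉ U) (hD : Disjoint D U) :
    Disjoint (star w D) (pairsAt U) := by
  rw [Finset.disjoint_left]
  intro e he he'
  simp only [star, Finset.mem_image] at he
  obtain ⟨d, hd, rfl⟩ := he
  obtain ⟨u, hu, h⟩ := (mem_filter.1 he').2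
  rcases Sym2.mem_iff.1 h with rfl | rfl
  · exact hw hu
  · exact Finset.disjoint_left.1 hD hd hu

lemma cn_inter_pairsAt (hWU : W ⊆ U) (hUO : Disjoint U O) :
    cn (S ∩ pairsAt U) W O = cn S W O := by
  ext w
  rw [mem_cn, mem_cn]
  refine and_congr_right fun hw => ?_
  rw [star_subset_inter ((star_mono hWU).trans
    (star_subset_pairsAt fun h => Finset.disjoint_left.1 hUO h hw))]

lemma cn_sdiff_pairsAt (hD : Disjoint D U) (hUO : Disjoint U O) :
    cn (S \ pairsAt U) D O = cn S D O := by
  ext w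
  rw [mem_cn, mem_cn]
  refine and_congr_right fun hw => ?_
  have := disjoint_star_pairsAt (w := w) (fun h => Finset.disjoint_left.1 hUO h hw) hD
  rw [subset_sdiff]
  exact and_iff_left this

lemma bprob_and_of_disjoint {Q R : Finset (Sym2 V) → Prop} (hQ : ∀ S, Q S ↔ Q (S ∩ pairsAt U))
    (hR : ∀ S, R S ↔ R (S \ pairsAt U)) :
    bprob p (pairs V) (fun S => Q S ∧ R S) = bprob p (pairs V) Q * bprob p (pairs V) R := by
  unfold bprob
  simp only [ind_and]
  exact bexp_mul_of_disjoint pairsAt_subset (fun S => by rw [propext (hQ S)])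
    (fun S => by rw [propext (hR S)])

lemma card_cn_le_add (U D : Finset V) (S : Finset (Sym2 V)) :
    #(cn S D Dᶜ) ≤ #(cn S D (U ∪ D)ᶜ) + #U := by
  refine (card_le_card ?_).trans (card_union_le _ _)
  intro w hw
  simp only [mem_union, mem_cn, mem_compl, not_or] at hw ⊢
  tauto

/-- Here `S` is the revealed configuration at `U` and `T` is the unrevealed rest. A vertex outside
`U ∪ D` sees `D` when it sees `U ∩ D` through `S` and `D \ U` through `T`. So the conditional count
is binomial, with one trial for each vertex that already sees `U ∩ D`. -/
lemma bexp_exp_card_cn (α : ℝ) (S : Finset (Sym2 V)) (hS : S ⊆ pairsAt U) :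
    bexp p (pairs V \ pairsAt U) (fun T => Real.exp (α * #(cn (S ∪ T) D (U ∪ D)ᶜ))) =
      (1 + p ^ #(D \ U) * (Real.exp α - 1)) ^ #(cn S (U ∩ D) (U ∪ D)ᶜ) := by
  set O := (U ∪ D)ᶜ with hO
  have hOU : ∀ w ∈ O, w ∉ U := fun w hw => by simp [hO] at hw; exact hw.1
  have hOD : ∀ w ∈ O, w ∉ D \ U := fun w hw => by simp [hO] at hw; simp [hw.2]
  have hsub : ∀ w ∈ O, star w (D \ U) ⊆ pairs V \ pairsAt U := fun w hw => by
    rw [subset_sdiff]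
    exact ⟨star_subset_pairs (hOD w hw), disjoint_star_pairsAt (hOU w hw) sdiff_disjoint⟩
  have hprod : ∀ T ⊆ pairs V \ pairsAt U, Real.exp (α * #(cn (S ∪ T) D O)) =
      ∏ w ∈ O, (1 + ind (star w (U ∩ D) ⊆ S) * ((Real.exp α - 1) * ind (star w (D \ U) ⊆ T))) := by
    intro T hT
    have hz : Real.exp α ^ #(cn (S ∪ T) D O) =
        ∏ w ∈ O, if star w D ⊆ S ∪ T then Real.exp α else 1 := by
      rw [prod_ite, prod_const, prod_const_one, mul_one]; rfl
    rw [mul_comm, Real.exp_nat_mul, hz]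
    refine prod_congr rfl fun w hw => ?_
    have hiff : star w D ⊆ S ∪ T ↔ star w (U ∩ D) ⊆ S ∧ star w (D \ U) ⊆ T := by
      have hd : Disjoint (star w (D \ U)) S :=
        disjoint_of_subset_right hS (disjoint_star_pairsAt (hOU w hw) sdiff_disjoint)
      have hd' : Disjoint (star w (U ∩ D)) T := by
        refine disjoint_of_subset_left ((star_mono inter_subset_left).trans
          (star_subset_pairsAt (hOU w hw))) ?_
        exact (disjoint_of_subset_left hT sdiff_disjoint).symm
      have hu : star w D = star w (U ∩ D) ∪ star w (D \ U) := by
        rw [star, star, star, ← image_union]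
        congr 1
        grind
      rw [hu, union_subset_iff]
      refine and_congr ⟨fun h => ?_, fun h => h.trans subset_union_left⟩
        ⟨fun h => ?_, fun h => h.trans subset_union_right⟩
      · exact hd'.left_le_of_le_sup_right h
      · exact hd.left_le_of_le_sup_left h
    by_cases h1 : star w (U ∩ D) ⊆ S <;> by_cases h2 : star w (D \ U) ⊆ T <;>
      simp [ind, hiff, h1, h2]
  rw [bexp_congr hprod, bexp_prod O _ (fun w => star w (D \ U)) hsub
    (fun w _ w' hw' h => disjoint_star (hOD w' hw') h)]
  · have : ∀ w ∈ O, bexp p (pairs V \ pairsAt U) (fun T => 1 + ind (star w (U ∩ D) ⊆ S) *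
        ((Real.exp α - 1) * ind (star w (D \ U) ⊆ T))) =
        if star w (U ∩ D) ⊆ S then 1 + p ^ #(D \ U) * (Real.exp α - 1) else 1 := by
      intro w hw
      have := bprob_subset (p := p) (hsub w hw)
      unfold bprob at this
      rw [bexp_add, bexp_const, bexp_const_mul, bexp_const_mul, this, card_star]
      split_ifs with h <;> simp [ind, h, mul_comm]
    rw [prod_congr rfl this, prod_ite, prod_const, prod_const_one, mul_one]
    rfl
  · intro w hw T
    rw [star_subset_inter (A := star w (D \ U)) subset_rfl]

/-- Exponential Markov inequality for the count of `D`, conditionally on the pairs at `U`. The cap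
`b` bounds the number of trials; the `#U` in the exponent pays for common neighbours of `D` that lie
in `U`. -/
lemma bprob_pair_le (h0 : 0 ≤ p) (h1 : p ≤ 1) {α t b : ℝ} (hα : 0 ≤ α) (U D : Finset V) :
    bprob p (pairs V) (fun S => t < #(cn S U Uᶜ) ∧ #(cn S (U ∩ D) Uᶜ) ≤ b ∧ t < #(cn S D Dᶜ)) ≤
      binTail #Uᶜ (p ^ #U) t *
        (Real.exp (-(α * (t - #U))) * (1 + p ^ #(D \ U) * (Real.exp α - 1)) ^ b) := by
  set c := 1 + p ^ #(D \ U) * (Real.exp α - 1) with hc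
  have hc1 : 1 ≤ c := by
    have : 0 ≤ Real.exp α - 1 := by linarith [Real.add_one_le_exp α]
    have := pow_nonneg h0 #(D \ U)
    rw [hc]; nlinarith
  have hUU : Disjoint U Uᶜ := disjoint_compl_right
  set f : Finset (Sym2 V) → ℝ := fun S => ind (t < #(cn S U Uᶜ) ∧ #(cn S (U ∩ D) Uᶜ) ≤ b) with hf
  have hfS : ∀ S, f S = f (S ∩ pairsAt U) := fun S => by
    simp only [hf]
    rw [cn_inter_pairsAt subset_rfl hUU, cn_inter_pairsAt inter_subset_left hUU]
  have hE : 0 < Real.exp (-(α * (t - #U))) := Real.exp_pos _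
  have hstep : ∀ S : Finset (Sym2 V),
      ind (t < #(cn S U Uᶜ) ∧ #(cn S (U ∩ D) Uᶜ) ≤ b ∧ t < #(cn S D Dᶜ)) ≤
        Real.exp (-(α * (t - #U))) * (f S * Real.exp (α * #(cn S D (U ∪ D)ᶜ))) := by
    intro S
    by_cases h : t < #(cn S U Uᶜ) ∧ #(cn S (U ∩ D) Uᶜ) ≤ b ∧ t < #(cn S D Dᶜ)
    · rw [ind_of h, hf]
      simp only
      rw [ind_of ⟨h.1, h.2.1⟩, one_mul, ← Real.exp_add]
      refine Real.one_le_exp ?_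
      have h2 : (#(cn S D Dᶜ) : ℝ) ≤ #(cn S D (U ∪ D)ᶜ) + #U := by
        exact_mod_cast card_cn_le_add U D S
      nlinarith [h.2.2]
    · rw [ind_of_not h]
      have := ind_nonneg (t < #(cn S U Uᶜ) ∧ #(cn S (U ∩ D) Uᶜ) ≤ b)
      positivity
  refine (bexp_mono h0 h1 fun S _ => hstep S).trans ?_
  rw [bexp_const_mul]
  have hAB : pairs V = pairsAt U ∪ (pairs V \ pairsAt U) :=
    (union_sdiff_of_subset pairsAt_subset).symm
  have hmain : bexp p (pairs V) (fun S => f S * Real.exp (α * #(cn S D (U ∪ D)ᶜ))) ≤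
      bexp p (pairs V) f * c ^ b := by
    rw [bexp_restrict pairsAt_subset hfS, ← bexp_mul_const]
    conv_lhs => rw [hAB, bexp_union disjoint_sdiff]
    refine bexp_mono h0 h1 fun S hS => ?_
    have : ∀ T ⊆ pairs V \ pairsAt U, f (S ∪ T) = f S := fun T hT => by
      rw [hfS (S ∪ T), hfS S]
      congr 1
      grind
    rw [bexp_congr (fun T hT => by rw [this T hT]), bexp_const_mul, bexp_exp_card_cn α S hS]
    by_cases h : t < #(cn S U Uᶜ) ∧ #(cn S (U ∩ D) Uᶜ) ≤ b
    · refine mul_le_mul_of_nonneg_left ?_ (ind_nonneg _)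
      rw [← Real.rpow_natCast]
      refine Real.rpow_le_rpow_of_exponent_le hc1 (le_trans ?_ h.2)
      exact_mod_cast card_le_card (fun w hw => by
        simp only [mem_cn, mem_compl, mem_union, not_or] at hw ⊢
        tauto)
    · simp only [hf]
      rw [ind_of_not h]; simp
  have hfle : bexp p (pairs V) f ≤ binTail #Uᶜ (p ^ #U) t := by
    rw [← bprob_lt_card_cn hUU]
    exact bprob_mono h0 h1 fun S _ h => h.1
  have hcb : 0 ≤ c ^ b := Real.rpow_nonneg (by linarith) _
  calc _ ≤ Real.exp (-(α * (t - #U))) * (binTail #Uᶜ (p ^ #U) t * c ^ b) := by gcongr; exact hmain.trans (by gcongr)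
    _ = _ := by ring

end Pairs

/-! ### Approximate Poisson recursion for the number of exceedances. -/

section Stein

variable {V : Type*} [DecidableEq V] [Fintype V] {U D : Finset V} {p t : ℝ} {k : ℕ}

open Classical in
/-- The number of `k`-element sets of vertices with more than `t` common neighbours. -/
noncomputable def exceedances (t : ℝ) (k : ℕ) (S : Finset (Sym2 V)) : ℕ :=
  #{D ∈ (univ : Finset V).powersetCard k | t < #(cn S D Dᶜ)}

open Classical in
/-- The number of `k`-element sets of vertices that are disjoint from `U` and have more than `t`
common neighbours outside `U`. -/
noncomputable def exceedancesOff (t : ℝ) (k : ℕ) (U : Finset V) (S : Finset (Sym2 V)) : ℕ :=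
  #{D ∈ (univ : Finset V).powersetCard k | Disjoint D U ∧ t < #(cn S D (U ∪ D)ᶜ)}

lemma sum_ind_eq_card {ι : Type*} (s : Finset ι) (Q : ι → Prop) [DecidablePred Q] :
    ∑ i ∈ s, ind (Q i) = #{i ∈ s | Q i} := by
  rw [card_filter, Nat.cast_sum]
  refine sum_congr rfl fun i _ => ?_
  by_cases h : Q i <;> simp [ind, h]

lemma abs_bprob_sub_le {α : Type*} {A : Finset α} (h0 : 0 ≤ p) (h1 : p ≤ 1)
    {Q R : Finset α → Prop} :
    |bprob p A Q - bprob p A R| ≤ bprob p A fun S => ¬ (Q S ↔ R S) := by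
  unfold bprob
  rw [abs_le, neg_le_iff_add_nonneg, sub_le_iff_le_add, ← bexp_sub, ← bexp_add, ← bexp_add]
  classical
  refine ⟨bexp_nonneg h0 h1 fun S _ => ?_, bexp_mono h0 h1 fun S _ => ?_⟩ <;>
  by_cases hQ : Q S <;> by_cases hR : R S <;> simp [ind, hQ, hR]

/-- The first event is decided by the pairs that meet `U`, the second by the other pairs: its sets
`D` avoid `U`, and so do the common neighbours it counts. -/
lemma bprob_and_exceedancesOff (U : Finset V) (i : ℕ) :
    bprob p (pairs V) (fun S => t < #(cn S U Uᶜ) ∧ exceedancesOff t k U S = i) =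
      bprob p (pairs V) (fun S => t < #(cn S U Uᶜ)) *
        bprob p (pairs V) (fun S => exceedancesOff t k U S = i) := by
  refine bprob_and_of_disjoint (U := U)
    (Q := fun S => t < #(cn S U Uᶜ)) (R := fun S => exceedancesOff t k U S = i) ?_ ?_
  · intro S
    rw [cn_inter_pairsAt subset_rfl disjoint_compl_right]
  · intro S
    unfold exceedancesOff
    have : ∀ D, (Disjoint D U ∧ t < #(cn S D (U ∪ D)ᶜ)) ↔
        (Disjoint D U ∧ t < #(cn (S \ pairsAt U) D (U ∪ D)ᶜ)) := fun D => by
      refine and_congr_right fun h => ?_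
      rw [cn_sdiff_pairsAt h]
      exact disjoint_of_subset_left subset_union_left disjoint_compl_right
    simp only [this]

/-- On `X = i + 1` the indicators of the exceedances add up to `i + 1`, which turns the left-hand
term into a sum over `U`. Each summand is compared with the probability that `U` exceeds and
`exceedancesOff = i`, which factors; the two errors measure replacing `X` by `exceedancesOff + 1` on
the exceedance of `U`, and replacing `exceedancesOff` by `X` without it. -/
lemma abs_mul_bprob_exceedances_sub_le (h0 : 0 ≤ p) (h1 : p ≤ 1) (i : ℕ) :
    |((i + 1 : ℕ) : ℝ) * bprob p (pairs V) (fun S => exceedances t k S = i + 1) -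
      (∑ U ∈ (univ : Finset V).powersetCard k, bprob p (pairs V) fun S => t < #(cn S U Uᶜ)) *
        bprob p (pairs V) (fun S => exceedances t k S = i)| ≤
    ∑ U ∈ (univ : Finset V).powersetCard k,
      (bprob p (pairs V)
          (fun S => t < #(cn S U Uᶜ) ∧ exceedances t k S ≠ exceedancesOff t k U S + 1) +
        bprob p (pairs V) (fun S => t < #(cn S U Uᶜ)) *
          bprob p (pairs V) (fun S => exceedances t k S ≠ exceedancesOff t k U S)) := by
  classical
  have hsum : ((i + 1 : ℕ) : ℝ) * bprob p (pairs V) (fun S => exceedances t k S = i + 1) =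
      ∑ U ∈ (univ : Finset V).powersetCard k,
        bprob p (pairs V) (fun S => t < #(cn S U Uᶜ) ∧ exceedances t k S = i + 1) := by
    unfold bprob
    rw [← bexp_sum, ← bexp_const_mul]
    refine bexp_congr fun S _ => ?_
    simp only [ind_and]
    rw [← sum_mul, sum_ind_eq_card]
    by_cases h : exceedances t k S = i + 1
    · rw [← h, exceedances]
    · rw [ind_of_not h, mul_zero, mul_zero]
  rw [hsum, sum_mul, ← sum_sub_distrib]
  refine (abs_sum_le_sum_abs _ _).trans (sum_le_sum fun U _ => ?_)
  have hI := bprob_nonneg (p := p) (A := pairs V) (Q := fun S => t < #(cn S U Uᶜ)) h0 h1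
  refine (abs_sub_le _ (bprob p (pairs V)
    (fun S => t < #(cn S U Uᶜ) ∧ exceedancesOff t k U S = i)) _).trans (add_le_add ?_ ?_)
  · refine (abs_bprob_sub_le h0 h1).trans (bprob_mono h0 h1 fun S _ => ?_)
    by_cases h : t < #(cn S U Uᶜ)
    · simp only [h, true_and]
      omega
    · simp [h]
  · rw [bprob_and_exceedancesOff, ← mul_sub, abs_mul, abs_of_nonneg hI]
    refine mul_le_mul_of_nonneg_left ?_ hI
    refine (abs_bprob_sub_le h0 h1).trans (bprob_mono h0 h1 fun S _ => ?_)
    omega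

/-- The two counts treat `D` differently only if `D` meets `U`, or if discarding the at most `k`
common neighbours inside `U` brings the count of `D` down past `t`. -/
lemma exists_meet_or_near_of_ne {S : Finset (Sym2 V)}
    (hU : #U = k) (h : exceedances t k S ≠ exceedancesOff t k U S) :
    (∃ D ∈ (univ : Finset V).powersetCard k, ¬ Disjoint D U ∧ t < #(cn S D Dᶜ)) ∨
    ∃ D ∈ (univ : Finset V).powersetCard k, Disjoint D U ∧
      t - k < #(cn S D (U ∪ D)ᶜ) ∧ ¬ t < #(cn S D (U ∪ D)ᶜ) := by
  by_contra! hc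
  obtain ⟨h1, h2⟩ := hc
  refine h ?_
  unfold exceedances exceedancesOff
  congr 1
  refine filter_congr fun D hD => ?_
  constructor
  · intro hD'
    have hdis : Disjoint D U := by
      by_contra hd
      exact absurd (h1 D hD hd) (not_le.2 hD')
    refine ⟨hdis, h2 D hD hdis ?_⟩
    have : (#(cn S D Dᶜ) : ℝ) ≤ #(cn S D (U ∪ D)ᶜ) + #U := by exact_mod_cast card_cn_le_add U D S
    rw [hU] at this
    linarith
  · rintro ⟨_, h⟩
    refine h.trans_le ?_
    exact_mod_cast card_le_card fun w hw => by
      simp only [mem_cn, mem_compl, mem_union, not_or] at hw ⊢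
      tauto

lemma exists_overlap_or_near_of_exceedance {S : Finset (Sym2 V)} (hk : 1 ≤ k)
    (hU : #U = k) (hUt : t < #(cn S U Uᶜ))
    (h : exceedances t k S ≠ exceedancesOff t k U S + 1) :
    (∃ D ∈ (univ : Finset V).powersetCard k, (D ≠ U ∧ ¬ Disjoint D U) ∧ t < #(cn S D Dᶜ)) ∨
    ∃ D ∈ (univ : Finset V).powersetCard k, Disjoint D U ∧
      t - k < #(cn S D (U ∪ D)ᶜ) ∧ ¬ t < #(cn S D (U ∪ D)ᶜ) := by
  classical
  by_contra! hc
  obtain ⟨h1, h2⟩ := hc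
  refine h ?_
  unfold exceedances exceedancesOff
  have hUU : ¬ Disjoint U U := by
    rw [disjoint_self, ← ne_eq, bot_eq_empty, ← nonempty_iff_ne_empty, ← card_pos]
    omega
  -- The extra `1` is `U` itself, which is not counted among the sets disjoint from `U` because `k ≥
  -- 1` makes it nonempty.
  rw [← card_insert_of_notMem (a := U) (fun h => hUU (mem_filter.1 h).2.1)]
  congr 1
  ext D
  simp only [mem_insert, mem_filter]
  constructor
  · rintro ⟨hD, hD'⟩
    by_cases hDU : D = U
    · exact Or.inl hDU
    right
    have hdis : Disjoint D U := by
      by_contra hd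
      exact absurd (h1 D hD ⟨hDU, hd⟩) (not_le.2 hD')
    refine ⟨hD, hdis, h2 D hD hdis ?_⟩
    have : (#(cn S D Dᶜ) : ℝ) ≤ #(cn S D (U ∪ D)ᶜ) + #U := by exact_mod_cast card_cn_le_add U D S
    rw [hU] at this
    linarith
  · rintro (rfl | ⟨hD, _, h⟩)
    · exact ⟨by simp [hU], hUt⟩
    · refine ⟨hD, h.trans_le ?_⟩
      exact_mod_cast card_le_card fun w hw => by
        simp only [mem_cn, mem_compl, mem_union, not_or] at hw ⊢
        tauto

/-- With `U ∩ D = W` fixed, `D` is determined by `D \ U`, which has `k - #W` elements. -/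
lemma card_powersetCard_inter_eq_le (W : Finset V) :
    #{D ∈ (univ : Finset V).powersetCard k | U ∩ D = W} ≤ Fintype.card V ^ (k - #W) := by
  classical
  refine le_trans ?_ ((Nat.choose_le_pow _ _).trans' (card_powersetCard (k - #W) (univ : Finset V)).le)
  refine card_le_card_of_injOn (fun D => D \ U) ?_ ?_
  · intro D hD
    simp only [coe_filter, Set.mem_ofPred_eq, mem_powersetCard_univ, mem_coe] at hD ⊢
    rw [← hD.1, ← hD.2, card_sdiff]
  · intro D hD D' hD' h
    simp only [coe_filter, Set.mem_ofPred_eq] at hD hD'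
    have e : ∀ D : Finset V, D = (U ∩ D) ∪ (D \ U) := fun D => by grind
    dsimp only at h
    rw [e D, e D', hD.2, hD'.2, h]

lemma card_powersetCard_meet_le (hU : #U = k) :
    #{D ∈ (univ : Finset V).powersetCard k | ¬ Disjoint D U} ≤ k * Fintype.card V ^ (k - 1) := by
  classical
  have hsub : ({D ∈ (univ : Finset V).powersetCard k | ¬ Disjoint D U} : Finset (Finset V)) ⊆
      U.biUnion fun u => {D ∈ (univ : Finset V).powersetCard k | {u} ∩ D = {u}} := by
    intro D hD
    simp only [mem_filter, Finset.not_disjoint_iff] at hD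
    obtain ⟨hD, u, hu, hu'⟩ := hD
    simp only [mem_biUnion, mem_filter]
    exact ⟨u, hu', hD, by simpa using hu⟩
  refine (card_le_card hsub).trans (card_biUnion_le.trans ?_)
  rw [← hU, ← smul_eq_mul, ← sum_const]
  refine sum_le_sum fun u _ => (card_powersetCard_inter_eq_le {u}).trans ?_
  simp

lemma bprob_near_eq (hD : #D = k) (hU : #U = k) (hDU : Disjoint D U) :
    bprob p (pairs V) (fun S => t - k < #(cn S D (U ∪ D)ᶜ) ∧ ¬ t < #(cn S D (U ∪ D)ᶜ)) =
      binTail (Fintype.card V - 2 * k) (p ^ k) (t - k) -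
        binTail (Fintype.card V - 2 * k) (p ^ k) t := by
  have hO : Disjoint D (U ∪ D)ᶜ :=
    disjoint_of_subset_left subset_union_right disjoint_compl_right
  have hc : #(U ∪ D)ᶜ = Fintype.card V - 2 * k := by
    rw [card_compl, card_union_of_disjoint hDU.symm, hD, hU, two_mul]
  rw [← hc, ← hD, ← bprob_lt_card_cn hO, ← bprob_lt_card_cn hO]
  unfold bprob
  rw [← bexp_sub]
  refine bexp_congr fun S _ => ?_
  have : (0 : ℝ) ≤ #D := Nat.cast_nonneg _
  beta_reduce
  generalize (#(cn S D (U ∪ D)ᶜ) : ℝ) = x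
  by_cases h : t < x
  · have h' : t - #D < x := by linarith
    rw [ind_of h, ind_of h', ind_of_not fun h'' => h''.2 h, sub_self]
  · simp only [ind, h, not_false_eq_true, and_true, if_false, sub_zero]

lemma bprob_lt_card_cn_compl (hU : #U = k) :
    bprob p (pairs V) (fun S => t < #(cn S U Uᶜ)) =
      binTail (Fintype.card V - k) (p ^ k) t := by
  rw [bprob_lt_card_cn disjoint_compl_right, card_compl, hU]

variable {τ δ : ℝ}

lemma sum_bprob_near_le (hU : #U = k) (h0 : 0 ≤ p) (h1 : p ≤ 1)
    (hδ : binTail (Fintype.card V - 2 * k) (p ^ k) (t - k) -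
        binTail (Fintype.card V - 2 * k) (p ^ k) t = δ) (hδ0 : 0 ≤ δ) :
    bprob p (pairs V) (fun S => ∃ D ∈ (univ : Finset V).powersetCard k, Disjoint D U ∧
      t - k < #(cn S D (U ∪ D)ᶜ) ∧ ¬ t < #(cn S D (U ∪ D)ᶜ)) ≤
      (Fintype.card V).choose k * δ := by
  refine (bprob_exists_le _ _ h0 h1).trans ?_
  have hcard : (Fintype.card V).choose k = #((univ : Finset V).powersetCard k) := by
    rw [card_powersetCard, card_univ]
  rw [hcard, ← nsmul_eq_mul, ← sum_const]
  refine sum_le_sum fun D hD => ?_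
  have hD' : #D = k := mem_powersetCard_univ.1 hD
  by_cases h : Disjoint D U
  · simp only [h, true_and]
    exact ((bprob_near_eq hD' hU h).trans hδ).le
  · simp only [h, false_and]
    unfold bprob
    rw [bexp_congr (g := fun _ => 0) (fun S _ => ind_of_not id), bexp_const]
    exact hδ0

lemma bprob_exceedances_ne_le (hU : #U = k) (h0 : 0 ≤ p) (h1 : p ≤ 1)
    (hτ : binTail (Fintype.card V - k) (p ^ k) t = τ)
    (hδ : binTail (Fintype.card V - 2 * k) (p ^ k) (t - k) -
        binTail (Fintype.card V - 2 * k) (p ^ k) t = δ) (hδ0 : 0 ≤ δ) (hτ0 : 0 ≤ τ) :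
    bprob p (pairs V) (fun S => exceedances t k S ≠ exceedancesOff t k U S) ≤
      k * (Fintype.card V : ℝ) ^ (k - 1) * τ + (Fintype.card V).choose k * δ := by
  classical
  refine (bprob_mono h0 h1 fun S _ => exists_meet_or_near_of_ne hU).trans
    ((bprob_or_le h0 h1).trans (add_le_add ?_ (sum_bprob_near_le hU h0 h1 hδ hδ0)))
  have : bprob p (pairs V) (fun S => ∃ D ∈ (univ : Finset V).powersetCard k,
        ¬ Disjoint D U ∧ t < #(cn S D Dᶜ)) ≤
      bprob p (pairs V) (fun S => ∃ D ∈ {D ∈ (univ : Finset V).powersetCard k | ¬ Disjoint D U},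
        t < #(cn S D Dᶜ)) := by
    refine bprob_mono h0 h1 fun S _ => ?_
    rintro ⟨D, hD, hD', h⟩
    exact ⟨D, mem_filter.2 ⟨hD, hD'⟩, h⟩
  refine this.trans ((bprob_exists_le _ _ h0 h1).trans ?_)
  rw [sum_congr rfl (g := fun _ => τ), sum_const, nsmul_eq_mul]
  · refine mul_le_mul_of_nonneg_right ?_ hτ0
    exact_mod_cast card_powersetCard_meet_le hU
  · intro D hD
    rw [bprob_lt_card_cn_compl (mem_powersetCard_univ.1 (mem_filter.1 hD).1), hτ]

/-- The overlapping `D` are grouped by `W = U ∩ D`. That `W` has unusually many common neighbours is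
paid for once per `W`, by `ε`, rather than once per `D`; otherwise the pair bound applies to each of
the at most `n ^ (k - r)` sets `D`. The near misses of disjoint sets are independent of the
exceedance of `U`, hence the factor `τ` in the last term. -/
lemma bprob_exceedance_and_ne_le (hk : 1 ≤ k) (hU : #U = k) (h0 : 0 ≤ p) (h1 : p ≤ 1)
    (hτ : binTail (Fintype.card V - k) (p ^ k) t = τ)
    (hδ : binTail (Fintype.card V - 2 * k) (p ^ k) (t - k) -
        binTail (Fintype.card V - 2 * k) (p ^ k) t = δ) (hδ0 : 0 ≤ δ) (hτ0 : 0 ≤ τ)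
    {α : ℝ} (hα : 0 ≤ α) (b ε η : ℕ → ℝ)
    (hε : ∀ W ⊆ U, #W ∈ Ico 1 k →
      bprob p (pairs V) (fun S => t < #(cn S U Uᶜ) ∧ b #W < #(cn S W Uᶜ)) ≤ ε #W)
    (hη : ∀ r ∈ Ico 1 k,
      Real.exp (-(α * (t - k))) * (1 + p ^ (k - r) * (Real.exp α - 1)) ^ b r ≤ η r)
    (hη0 : ∀ r, 0 ≤ η r) :
    bprob p (pairs V)
        (fun S => t < #(cn S U Uᶜ) ∧ exceedances t k S ≠ exceedancesOff t k U S + 1) ≤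
      ∑ r ∈ Ico 1 k, k.choose r * (ε r + (Fintype.card V : ℝ) ^ (k - r) * (τ * η r)) +
        τ * ((Fintype.card V).choose k * δ) := by
  classical
  set 𝒰 := (univ : Finset V).powersetCard k with h𝒰
  set Ws : Finset (Finset V) := {W ∈ U.powerset | #W ∈ Ico 1 k} with hWs
  set Ds : Finset (Finset V) := {D ∈ 𝒰 | D ≠ U ∧ ¬ Disjoint D U} with hDs
  have hinter : ∀ D ∈ Ds, U ∩ D ∈ Ws ∧ #D = k := by
    intro D hD
    simp only [hDs, hWs, h𝒰, mem_filter, mem_powersetCard_univ, mem_powerset, mem_Ico] at hD ⊢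
    refine ⟨⟨inter_subset_left, ?_, ?_⟩, hD.1⟩
    · rw [Nat.one_le_iff_ne_zero, ne_eq, card_eq_zero, ← disjoint_iff_inter_eq_empty]
      exact fun h => hD.2.2 h.symm
    · rw [← hU]
      refine card_lt_card ⟨inter_subset_left, fun h => hD.2.1 ?_⟩
      exact (eq_of_subset_of_card_le (h.trans inter_subset_right) (by omega)).symm
  have hmono : ∀ S ⊆ pairs V,
      (t < #(cn S U Uᶜ) ∧ exceedances t k S ≠ exceedancesOff t k U S + 1) →
      ((∃ W ∈ Ws, t < #(cn S U Uᶜ) ∧ b #W < #(cn S W Uᶜ)) ∨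
        ∃ D ∈ Ds, t < #(cn S U Uᶜ) ∧ #(cn S (U ∩ D) Uᶜ) ≤ b #(U ∩ D) ∧ t < #(cn S D Dᶜ)) ∨
      (t < #(cn S U Uᶜ) ∧ ∃ D ∈ 𝒰, Disjoint D U ∧
        t - k < #(cn S D (U ∪ D)ᶜ) ∧ ¬ t < #(cn S D (U ∪ D)ᶜ)) := by
    rintro S _ ⟨h, h'⟩
    rcases exists_overlap_or_near_of_exceedance hk hU h h' with ⟨D, hD, hD', hDt⟩ | h''
    · left
      have hDs' : D ∈ Ds := mem_filter.2 ⟨hD, hD'⟩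
      by_cases hb : b #(U ∩ D) < #(cn S (U ∩ D) Uᶜ)
      · exact Or.inl ⟨U ∩ D, (hinter D hDs').1, h, hb⟩
      · exact Or.inr ⟨D, hDs', h, not_lt.1 hb, hDt⟩
    · exact Or.inr ⟨h, h''⟩
  have hW : ∀ g : ℕ → ℝ, ∑ W ∈ Ws, g #W = ∑ r ∈ Ico 1 k, k.choose r * g r := by
    intro g
    rw [hWs, sum_filter, sum_powerset_apply_card (fun j => if j ∈ Ico 1 k then g j else 0), hU]
    simp only [nsmul_eq_mul, mul_ite, mul_zero]
    rw [← sum_filter]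
    refine sum_congr ?_ fun _ _ => rfl
    ext r; simp only [mem_filter, mem_range, mem_Ico]; omega
  refine (bprob_mono h0 h1 hmono).trans ((bprob_or_le h0 h1).trans (add_le_add ?_ ?_))
  · refine (bprob_or_le h0 h1).trans ?_
    have e1 : bprob p (pairs V) (fun S => ∃ W ∈ Ws, t < #(cn S U Uᶜ) ∧ b #W < #(cn S W Uᶜ)) ≤
        ∑ r ∈ Ico 1 k, k.choose r * ε r := by
      rw [← hW]
      refine (bprob_exists_le _ _ h0 h1).trans (sum_le_sum fun W hW' => ?_)
      exact hε W (mem_powerset.1 (mem_filter.1 hW').1) (mem_filter.1 hW').2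
    have e2 : bprob p (pairs V) (fun S => ∃ D ∈ Ds, t < #(cn S U Uᶜ) ∧
          #(cn S (U ∩ D) Uᶜ) ≤ b #(U ∩ D) ∧ t < #(cn S D Dᶜ)) ≤
        ∑ r ∈ Ico 1 k, k.choose r * ((Fintype.card V : ℝ) ^ (k - r) * (τ * η r)) := by
      rw [← hW (fun r => (Fintype.card V : ℝ) ^ (k - r) * (τ * η r))]
      refine (bprob_exists_le _ _ h0 h1).trans ?_
      rw [← sum_fiberwise_of_maps_to (g := fun D => U ∩ D) (fun D hD => (hinter D hD).1)]
      refine sum_le_sum fun W hW' => ?_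
      have hb : ∀ D ∈ {D ∈ Ds | U ∩ D = W}, bprob p (pairs V) (fun S => t < #(cn S U Uᶜ) ∧
          #(cn S (U ∩ D) Uᶜ) ≤ b #(U ∩ D) ∧ t < #(cn S D Dᶜ)) ≤ τ * η #W := by
        intro D hD
        obtain ⟨hD₁, rfl⟩ := mem_filter.1 hD
        refine (bprob_pair_le h0 h1 hα U D).trans ?_
        rw [card_compl, hU, hτ, card_sdiff, (hinter D hD₁).2]
        exact mul_le_mul_of_nonneg_left (hη _ (mem_filter.1 hW').2) hτ0
      refine (sum_le_card_nsmul _ _ _ hb).trans ?_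
      rw [nsmul_eq_mul]
      refine mul_le_mul_of_nonneg_right ?_ (mul_nonneg hτ0 (hη0 _))
      refine le_trans ?_ (Nat.cast_le.2 (card_powersetCard_inter_eq_le (U := U) (k := k) W)) |>.trans
        (Nat.cast_pow _ _).le
      refine Nat.cast_le.2 (card_le_card fun D hD => ?_)
      obtain ⟨hD, h⟩ := mem_filter.1 hD
      exact mem_filter.2 ⟨(mem_filter.1 hD).1, h⟩
    simp only [mul_add, sum_add_distrib]
    exact add_le_add e1 e2
  · rw [bprob_and_of_disjoint (U := U) (Q := fun S => t < #(cn S U Uᶜ))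
      (R := fun S => ∃ D ∈ 𝒰, Disjoint D U ∧
        t - k < #(cn S D (U ∪ D)ᶜ) ∧ ¬ t < #(cn S D (U ∪ D)ᶜ)), bprob_lt_card_cn_compl hU, hτ]
    · exact mul_le_mul_of_nonneg_left (sum_bprob_near_le hU h0 h1 hδ hδ0) hτ0
    · intro S
      rw [cn_inter_pairsAt subset_rfl disjoint_compl_right]
    · intro S
      refine exists_congr fun D => and_congr_right fun _ => and_congr_right fun h => ?_
      rw [cn_sdiff_pairsAt h]
      exact disjoint_of_subset_left subset_union_left disjoint_compl_right

end Stein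

/-! ### From order statistics to counts, and from the recursion to the Poisson law. -/

section Reduction

/-- For `t ≥ 0`, exceeding `t` means reaching the integer `⌊t⌋₊ + 1`. The assumption `m ≥ 1` keeps
the set under the supremum bounded. -/
lemma mthLargest_le_iff {ι : Type*} {m : ℕ} (hm : 1 ≤ m) (s : Finset ι) (f : ι → ℕ) {t : ℝ}
    (ht : 0 ≤ t) [DecidablePred fun i => t < f i] :
    (mthLargest m s f : ℝ) ≤ t ↔ #{i ∈ s | t < f i} < m := by
  classical
  have hbdd : BddAbove {t : ℕ | m ≤ #{i ∈ s | t ≤ f i}} := by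
    refine ⟨s.sup f, fun t ht => ?_⟩
    have ht' : m ≤ #{i ∈ s | t ≤ f i} := ht
    obtain ⟨i, hi⟩ := card_pos.1 (lt_of_lt_of_le hm ht')
    exact (mem_filter.1 hi).2.trans (le_sup (mem_filter.1 hi).1)
  have hfloor : ∀ i, t < f i ↔ ⌊t⌋₊ + 1 ≤ f i := fun i => by
    rw [Nat.succ_le_iff, Nat.floor_lt ht]
  simp only [hfloor]
  rw [← Nat.le_floor_iff ht, ← not_le, ← not_lt, not_iff_not]
  unfold mthLargest
  constructor
  · intro h
    -- In `ℕ` the supremum of the empty set is `0`, which cannot exceed `⌊t⌋₊`.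
    have hne : {t : ℕ | m ≤ #{i ∈ s | t ≤ f i}}.Nonempty := by
      by_contra hne
      rw [Set.not_nonempty_iff_eq_empty] at hne
      simp [hne] at h
    have hmem : m ≤ #{i ∈ s | sSup {t : ℕ | m ≤ #{i ∈ s | t ≤ f i}} ≤ f i} :=
      Nat.sSup_mem hne hbdd
    refine hmem.trans (card_le_card fun i hi => ?_)
    rw [mem_filter] at hi ⊢
    exact ⟨hi.1, (Nat.succ_le_of_lt h).trans hi.2⟩
  · intro h
    exact Nat.lt_of_succ_le (le_csSup hbdd h)

lemma binomialRandom_real_mthMaxCommonNbrs_le {V : Type*} [DecidableEq V] [Fintype V] {k m : ℕ}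
    (hm : 1 ≤ m) (p : unitInterval) {a σ y : ℝ} (hσ : 0 < σ) (ht : 0 ≤ a + σ * y) :
    (SimpleGraph.binomialRandom V p).real
        {G : SimpleGraph V | ((mthMaxCommonNbrs k m G : ℝ) - a) / σ ≤ y} =
      ∑ i ∈ range m, bprob (p : ℝ) (pairs V) fun S => exceedances (a + σ * y) k S = i := by
  classical
  rw [binomialRandom_real_eq]
  unfold bprob
  rw [← bexp_sum]
  refine bexp_congr fun S hS => ?_
  have h1 : ((mthMaxCommonNbrs k m (SimpleGraph.fromEdgeSet (S : Set (Sym2 V))) : ℝ) - a) / σ ≤ y ↔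
      exceedances (a + σ * y) k S < m := by
    rw [div_le_iff₀ hσ, sub_le_iff_le_add', mul_comm y, mthMaxCommonNbrs, mthLargest_le_iff hm _ _ ht,
      exceedances]
    simp only [commonNbrs_fromEdgeSet hS]
  beta_reduce
  rw [propext h1, sum_ind_eq_card]
  by_cases h : exceedances (a + σ * y) k S < m
  · rw [ind_of h]
    have : {i ∈ range m | exceedances (a + σ * y) k S = i} = {exceedances (a + σ * y) k S} := by
      ext i; simp only [mem_filter, mem_range, mem_singleton]; omega
    rw [this]; simp
  · rw [ind_of_not h]
    symm
    rw [Nat.cast_eq_zero, card_eq_zero, filter_eq_empty_iff]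
    intro i hi
    rw [mem_range] at hi
    omega

/-- Markov's inequality for the number of exceedances, which prevents mass from escaping to infinity
in the Poisson limit. -/
lemma one_sub_le_sum_bprob {V : Type*} [DecidableEq V] [Fintype V] {k : ℕ} {p t : ℝ}
    (h0 : 0 ≤ p) (h1 : p ≤ 1) {K : ℕ} (hK : 0 < K) :
    1 - (∑ U ∈ (univ : Finset V).powersetCard k, bprob p (pairs V) fun S => t < #(cn S U Uᶜ)) / K ≤
      ∑ i ∈ range K, bprob p (pairs V) fun S => exceedances t k S = i := by
  classical
  have hK' : (0 : ℝ) < K := Nat.cast_pos.2 hK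
  unfold bprob
  rw [← bexp_sum, ← bexp_sum, div_eq_mul_inv, ← bexp_mul_const, sub_le_iff_le_add, ← bexp_add,
    ← bexp_const (p := p) (A := pairs V) 1]
  refine bexp_mono h0 h1 fun S _ => ?_
  rw [sum_ind_eq_card, sum_ind_eq_card]
  by_cases h : exceedances t k S < K
  · have : 1 ≤ #{i ∈ range K | exceedances t k S = i} :=
      card_pos.2 ⟨_, mem_filter.2 ⟨mem_range.2 h, rfl⟩⟩
    have : (1 : ℝ) ≤ #{i ∈ range K | exceedances t k S = i} := by exact_mod_cast this
    have h2 : (0 : ℝ) ≤ #{D ∈ (univ : Finset V).powersetCard k | t < #(cn S D Dᶜ)} * (K : ℝ)⁻¹ := by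
      positivity
    linarith
  · have h2 : (K : ℝ) ≤ #{D ∈ (univ : Finset V).powersetCard k | t < #(cn S D Dᶜ)} :=
      Nat.cast_le.2 (not_lt.1 h)
    have h3 : 1 ≤ #{D ∈ (univ : Finset V).powersetCard k | t < #(cn S D Dᶜ)} * (K : ℝ)⁻¹ := by
      rwa [← div_eq_mul_inv, one_le_div hK']
    have : (0 : ℝ) ≤ #{i ∈ range K | exceedances t k S = i} := Nat.cast_nonneg _
    linarith

lemma sum_bprob_le_one {V : Type*} [DecidableEq V] [Fintype V] {k : ℕ} {p t : ℝ}
    (h0 : 0 ≤ p) (h1 : p ≤ 1) (K : ℕ) :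
    ∑ i ∈ range K, bprob p (pairs V) (fun S => exceedances t k S = i) ≤ 1 := by
  classical
  unfold bprob
  rw [← bexp_sum, ← bexp_const (p := p) (A := pairs V) 1]
  refine bexp_mono h0 h1 fun S _ => ?_
  rw [sum_ind_eq_card, ← Nat.cast_one, Nat.cast_le, card_le_one]
  intro a ha b hb
  rw [← (mem_filter.1 ha).2, (mem_filter.1 hb).2]

/-- A sequence of laws on the natural numbers that satisfies the recursion characterizing the
Poisson law up to vanishing errors, with bounded means, converges to the Poisson law. -/
lemma tendsto_poisson_of_recursion {q : ℕ → ℕ → ℝ} {lam : ℕ → ℝ} {μ : ℝ} (hμ : 0 ≤ μ)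
    (hq0 : ∀ n i, 0 ≤ q n i) (hq1 : ∀ n K, ∑ i ∈ range K, q n i ≤ 1)
    (hmean : ∀ n K, 0 < K → 1 - lam n / K ≤ ∑ i ∈ range K, q n i)
    (hlam : Tendsto lam atTop (𝓝 μ))
    (hrec : ∀ i : ℕ,
      Tendsto (fun n => ((i + 1 : ℕ) : ℝ) * q n (i + 1) - lam n * q n i) atTop (𝓝 0)) (m : ℕ) :
    Tendsto (fun n => ∑ i ∈ range m, q n i) atTop
      (𝓝 (Real.exp (-μ) * ∑ i ∈ range m, μ ^ i / (i.factorial : ℝ))) := by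
  have hq1' : ∀ n i, q n i ≤ 1 := fun n i => by
    refine le_trans ?_ (hq1 n (i + 1))
    exact single_le_sum (f := q n) (fun j _ => hq0 n j) (mem_range.2 (Nat.lt_succ_self i))
  have hlamq : ∀ i, Tendsto (fun n => (lam n - μ) * q n i) atTop (𝓝 0) := by
    intro i
    have h1 : Tendsto (fun n => |lam n - μ|) atTop (𝓝 0) := by
      simpa using (hlam.sub_const μ).abs
    refine squeeze_zero_norm (fun n => ?_) h1
    rw [Real.norm_eq_abs, abs_mul, abs_of_nonneg (hq0 n i)]
    exact mul_le_of_le_one_right (abs_nonneg _) (hq1' n i)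
  -- The recursion determines every `q n i` from `q n 0` up to `o(1)`; only the normalization then
  -- remains.
  have hlim : ∀ i, Tendsto (fun n => q n i - q n 0 * (μ ^ i / (i.factorial : ℝ))) atTop (𝓝 0) := by
    intro i
    induction i with
    | zero => simp
    | succ i ih =>
      have h := (((hrec i).add (hlamq i)).add (ih.const_mul μ)).div_const ((i + 1 : ℕ) : ℝ)
      simp only [mul_zero, add_zero, zero_div] at h
      refine h.congr fun n => ?_
      have : ((i + 1 : ℕ) : ℝ) ≠ 0 := by positivity
      rw [Nat.factorial_succ, pow_succ]
      push_cast at this ⊢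
      have h2 : (i.factorial : ℝ) ≠ 0 := by positivity
      field_simp
      ring
  have hsumlim : ∀ K, Tendsto (fun n => ∑ i ∈ range K, q n i -
      q n 0 * ∑ i ∈ range K, μ ^ i / (i.factorial : ℝ)) atTop (𝓝 0) := by
    intro K
    have := tendsto_finsetSum (range K) fun i _ => hlim i
    simpa [sum_sub_distrib, mul_sum] using this
  have hexp : Tendsto (fun K => ∑ i ∈ range K, μ ^ i / (i.factorial : ℝ)) atTop
      (𝓝 (Real.exp μ)) := by
    rw [Real.exp_eq_exp_ℝ]
    exact (NormedSpace.expSeries_div_hasSum_exp μ).tendsto_sum_nat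
  have hq0lim : Tendsto (fun n => q n 0 * Real.exp μ) atTop (𝓝 1) := by
    rw [Metric.tendsto_atTop']
    intro ε hε
    -- A cutoff `K` is fixed before `n` so that the tail of the exponential series and the Markov
    -- bound `(μ + 1) / K` are small together; the mass of `q n` below `K` is then close to both `1`
    -- and `q n 0 * exp μ`.
    have hKlim : Tendsto (fun K : ℕ => Real.exp μ - (∑ i ∈ range K, μ ^ i / (i.factorial : ℝ)) +
        (μ + 1) / K) atTop (𝓝 0) := by
      have := (hexp.const_sub (Real.exp μ)).add
        (tendsto_const_div_atTop_nhds_zero_nat (μ + 1))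
      simpa using this
    obtain ⟨K, hK1, hK2⟩ := ((hKlim.eventually (gt_mem_nhds (half_pos hε))).and
      (eventually_gt_atTop 0)).exists
    have hev := ((hsumlim K).abs.eventually
      (gt_mem_nhds (by simpa using half_pos hε : |(0 : ℝ)| < ε / 2))).and
      (hlam.eventually (gt_mem_nhds (lt_add_one μ)))
    obtain ⟨N, hN⟩ := eventually_atTop.1 hev
    refine ⟨N, fun n hn => ?_⟩
    obtain ⟨h1, h2⟩ := hN n hn.le
    have h3 := hmean n K hK2
    have h4 := hq1 n K
    have hK' : (0 : ℝ) < K := Nat.cast_pos.2 hK2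
    have h5 : lam n / K ≤ (μ + 1) / K := by gcongr
    have hs : ∑ i ∈ range K, μ ^ i / (i.factorial : ℝ) ≤ Real.exp μ :=
      Real.sum_le_exp_of_nonneg hμ K
    have h6 := hq0 n 0
    have h7 := hq1' n 0
    have h8 : q n 0 * (Real.exp μ - ∑ i ∈ range K, μ ^ i / (i.factorial : ℝ)) ≤
        Real.exp μ - ∑ i ∈ range K, μ ^ i / (i.factorial : ℝ) :=
      mul_le_of_le_one_left (sub_nonneg.2 hs) h7
    have h9 : 0 ≤ q n 0 * (Real.exp μ - ∑ i ∈ range K, μ ^ i / (i.factorial : ℝ)) :=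
      mul_nonneg h6 (sub_nonneg.2 hs)
    have h10 := abs_lt.1 h1
    have h11 : 0 ≤ (μ + 1) / K := by positivity
    rw [Real.dist_eq, abs_lt]
    constructor <;> nlinarith [h10.1, h10.2]
  have hq0lim' : Tendsto (fun n => q n 0) atTop (𝓝 (Real.exp (-μ))) := by
    have := hq0lim.mul_const (Real.exp (-μ))
    rw [one_mul] at this
    refine this.congr fun n => ?_
    rw [mul_assoc, ← Real.exp_add]
    simp
  have := (hsumlim m).add (hq0lim'.mul_const (∑ i ∈ range m, μ ^ i / (i.factorial : ℝ)))
  rw [zero_add] at this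
  refine this.congr fun n => ?_
  ring

end Reduction

/-! ### Stirling's formula and ratios of consecutive binomial probabilities. -/

section ModerateDeviations

/-- The probability that a binomial variable with parameters `N` and `P` equals `j`. -/
noncomputable def binPmf (N : ℕ) (P : ℝ) (j : ℕ) : ℝ := N.choose j * P ^ j * (1 - P) ^ (N - j)

lemma factorial_eq_stirlingSeq {n : ℕ} (hn : 0 < n) :
    (n.factorial : ℝ) = Stirling.stirlingSeq n * (√(2 * n) * (n / Real.exp 1) ^ n) := by
  have : (0 : ℝ) < n := Nat.cast_pos.2 hn
  unfold Stirling.stirlingSeq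
  rw [div_mul_cancel₀]
  positivity

lemma exp_mul_log_div {a b : ℝ} (ha : 0 < a) (hb : 0 < b) (n : ℕ) :
    Real.exp (-(n * Real.log (a / b))) = (b / a) ^ n := by
  rw [← mul_neg, ← Real.log_inv, inv_div, Real.exp_nat_mul, Real.exp_log (by positivity)]

/-- An exact identity, because `stirlingSeq` carries the error of Stirling's formula. The exponent
is minus the number of trials times the relative entropy of the observed frequency with respect to
`P`. -/
lemma binPmf_add_eq {j m : ℕ} (hj : 0 < j) (hm : 0 < m) {P : ℝ} (h0 : 0 < P) (h1 : P < 1) :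
    binPmf (j + m) P j =
      Stirling.stirlingSeq (j + m) / (Stirling.stirlingSeq j * Stirling.stirlingSeq m) *
        √((j + m : ℝ) / (2 * (j * m))) *
        Real.exp (-(j * Real.log (j / ((j + m : ℝ) * P)) +
          m * Real.log (m / ((j + m : ℝ) * (1 - P))))) := by
  have hj' : (0 : ℝ) < j := Nat.cast_pos.2 hj
  have hm' : (0 : ℝ) < m := Nat.cast_pos.2 hm
  have h1' : 0 < 1 - P := sub_pos.2 h1
  have hs : ∀ n : ℕ, 0 < n → Stirling.stirlingSeq n ≠ 0 := fun n hn => by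
    obtain ⟨n, rfl⟩ := Nat.exists_eq_succ_of_ne_zero hn.ne'
    exact (Stirling.stirlingSeq'_pos n).ne'
  rw [neg_add, Real.exp_add, exp_mul_log_div hj' (by positivity),
    exp_mul_log_div hm' (by positivity), binPmf, Nat.cast_add_choose, Nat.add_sub_cancel_left,
    factorial_eq_stirlingSeq hj, factorial_eq_stirlingSeq hm, factorial_eq_stirlingSeq (by omega)]
  have hsq : √(2 * ((j + m : ℕ) : ℝ)) = √((j + m : ℝ) / (2 * (j * m))) * (√(2 * j) * √(2 * m)) := by
    rw [← Real.sqrt_mul (by positivity), ← Real.sqrt_mul (by positivity)]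
    congr 1
    push_cast
    field_simp
  rw [hsq, pow_add]
  have := hs j hj
  have := hs m hm
  have : √(2 * (j : ℝ)) ≠ 0 := by positivity
  have : √(2 * (m : ℝ)) ≠ 0 := by positivity
  push_cast
  simp only [div_pow, mul_pow]
  field_simp

/-- Insert the second-order expansion of the logarithm, whose error is at most `2 |u|³` here. The
factor `1 + u ≤ 3 / 2` and the leftover `u³ / 2` bring the constant to `7 / 2`. -/
lemma abs_mul_log_sub_le {u : ℝ} (hu : |u| ≤ 1 / 2) :
    |(1 + u) * Real.log (1 + u) - u - u ^ 2 / 2| ≤ 4 * |u| ^ 3 := by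
  have h := Real.abs_log_sub_add_sum_range_le (x := -u) (by rw [abs_neg]; linarith) 2
  simp only [sum_range_succ, range_zero, sum_empty, abs_neg, sub_neg_eq_add] at h
  have h2 : |u| ^ (2 + 1) / (1 - |u|) ≤ 2 * |u| ^ 3 := by
    rw [div_le_iff₀ (by linarith), show |u| ^ (2 + 1) = |u| ^ 3 from rfl]
    nlinarith [mul_nonneg (pow_nonneg (abs_nonneg u) 3) (sub_nonneg.2 hu)]
  have h3 := h.trans h2
  set e := 0 + (-u) ^ (0 + 1) / (((0 : ℕ) : ℝ) + 1) + (-u) ^ (1 + 1) / (((1 : ℕ) : ℝ) + 1) +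
    Real.log (1 + u) with he
  have hlog : Real.log (1 + u) = e + u - u ^ 2 / 2 := by
    rw [he]; push_cast; ring
  have : (1 + u) * Real.log (1 + u) - u - u ^ 2 / 2 = (1 + u) * e - u ^ 3 / 2 := by
    rw [hlog]; ring
  rw [this]
  have h4 : |(1 + u) * e| ≤ 3 / 2 * (2 * |u| ^ 3) := by
    rw [abs_mul]
    have : |1 + u| ≤ 3 / 2 := (abs_add_le _ _).trans (by rw [abs_one]; linarith)
    gcongr
  have h5 : |u ^ 3 / 2| = |u| ^ 3 / 2 := by rw [abs_div, abs_pow]; norm_num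
  have := pow_nonneg (abs_nonneg u) 3
  calc _ ≤ |(1 + u) * e| + |u ^ 3 / 2| := abs_sub _ _
    _ ≤ _ := by rw [h5]; linarith

lemma binPmf_succ_mul {N : ℕ} {P : ℝ} {i : ℕ} (hi : i < N) :
    binPmf N P (i + 1) * ((i + 1) * (1 - P)) = binPmf N P i * ((N - i) * P) := by
  unfold binPmf
  have h := Nat.choose_succ_right_eq N i
  have h' : (N.choose (i + 1) : ℝ) * (i + 1) = N.choose i * (N - i) := by
    have := congrArg (Nat.cast : ℕ → ℝ) h
    push_cast [Nat.cast_sub hi.le] at this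
    exact this
  have e : (1 - P) ^ (N - i) = (1 - P) ^ (N - (i + 1)) * (1 - P) := by
    rw [← pow_succ]; congr 1; omega
  rw [e, pow_succ]
  calc _ = (N.choose (i + 1) : ℝ) * (i + 1) * (P ^ i * P * (1 - P) ^ (N - (i + 1)) * (1 - P)) := by ring
    _ = _ := by rw [h']; ring

/-- The ratio of consecutive binomial probabilities. -/
noncomputable def binRatio (N : ℕ) (P : ℝ) (i : ℕ) : ℝ := (N - i) * P / ((i + 1) * (1 - P))

variable {N : ℕ} {P : ℝ}

lemma binPmf_nonneg (h0 : 0 < P) (h1 : P < 1) (i : ℕ) : 0 ≤ binPmf N P i := by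
  unfold binPmf
  have := sub_pos.2 h1
  positivity

lemma binPmf_succ (h1 : P < 1) {i : ℕ} (hi : i < N) :
    binPmf N P (i + 1) = binPmf N P i * binRatio N P i := by
  have : 0 < ((i : ℝ) + 1) * (1 - P) := mul_pos (by positivity) (sub_pos.2 h1)
  rw [binRatio, mul_div_assoc', eq_div_iff this.ne', binPmf_succ_mul hi]

lemma binRatio_anti (h0 : 0 < P) (h1 : P < 1) {i j : ℕ} (hij : i ≤ j) (hj : j ≤ N) :
    binRatio N P j ≤ binRatio N P i := by
  unfold binRatio
  have h1' := sub_pos.2 h1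
  have hij' : (i : ℝ) ≤ j := Nat.cast_le.2 hij
  have hj' : (j : ℝ) ≤ N := Nat.cast_le.2 hj
  have : (0 : ℝ) ≤ N - i := by linarith
  gcongr

lemma binRatio_nonneg (h0 : 0 < P) (h1 : P < 1) {j : ℕ} (hj : j ≤ N) : 0 ≤ binRatio N P j := by
  unfold binRatio
  have h1' := sub_pos.2 h1
  have hj' : (j : ℝ) ≤ N := Nat.cast_le.2 hj
  have : (0 : ℝ) ≤ N - j := by linarith
  positivity

lemma binPmf_add_le (h0 : 0 < P) (h1 : P < 1) {j : ℕ} (l : ℕ) (hl : j + l ≤ N) :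
    binPmf N P (j + l) ≤ binPmf N P j * binRatio N P j ^ l := by
  induction l with
  | zero => simp
  | succ l ih =>
    rw [← add_assoc, binPmf_succ h1 (by omega), pow_succ, ← mul_assoc]
    exact mul_le_mul (ih (by omega)) (binRatio_anti h0 h1 (by omega) (by omega))
      (binRatio_nonneg h0 h1 (by omega))
      (mul_nonneg (binPmf_nonneg h0 h1 _) (pow_nonneg (binRatio_nonneg h0 h1 (by omega)) _))

lemma le_binPmf_add (h0 : 0 < P) (h1 : P < 1) {j K : ℕ} (l : ℕ) (hl : l ≤ K) (hK : j + K ≤ N) :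
    binPmf N P j * binRatio N P (j + K) ^ l ≤ binPmf N P (j + l) := by
  induction l with
  | zero => simp
  | succ l ih =>
    rw [← add_assoc, binPmf_succ h1 (by omega), pow_succ, ← mul_assoc]
    exact mul_le_mul (ih (by omega)) (binRatio_anti h0 h1 (by omega) (by omega))
      (binRatio_nonneg h0 h1 (by omega)) (binPmf_nonneg h0 h1 _)

lemma binTail_eq {x : ℝ} (hx : 0 ≤ x) :
    binTail N P x = ∑ i ∈ Ico (⌊x⌋₊ + 1) (N + 1), binPmf N P i := by
  unfold binTail binPmf
  refine sum_congr ?_ fun _ _ => rfl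
  ext i
  rw [mem_filter, mem_range, mem_Ico, Nat.succ_le_iff, Nat.floor_lt hx]
  tauto

/-- The ratios decrease beyond `j`, so the tail is dominated by a geometric series with the first
ratio. -/
lemma sum_Ico_binPmf_le (h0 : 0 < P) (h1 : P < 1) {j : ℕ} (hj : j ≤ N) (hR : binRatio N P j < 1) :
    ∑ i ∈ Ico j (N + 1), binPmf N P i ≤ binPmf N P j / (1 - binRatio N P j) := by
  have hR0 := binRatio_nonneg h0 h1 hj
  rw [sum_Ico_eq_sum_range, div_eq_mul_inv]
  refine (sum_le_sum fun l hl => binPmf_add_le h0 h1 l ?_).trans ?_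
  · rw [mem_range] at hl; omega
  rw [← mul_sum]
  refine mul_le_mul_of_nonneg_left ?_ (binPmf_nonneg h0 h1 _)
  rw [← tsum_geometric_of_lt_one hR0 hR]
  exact (summable_geometric_of_lt_one hR0 hR).sum_le_tsum _ fun _ _ => pow_nonneg hR0 _

/-- The matching lower bound keeps `K` terms, along which every ratio is at least the one at `j +
K`. -/
lemma le_sum_Ico_binPmf (h0 : 0 < P) (h1 : P < 1) {j K : ℕ} (hK : j + K ≤ N)
    (hR : binRatio N P (j + K) < 1) :
    binPmf N P j * ((1 - binRatio N P (j + K) ^ K) / (1 - binRatio N P (j + K))) ≤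
      ∑ i ∈ Ico j (N + 1), binPmf N P i := by
  have hsub : Ico j (j + K) ⊆ Ico j (N + 1) := Ico_subset_Ico_right (by omega)
  refine le_trans ?_ (sum_le_sum_of_subset_of_nonneg hsub fun i _ _ => binPmf_nonneg h0 h1 i)
  rw [sum_Ico_eq_sum_range, Nat.add_sub_cancel_left]
  have : (1 - binRatio N P (j + K) ^ K) / (1 - binRatio N P (j + K)) =
      ∑ l ∈ range K, binRatio N P (j + K) ^ l := by
    rw [geom_sum_eq hR.ne, ← neg_div_neg_eq, neg_sub, neg_sub]
  rw [this, mul_sum]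
  exact sum_le_sum fun l hl => le_binPmf_add h0 h1 l (mem_range.1 hl).le hK

end ModerateDeviations

/-! ### Local limit theorem for moderate deviations. -/

section LocalLimit

/-- With `A` and `B` the expected numbers of successes and failures, the linear terms `z` and `-z`
cancel. Since `1 / A + 1 / B = 1 / v`, the quadratic terms add up to `w² / 2`. Each cubic error is
at most `4 w³ / √v`, because `v` is at most `A` and `B`. -/
lemma abs_entropy_sub_le {A B z v w : ℝ} (hA : 0 < A) (hB : 0 < B) (hz : 0 < z)
    (hzA : z ≤ A / 2) (hzB : z ≤ B / 2) (hv : v = A * B / (A + B)) (hw : w = z / √v) :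
    |((A + z) * Real.log ((A + z) / A) + (B - z) * Real.log ((B - z) / B)) - w ^ 2 / 2| ≤
      8 * (w ^ 3 / √v) := by
  have hv0 : 0 < v := by rw [hv]; positivity
  have hvA : v ≤ A := by
    rw [hv, div_le_iff₀ (by positivity)]; nlinarith
  have hvB : v ≤ B := by
    rw [hv, div_le_iff₀ (by positivity)]; nlinarith
  have hsv : √v ^ 2 = v := Real.sq_sqrt hv0.le
  have hsv0 : 0 < √v := Real.sqrt_pos.2 hv0
  have hw2 : w ^ 2 = z ^ 2 / A + z ^ 2 / B := by
    rw [hw, div_pow, hsv, hv]; field_simp; ring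
  have hw3 : w ^ 3 / √v = z ^ 3 / v ^ 2 := by
    have : v ^ 2 = √v ^ 3 * √v := by
      rw [← pow_succ, show √v ^ (3 + 1) = (√v ^ 2) ^ 2 by ring, hsv]
    rw [hw, div_pow, this, div_div]
  have hcube : ∀ C, v ≤ C → C * (4 * (z / C) ^ 3) ≤ 4 * (w ^ 3 / √v) := by
    intro C hC
    have hC0 : 0 < C := hv0.trans_le hC
    have : C * (4 * (z / C) ^ 3) = 4 * (z ^ 3 / C ^ 2) := by field_simp
    rw [this, hw3]
    gcongr
  have ha : |z / A| ≤ 1 / 2 := by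
    rw [abs_of_pos (by positivity), div_le_iff₀ hA]; linarith
  have hb : |-(z / B)| ≤ 1 / 2 := by
    rw [abs_neg, abs_of_pos (by positivity), div_le_iff₀ hB]; linarith
  have h1 := abs_mul_log_sub_le ha
  have h2 := abs_mul_log_sub_le hb
  rw [abs_neg] at h2
  rw [abs_of_pos (show 0 < z / A by positivity)] at h1
  rw [abs_of_pos (show 0 < z / B by positivity)] at h2
  have e1 : (A + z) / A = 1 + z / A := by field_simp
  have e2 : (B - z) / B = 1 + -(z / B) := by field_simp; ring
  have e : ((A + z) * Real.log ((A + z) / A) + (B - z) * Real.log ((B - z) / B)) - w ^ 2 / 2 =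
      A * ((1 + z / A) * Real.log (1 + z / A) - z / A - (z / A) ^ 2 / 2) +
      B * ((1 + -(z / B)) * Real.log (1 + -(z / B)) - -(z / B) - (-(z / B)) ^ 2 / 2) := by
    rw [hw2, e1, e2]; field_simp; ring
  rw [e]
  refine (abs_add_le _ _).trans ?_
  rw [abs_mul, abs_mul, abs_of_pos hA, abs_of_pos hB]
  have := mul_le_mul_of_nonneg_left h1 hA.le
  have := mul_le_mul_of_nonneg_left h2 hB.le
  linarith [hcube A hvA, hcube B hvB]

variable {N j : ℕ → ℕ} {P v w : ℕ → ℝ}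

lemma tendsto_div_sqrt (hw : Tendsto w atTop atTop)
    (hwv : Tendsto (fun n => w n ^ 3 / √(v n)) atTop (𝓝 0)) :
    Tendsto (fun n => w n / √(v n)) atTop (𝓝 0) := by
  refine tendsto_of_tendsto_of_tendsto_of_le_of_le' tendsto_const_nhds hwv ?_ ?_
  · filter_upwards [hw.eventually_ge_atTop 1] with n hn
    positivity
  · filter_upwards [hw.eventually_ge_atTop 1] with n hn
    have : w n ≤ w n ^ 3 := by nlinarith [sq_nonneg (w n)]
    gcongr

lemma tendsto_stirlingSeq_ratio {m : ℕ → ℕ} (hj : Tendsto j atTop atTop)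
    (hm : Tendsto m atTop atTop) :
    Tendsto (fun n => √Real.pi * (Stirling.stirlingSeq (j n + m n) /
      (Stirling.stirlingSeq (j n) * Stirling.stirlingSeq (m n)))) atTop (𝓝 1) := by
  have hpi : √Real.pi ≠ 0 := by positivity
  have h := Stirling.tendsto_stirlingSeq_sqrt_pi
  have := ((h.comp (tendsto_atTop_mono (fun n => Nat.le_add_right _ (m n)) hj)).div ((h.comp hj).mul (h.comp hm))
    (mul_ne_zero hpi hpi)).const_mul √Real.pi
  rw [show √Real.pi * (√Real.pi / (√Real.pi * √Real.pi)) = 1 by field_simp] at this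
  exact this

/-- A local limit theorem for the binomial law, in the range of moderate deviations. -/
lemma tendsto_binPmf (hP : ∀ n, 0 < P n ∧ P n < 1)
    (hv : ∀ n, v n = N n * P n * (1 - P n)) (hw : ∀ n, w n = (j n - N n * P n) / √(v n))
    (hv' : Tendsto v atTop atTop) (hw' : Tendsto w atTop atTop)
    (hwv : Tendsto (fun n => w n ^ 3 / √(v n)) atTop (𝓝 0)) :
    Tendsto (fun n => binPmf (N n) (P n) (j n) * √(2 * Real.pi * v n) * Real.exp (w n ^ 2 / 2))
      atTop (𝓝 1) := by
  have hwv1 := tendsto_div_sqrt hw' hwv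
  set A : ℕ → ℝ := fun n => N n * P n with hA
  set B : ℕ → ℝ := fun n => N n * (1 - P n) with hB
  set z : ℕ → ℝ := fun n => j n - N n * P n with hz
  -- the basic inequalities
  have hev : ∀ᶠ n in atTop, 0 < v n ∧ 0 < z n ∧ v n ≤ A n ∧ v n ≤ B n ∧
      z n / A n ≤ w n / √(v n) ∧ z n / B n ≤ w n / √(v n) ∧ w n / √(v n) ≤ 1 / 2 := by
    filter_upwards [hv'.eventually_gt_atTop 0, hw'.eventually_gt_atTop 0,
      hwv1.eventually (ge_mem_nhds (show (0 : ℝ) < 1 / 2 by norm_num))] with n h1 h2 h3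
    obtain ⟨hP0, hP1⟩ := hP n
    have hs := Real.sqrt_pos.2 h1
    have hz0 : 0 < z n := by
      have := mul_pos h2 hs
      rwa [hw n, div_mul_cancel₀ _ hs.ne'] at this
    have hvA : v n ≤ A n := by
      rw [hv n]
      exact mul_le_of_le_one_right (by positivity) (by linarith)
    have hvB : v n ≤ B n := by
      rw [hv n, mul_right_comm]
      exact mul_le_of_le_one_right (mul_nonneg (by positivity) (by linarith)) (by linarith)
    have hwz : w n / √(v n) = z n / v n := by
      rw [hw n, div_div, Real.mul_self_sqrt h1.le]
    refine ⟨h1, hz0, hvA, hvB, ?_, ?_, h3⟩ <;> rw [hwz] <;> gcongr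
  -- Successes and failures both grow without bound, so Stirling's formula applies to all three
  -- factorials.
  have hjm : ∀ᶠ n in atTop, v n ≤ j n ∧ v n / 2 ≤ (N n - j n : ℕ) ∧ j n + (N n - j n) = N n := by
    filter_upwards [hev] with n ⟨h1, h2, h3, h4, h5, h6, h7⟩
    have hB0 : 0 < B n := h1.trans_le h4
    have h8 : z n ≤ B n / 2 := by
      have := (div_le_iff₀ hB0).1 (h6.trans h7); linarith
    have h9 : (j n : ℝ) = A n + z n := by simp only [hA, hz]; ring
    have h10 : (N n : ℝ) - j n = B n - z n := by simp only [hB, hz]; ring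
    have h11 : j n ≤ N n := by
      have : (j n : ℝ) ≤ N n := by linarith
      exact_mod_cast this
    refine ⟨by linarith, ?_, by omega⟩
    rw [Nat.cast_sub h11]; linarith
  have hj_top : Tendsto j atTop atTop :=
    tendsto_natCast_atTop_iff.1 (tendsto_atTop_mono' _ (hjm.mono fun n h => h.1) hv')
  have hm_top : Tendsto (fun n => N n - j n) atTop atTop :=
    tendsto_natCast_atTop_iff.1
      (tendsto_atTop_mono' _ (hjm.mono fun n h => h.2.1) (hv'.atTop_div_const two_pos))
  have hst := tendsto_stirlingSeq_ratio hj_top hm_top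
  have hzA : Tendsto (fun n => z n / A n) atTop (𝓝 0) := by
    refine tendsto_of_tendsto_of_tendsto_of_le_of_le' tendsto_const_nhds hwv1 ?_
      (hev.mono fun n h => h.2.2.2.2.1)
    filter_upwards [hev] with n ⟨h1, h2, h3, _⟩
    exact div_nonneg h2.le (h1.le.trans h3)
  have hzB : Tendsto (fun n => z n / B n) atTop (𝓝 0) := by
    refine tendsto_of_tendsto_of_tendsto_of_le_of_le' tendsto_const_nhds hwv1 ?_
      (hev.mono fun n h => h.2.2.2.2.2.1)
    filter_upwards [hev] with n ⟨h1, h2, _, h4, _⟩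
    exact div_nonneg h2.le (h1.le.trans h4)
  have hsqrt : Tendsto (fun n => √(1 / ((1 + z n / A n) * (1 - z n / B n)))) atTop (𝓝 1) := by
    have := (((hzA.const_add 1).mul (hzB.const_sub 1)).inv₀ (by norm_num)).sqrt
    simpa [one_div] using this
  set Φ : ℕ → ℝ := fun n => j n * Real.log (j n / (N n * P n)) +
    (N n - j n : ℕ) * Real.log ((N n - j n : ℕ) / (N n * (1 - P n))) with hΦ
  have hexp : Tendsto (fun n => Real.exp (-(Φ n - w n ^ 2 / 2))) atTop (𝓝 1) := by
    rw [← Real.exp_zero]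
    refine (Real.continuous_exp.tendsto 0).comp ?_
    have h0 : Tendsto (fun n => 8 * (w n ^ 3 / √(v n))) atTop (𝓝 0) := by
      simpa using hwv.const_mul 8
    refine squeeze_zero_norm' ?_ h0
    filter_upwards [hev, hjm] with n ⟨h1, h2, h3, h4, h5, h6, h7⟩ ⟨_, _, h8⟩
    have hA0 : 0 < A n := h1.trans_le h3
    have hB0 : 0 < B n := h1.trans_le h4
    have hAB : A n + B n = N n := by simp only [hA, hB]; ring
    have hvAB : v n = A n * B n / (A n + B n) := by
      rw [hAB, eq_div_iff (by linarith), hv n]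
      simp only [hA, hB]; ring
    have := abs_entropy_sub_le hA0 hB0 h2
      (by have := (div_le_iff₀ hA0).1 (h5.trans h7); linarith)
      (by have := (div_le_iff₀ hB0).1 (h6.trans h7); linarith) hvAB (hw n)
    rw [norm_neg, Real.norm_eq_abs]
    refine le_trans (le_of_eq ?_) this
    have e1 : (j n : ℝ) = A n + z n := by simp only [hA, hz]; ring
    have e2 : ((N n - j n : ℕ) : ℝ) = B n - z n := by
      rw [Nat.cast_sub (by omega)]; simp only [hB, hz]; ring
    simp only [hΦ]
    rw [e2, e1]
  have hmain := (hst.mul hsqrt).mul hexp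
  simp only [mul_one] at hmain
  refine hmain.congr' ?_
  filter_upwards [hev, hjm, hj_top.eventually_gt_atTop 0, hm_top.eventually_gt_atTop 0]
    with n ⟨h1, h2, h3, h4, h5, h6, h7⟩ ⟨_, _, h8⟩ h9 h10
  have hA0 : 0 < A n := h1.trans_le h3
  have hB0 : 0 < B n := h1.trans_le h4
  have hj0 : (0 : ℝ) < j n := Nat.cast_pos.2 h9
  have hm0 : (0 : ℝ) < (N n - j n : ℕ) := Nat.cast_pos.2 h10
  have hsum : (j n : ℝ) + (N n - j n : ℕ) = N n := by exact_mod_cast h8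
  have hpmf := binPmf_add_eq h9 h10 (hP n).1 (hP n).2
  rw [h8, hsum] at hpmf
  rw [hpmf, h8]
  have e1 : (j n : ℝ) = A n * (1 + z n / A n) := by
    rw [mul_add, mul_div_cancel₀ _ hA0.ne']; simp only [hA, hz]; ring
  have e2 : ((N n - j n : ℕ) : ℝ) = B n * (1 - z n / B n) := by
    rw [mul_sub, mul_div_cancel₀ _ hB0.ne', eq_sub_iff_add_eq.2 ((add_comm _ _).trans hsum)]
    simp only [hB, hz]; ring
  have e3 : √((N n : ℝ) / (2 * (j n * (N n - j n : ℕ)))) * √(2 * Real.pi * v n) =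
      √Real.pi * √(1 / ((1 + z n / A n) * (1 - z n / B n))) := by
    rw [← Real.sqrt_mul (by positivity), ← Real.sqrt_mul (by positivity)]
    congr 1
    have hN0 : (N n : ℝ) ≠ 0 := by rw [← hsum]; positivity
    have hx : 1 + z n / A n ≠ 0 := fun h => by rw [h, mul_zero] at e1; exact hj0.ne' e1
    have hy : 1 - z n / B n ≠ 0 := fun h => by rw [h, mul_zero] at e2; exact hm0.ne' e2
    have hvN : v n * N n = A n * B n := by rw [hv n]; simp only [hA, hB]; ring
    rw [e1, e2]
    generalize 1 + z n / A n = a at *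
    generalize 1 - z n / B n = b at *
    field_simp
    linarith
  have e4 : Real.exp (-(Φ n - w n ^ 2 / 2)) = Real.exp (-Φ n) * Real.exp (w n ^ 2 / 2) := by
    rw [← Real.exp_add]; congr 1; ring
  rw [e4]
  calc _ = (Stirling.stirlingSeq (N n) /
      (Stirling.stirlingSeq (j n) * Stirling.stirlingSeq (N n - j n))) *
      (√Real.pi * √(1 / ((1 + z n / A n) * (1 - z n / B n)))) *
      (Real.exp (-Φ n) * Real.exp (w n ^ 2 / 2)) := by ring
    _ = _ := by rw [← e3]; ring

end LocalLimit

/-! ### From point probabilities to the binomial tail. -/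

section Tail

variable {N j : ℕ → ℕ} {P v w : ℕ → ℝ}

/-- The complementary ratio of consecutive binomial probabilities, `w` standard deviations above the
mean. -/
lemma tendsto_one_sub_binRatio {i : ℕ → ℕ} (hP : ∀ n, 0 < P n ∧ P n < 1)
    (hv : ∀ n, v n = N n * P n * (1 - P n))
    (hv' : Tendsto v atTop atTop) (hw' : Tendsto w atTop atTop)
    (hwv1 : Tendsto (fun n => w n / √(v n)) atTop (𝓝 0))
    (hi : Tendsto (fun n => (i n - N n * P n) / (w n * √(v n))) atTop (𝓝 1)) :
    Tendsto (fun n => (1 - binRatio (N n) (P n) (i n)) * √(v n) / w n) atTop (𝓝 1) := by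
  have hsv : Tendsto (fun n => √(v n)) atTop atTop := Real.tendsto_sqrt_atTop.comp hv'
  have hA : Tendsto (fun n => N n * P n) atTop atTop := by
    refine tendsto_atTop_mono (fun n => ?_) hv'
    obtain ⟨h0, h1⟩ := hP n
    rw [hv n]
    exact mul_le_of_le_one_right (by positivity) (by linarith)
  have hwA : Tendsto (fun n => w n * √(v n) / (N n * P n)) atTop (𝓝 0) := by
    refine tendsto_of_tendsto_of_tendsto_of_le_of_le' tendsto_const_nhds hwv1 ?_ ?_
    · filter_upwards [hw'.eventually_ge_atTop 0] with n hn
      have := (hP n).1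
      positivity
    · filter_upwards [hw'.eventually_ge_atTop 0, hv'.eventually_gt_atTop 0] with n hn hvn
      obtain ⟨h0, h1⟩ := hP n
      have hs := Real.sqrt_pos.2 hvn
      have hle : v n ≤ N n * P n := by
        rw [hv n]
        exact mul_le_of_le_one_right (by positivity) (by linarith)
      rw [div_le_div_iff₀ (hvn.trans_le hle) hs, mul_assoc, Real.mul_self_sqrt hvn.le]
      gcongr
  have hden : Tendsto (fun n => ((i n : ℝ) + 1) / (N n * P n)) atTop (𝓝 1) := by
    have h := ((hi.mul hwA).const_add 1).add (tendsto_inv_atTop_zero.comp hA)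
    simp only [mul_zero, add_zero] at h
    refine h.congr' ?_
    filter_upwards [hw'.eventually_gt_atTop 0, hsv.eventually_gt_atTop 0,
      hA.eventually_gt_atTop 0] with n h1 h2 h3
    simp only [Function.comp]
    have : w n * √(v n) ≠ 0 := by positivity
    rw [div_mul_div_cancel₀ this]
    generalize N n * P n = a at h3 ⊢
    field_simp
    ring
  have hsmall : Tendsto (fun n => (1 - P n) / (w n * √(v n))) atTop (𝓝 0) := by
    have hinf := hw'.atTop_mul_atTop₀ hsv
    refine squeeze_zero_norm' ?_ (tendsto_inv_atTop_zero.comp hinf)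
    filter_upwards [hw'.eventually_gt_atTop 0, hsv.eventually_gt_atTop 0] with n h1 h2
    obtain ⟨h3, h4⟩ := hP n
    simp only [Function.comp]
    rw [norm_div, Real.norm_eq_abs, Real.norm_eq_abs, abs_of_pos (sub_pos.2 h4),
      abs_of_pos (by positivity), div_eq_mul_inv]
    exact mul_le_of_le_one_left (by positivity) (by linarith)
  have h := (hi.add hsmall).mul (hden.inv₀ one_ne_zero)
  simp only [add_zero, inv_one, mul_one] at h
  refine h.congr' ?_
  filter_upwards [hw'.eventually_gt_atTop 0, hv'.eventually_gt_atTop 0] with n h1 h2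
  obtain ⟨h3, h4⟩ := hP n
  have hs := Real.sqrt_pos.2 h2
  have h4' := sub_pos.2 h4
  have hss : √(v n) * √(v n) = N n * P n * (1 - P n) := by rw [Real.mul_self_sqrt h2.le, hv n]
  have hN : (N n : ℝ) ≠ 0 := by
    intro h; rw [hv n, h] at h2; simp at h2
  have hi1 : (i n : ℝ) + 1 ≠ 0 := by positivity
  unfold binRatio
  -- The numerator is asymptotic to `w √v` and the denominator to `N P (1 - P) = v`, which gives `w
  -- / √v`.
  have e1 : 1 - (N n - i n) * P n / ((i n + 1) * (1 - P n)) =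
      (i n - N n * P n + (1 - P n)) / ((i n + 1) * (1 - P n)) := by
    field_simp; ring
  rw [e1]
  generalize hq : (i n : ℝ) - N n * P n + (1 - P n) = q
  have e2 : ((i n : ℝ) - N n * P n) / (w n * √(v n)) + (1 - P n) / (w n * √(v n)) =
      q / (w n * √(v n)) := by rw [← hq, add_div]
  rw [e2]
  have h5 := (hP n).1.ne'
  rw [inv_div, div_mul_div_comm, div_mul_eq_mul_div, div_div, div_eq_div_iff (by positivity) (by positivity)]
  linear_combination (-q * (i n + 1) * w n) * hss

lemma tendsto_sum_Ico_binPmf (hP : ∀ n, 0 < P n ∧ P n < 1)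
    (hv : ∀ n, v n = N n * P n * (1 - P n)) (hw : ∀ n, w n = (j n - N n * P n) / √(v n))
    (hv' : Tendsto v atTop atTop) (hw' : Tendsto w atTop atTop)
    (hwv : Tendsto (fun n => w n ^ 3 / √(v n)) atTop (𝓝 0)) :
    Tendsto (fun n => (∑ i ∈ Ico (j n) (N n + 1), binPmf (N n) (P n) i) *
      (w n * √(2 * Real.pi) * Real.exp (w n ^ 2 / 2))) atTop (𝓝 1) := by
  have hwv1 := tendsto_div_sqrt hw' hwv
  have hsv : Tendsto (fun n => √(v n)) atTop atTop := Real.tendsto_sqrt_atTop.comp hv'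
  have hlocal := tendsto_binPmf hP hv hw hv' hw' hwv
  have hji : Tendsto (fun n => (j n - N n * P n) / (w n * √(v n))) atTop (𝓝 1) := by
    refine (tendsto_congr' ?_).2 tendsto_const_nhds
    filter_upwards [hw'.eventually_gt_atTop 0, hsv.eventually_gt_atTop 0] with n h1 h2
    have : (j n - N n * P n) = w n * √(v n) := by rw [hw n, div_mul_cancel₀ _ h2.ne']
    rw [this, div_self (by positivity)]
  have hK : Tendsto (fun n => (⌈√(v n)⌉₊ : ℝ) / √(v n)) atTop (𝓝 1) :=
    (tendsto_nat_ceil_div_atTop (R := ℝ)).comp hsv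
  -- The window is short compared with `w √v`, so the ratio at its end has the same asymptotics, and
  -- long compared with the decay length `√v / w`, so the truncated geometric sum is asymptotically
  -- complete.
  set K : ℕ → ℕ := fun n => ⌈√(v n)⌉₊ with hKdef
  have hjK : Tendsto (fun n => (((j n + K n : ℕ) : ℝ) - N n * P n) / (w n * √(v n))) atTop
      (𝓝 1) := by
    have h := hji.add (hK.mul (tendsto_inv_atTop_zero.comp hw'))
    simp only [mul_zero, add_zero] at h
    refine h.congr fun n => ?_
    simp only [Function.comp, Nat.cast_add]
    rw [← div_eq_mul_inv, div_div, mul_comm (√(v n)), ← add_div]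
    congr 1; ring
  have hR1 := tendsto_one_sub_binRatio hP hv hv' hw' hwv1 hji
  have hR2 := tendsto_one_sub_binRatio hP hv hv' hw' hwv1 hjK
  have hle : ∀ᶠ n in atTop, j n + K n ≤ N n := by
    have hB : Tendsto (fun n => w n * √(v n) / (N n * (1 - P n))) atTop (𝓝 0) := by
      refine tendsto_of_tendsto_of_tendsto_of_le_of_le' tendsto_const_nhds hwv1 ?_ ?_
      · filter_upwards [hw'.eventually_ge_atTop 0] with n hn
        have := sub_pos.2 (hP n).2
        positivity
      · filter_upwards [hw'.eventually_ge_atTop 0, hv'.eventually_gt_atTop 0] with n hn hvn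
        obtain ⟨h0, h1⟩ := hP n
        have hs := Real.sqrt_pos.2 hvn
        have hle : v n ≤ N n * (1 - P n) := by
          rw [hv n, mul_right_comm]
          exact mul_le_of_le_one_right (mul_nonneg (by positivity) (by linarith)) (by linarith)
        rw [div_le_div_iff₀ (hvn.trans_le hle) hs, mul_assoc, Real.mul_self_sqrt hvn.le]
        gcongr
    have h := hjK.mul hB
    rw [mul_zero] at h
    filter_upwards [h.eventually (ge_mem_nhds one_pos), hw'.eventually_gt_atTop 0,
      hv'.eventually_gt_atTop 0] with n h1 h2 h3
    have hs := Real.sqrt_pos.2 h3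
    have : w n * √(v n) ≠ 0 := by positivity
    rw [div_mul_div_cancel₀ this] at h1
    have hB0 : 0 < N n * (1 - P n) := by
      have h4 := h3
      rw [hv n, mul_right_comm] at h4
      exact pos_of_mul_pos_left h4 (hP n).1.le
    rw [div_le_one hB0] at h1
    have : ((j n + K n : ℕ) : ℝ) ≤ N n := by linarith
    exact_mod_cast this
  -- the ratios are less than one
  have hpos : ∀ i : ℕ → ℕ, Tendsto (fun n => (1 - binRatio (N n) (P n) (i n)) * √(v n) / w n) atTop
      (𝓝 1) → ∀ᶠ n in atTop, binRatio (N n) (P n) (i n) < 1 := by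
    intro i hi
    filter_upwards [hi.eventually (lt_mem_nhds one_pos), hw'.eventually_gt_atTop 0,
      hsv.eventually_gt_atTop 0] with n h1 h2 h3
    have h4 := pos_of_mul_pos_left ((div_pos_iff_of_pos_right h2).1 h1) h3.le
    linarith
  have hRK : Tendsto (fun n => binRatio (N n) (P n) (j n + K n) ^ K n) atTop (𝓝 0) := by
    have hinf : Tendsto (fun n => (1 - binRatio (N n) (P n) (j n + K n)) * √(v n) / w n *
        ((K n : ℝ) / √(v n)) * w n) atTop atTop := by
      refine Tendsto.pos_mul_atTop one_pos ?_ hw'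
      simpa using hR2.mul hK
    refine tendsto_of_tendsto_of_tendsto_of_le_of_le' tendsto_const_nhds
      (Real.tendsto_exp_neg_atTop_nhds_zero.comp hinf) ?_ ?_
    · filter_upwards [hle] with n hn
      exact pow_nonneg (binRatio_nonneg (hP n).1 (hP n).2 hn) _
    · filter_upwards [hle, hw'.eventually_gt_atTop 0, hsv.eventually_gt_atTop 0] with n hn h1 h2
      have h3 := binRatio_nonneg (hP n).1 (hP n).2 hn
      simp only [Function.comp]
      generalize binRatio (N n) (P n) (j n + K n) = R at h3 ⊢
      have h4 : R ≤ Real.exp (-(1 - R)) := by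
        have := Real.add_one_le_exp (-(1 - R)); linarith
      refine (pow_le_pow_left₀ h3 h4 _).trans (le_of_eq ?_)
      rw [← Real.exp_nat_mul]
      congr 1
      field_simp
  have hupper : Tendsto (fun n => binPmf (N n) (P n) (j n) * √(2 * Real.pi * v n) *
      Real.exp (w n ^ 2 / 2) * ((1 - binRatio (N n) (P n) (j n)) * √(v n) / w n)⁻¹) atTop (𝓝 1) := by
    simpa using hlocal.mul (hR1.inv₀ one_ne_zero)
  have hlower : Tendsto (fun n => binPmf (N n) (P n) (j n) * √(2 * Real.pi * v n) *
      Real.exp (w n ^ 2 / 2) * ((1 - binRatio (N n) (P n) (j n + K n)) * √(v n) / w n)⁻¹ *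
      (1 - binRatio (N n) (P n) (j n + K n) ^ K n)) atTop (𝓝 1) := by
    simpa using (hlocal.mul (hR2.inv₀ one_ne_zero)).mul (hRK.const_sub 1)
  refine tendsto_of_tendsto_of_tendsto_of_le_of_le' hlower hupper ?_ ?_
  · filter_upwards [hle, hpos _ hR2, hw'.eventually_gt_atTop 0, hv'.eventually_gt_atTop 0]
      with n h1 h2 h3 h4
    have hs := Real.sqrt_pos.2 h4
    have h5 := le_sum_Ico_binPmf (hP n).1 (hP n).2 h1 h2
    have h6 : 0 ≤ w n * √(2 * Real.pi) * Real.exp (w n ^ 2 / 2) := by positivity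
    refine le_trans (le_of_eq ?_) (mul_le_mul_of_nonneg_right h5 h6)
    rw [Real.sqrt_mul (show (0 : ℝ) ≤ 2 * Real.pi by positivity) (v n)]
    have : 1 - binRatio (N n) (P n) (j n + K n) ≠ 0 := by linarith
    generalize 1 - binRatio (N n) (P n) (j n + K n) ^ K n = c
    generalize 1 - binRatio (N n) (P n) (j n + K n) = d at this ⊢
    field_simp
  · filter_upwards [hle, hpos _ hR1, hw'.eventually_gt_atTop 0, hv'.eventually_gt_atTop 0]
      with n h1 h2 h3 h4
    have hs := Real.sqrt_pos.2 h4
    have h5 := sum_Ico_binPmf_le (hP n).1 (hP n).2 ((Nat.le_add_right _ _).trans h1) h2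
    have h6 : 0 ≤ w n * √(2 * Real.pi) * Real.exp (w n ^ 2 / 2) := by positivity
    refine (mul_le_mul_of_nonneg_right h5 h6).trans (le_of_eq ?_)
    rw [Real.sqrt_mul (show (0 : ℝ) ≤ 2 * Real.pi by positivity) (v n)]
    have : 1 - binRatio (N n) (P n) (j n) ≠ 0 := by linarith
    generalize 1 - binRatio (N n) (P n) (j n) = d at this ⊢
    field_simp

/-- The binomial tail in the range of moderate deviations. -/
theorem tendsto_binTail {x : ℕ → ℝ} (hP : ∀ n, 0 < P n ∧ P n < 1)
    (hv : ∀ n, v n = N n * P n * (1 - P n)) (hw : ∀ n, w n = (x n - N n * P n) / √(v n))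
    (hv' : Tendsto v atTop atTop) (hw' : Tendsto w atTop atTop)
    (hwv : Tendsto (fun n => w n ^ 3 / √(v n)) atTop (𝓝 0)) :
    Tendsto (fun n => binTail (N n) (P n) (x n) *
      (w n * √(2 * Real.pi) * Real.exp (w n ^ 2 / 2))) atTop (𝓝 1) := by
  have hwv1 := tendsto_div_sqrt hw' hwv
  have hsv : Tendsto (fun n => √(v n)) atTop atTop := Real.tendsto_sqrt_atTop.comp hv'
  -- The first integer above `x`. Rounding raises the standardized height by at most `1 / √v`, and
  -- its square by at most `2 w / √v + 1 / v`, which vanishes.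
  set j : ℕ → ℕ := fun n => ⌊x n⌋₊ + 1 with hj
  set u : ℕ → ℝ := fun n => (j n - N n * P n) / √(v n) with hu
  have hx : ∀ᶠ n in atTop, 0 ≤ x n := by
    filter_upwards [hw'.eventually_gt_atTop 0, hsv.eventually_gt_atTop 0] with n h1 h2
    rw [hw n, div_pos_iff_of_pos_right h2, sub_pos] at h1
    have := (hP n).1
    exact (by positivity : (0 : ℝ) ≤ N n * P n).trans h1.le
  have hdiff : ∀ᶠ n in atTop, w n ≤ u n ∧ u n ≤ w n + (√(v n))⁻¹ := by
    filter_upwards [hx, hsv.eventually_gt_atTop 0] with n h1 h2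
    have h3 := Nat.lt_floor_add_one (x n)
    have h4 := Nat.floor_le h1
    rw [hw n, hu, ← one_div, ← add_div]
    simp only [hj, Nat.cast_add, Nat.cast_one]
    exact ⟨div_le_div_of_nonneg_right (by linarith) h2.le,
      div_le_div_of_nonneg_right (by linarith) h2.le⟩
  have hinv : Tendsto (fun n => (√(v n))⁻¹) atTop (𝓝 0) := tendsto_inv_atTop_zero.comp hsv
  have hu' : Tendsto u atTop atTop := tendsto_atTop_mono' _ (hdiff.mono fun n h => h.1) hw'
  have huw : Tendsto (fun n => u n - w n) atTop (𝓝 0) := by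
    refine tendsto_of_tendsto_of_tendsto_of_le_of_le' tendsto_const_nhds hinv ?_ ?_
    · exact hdiff.mono fun n h => sub_nonneg.2 h.1
    · exact hdiff.mono fun n h => by linarith [h.2]
  have hratio : Tendsto (fun n => u n / w n) atTop (𝓝 1) := by
    have h := (huw.mul (tendsto_inv_atTop_zero.comp hw')).const_add 1
    simp only [mul_zero, add_zero] at h
    refine h.congr' ?_
    filter_upwards [hw'.eventually_gt_atTop 0] with n h1
    simp only [Function.comp]
    field_simp
    ring
  have huv : Tendsto (fun n => u n ^ 3 / √(v n)) atTop (𝓝 0) := by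
    have h := (hratio.pow 3).mul hwv
    rw [mul_zero] at h
    refine h.congr' ?_
    filter_upwards [hw'.eventually_gt_atTop 0] with n h1
    field_simp
  have hsq : Tendsto (fun n => u n ^ 2 - w n ^ 2) atTop (𝓝 0) := by
    have hup : Tendsto (fun n => 2 * (w n / √(v n)) + (√(v n))⁻¹ * (√(v n))⁻¹) atTop (𝓝 0) := by
      simpa using (hwv1.const_mul 2).add (hinv.mul hinv)
    refine tendsto_of_tendsto_of_tendsto_of_le_of_le' tendsto_const_nhds hup ?_ ?_
    · filter_upwards [hdiff, hw'.eventually_gt_atTop 0] with n h1 h2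
      nlinarith [h1.1]
    · filter_upwards [hdiff, hw'.eventually_gt_atTop 0] with n h1 h2
      rw [div_eq_mul_inv]
      nlinarith [h1.1, h1.2]
  have hmain := tendsto_sum_Ico_binPmf (w := u) (j := j) hP hv (fun n => rfl) hv' hu' huv
  have hexp : Tendsto (fun n => Real.exp (-((u n ^ 2 - w n ^ 2) / 2))) atTop (𝓝 1) := by
    rw [← Real.exp_zero]
    refine (Real.continuous_exp.tendsto 0).comp ?_
    simpa using (hsq.div_const 2).neg
  have h := (hmain.mul (hratio.inv₀ one_ne_zero)).mul hexp
  simp only [inv_one, mul_one] at h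
  refine h.congr' ?_
  filter_upwards [hx, hw'.eventually_gt_atTop 0, hu'.eventually_gt_atTop 0] with n h1 h2 h3
  have e : Real.exp (w n ^ 2 / 2) =
      Real.exp (u n ^ 2 / 2) * Real.exp (-((u n ^ 2 - w n ^ 2) / 2)) := by
    rw [← Real.exp_add]; congr 1; ring
  rw [binTail_eq h1, e, inv_div]
  field_simp
  rfl

end Tail

/-! ### The threshold and the expected number of exceedances. -/

section Threshold

/-- The standard deviation of a binomial variable with parameters `n` and `p ^ k`. -/
noncomputable def sdev (k n : ℕ) (p : ℝ) : ℝ := √(n * p ^ k * (1 - p ^ k))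

/-- The leading term `√(2 k log n)` of the threshold, in standard deviations. -/
noncomputable def level (k n : ℕ) : ℝ := √(2 * k * Real.log n)

/-- The correction to the threshold, scaled by `level`. -/
noncomputable def correction (k n : ℕ) (y : ℝ) : ℝ :=
  Real.log (k.factorial : ℝ) + Real.log (4 * Real.pi * k * Real.log n) / 2 - y

/-- The threshold `a + σ y`. -/
noncomputable def threshold (k n : ℕ) (p y : ℝ) : ℝ := centring k n p + scaling k n p * y

variable {k : ℕ}

lemma tendsto_log_natCast : Tendsto (fun n : ℕ => Real.log n) atTop atTop :=
  Real.tendsto_log_atTop.comp tendsto_natCast_atTop_atTop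

lemma level_sq (n : ℕ) : level k n ^ 2 = 2 * k * Real.log n := by
  rw [level, Real.sq_sqrt]
  have := Real.log_natCast_nonneg n
  positivity

lemma level_pos (hk : 1 ≤ k) {n : ℕ} (hn : 0 < Real.log n) : 0 < level k n := by
  have : (0 : ℝ) < k := by exact_mod_cast hk
  rw [level, Real.sqrt_pos]
  positivity

lemma tendsto_level (hk : 1 ≤ k) : Tendsto (level k) atTop atTop := by
  have : (0 : ℝ) < k := by exact_mod_cast hk
  exact Real.tendsto_sqrt_atTop.comp (tendsto_log_natCast.const_mul_atTop (by positivity))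

/-- The square root in `centring` is `sdev * level` and `scaling` is `sdev / level`, so in standard
deviations the height is `level - correction / level`. Its square is `level² - 2 correction` up to a
vanishing term. -/
lemma threshold_eq (hk : 1 ≤ k) {n : ℕ} (hn : 0 < Real.log n) {p : ℝ} (h0 : 0 < p) (h1 : p < 1)
    (y : ℝ) :
    threshold k n p y = n * p ^ k + sdev k n p * (level k n - correction k n y / level k n) := by
  have hk' : (0 : ℝ) < k := by exact_mod_cast hk
  have hx := level_pos hk hn
  have hP0 : 0 < p ^ k := pow_pos h0 k
  have hP1 : 0 < 1 - p ^ k := sub_pos.2 (pow_lt_one₀ h0.le h1 (by omega))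
  have e1 : √(2 * k * p ^ k * (1 - p ^ k) * n * Real.log n) = sdev k n p * level k n := by
    rw [sdev, level, ← Real.sqrt_mul (by positivity)]
    congr 1; ring
  have e2 : √(p ^ k * (1 - p ^ k) * n / (2 * k * Real.log n)) = sdev k n p / level k n := by
    rw [sdev, level, ← Real.sqrt_div (by positivity)]
    congr 2; ring
  have e3 : 4 * k * Real.log n = 2 * level k n ^ 2 := by rw [level_sq]; ring
  rw [threshold, centring, scaling, e1, e2, e3, ← level_sq, correction]
  field_simp
  ring

lemma tendsto_loglog : Tendsto (fun n : ℕ => Real.log (Real.log n)) atTop atTop :=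
  Real.tendsto_log_atTop.comp tendsto_log_natCast

lemma tendsto_loglog_div_sqrt_log :
    Tendsto (fun n : ℕ => Real.log (Real.log n) / √(Real.log n)) atTop (𝓝 0) := by
  have h := (isLittleO_log_rpow_atTop (r := 1 / 2) (by norm_num)).tendsto_div_nhds_zero
  refine (h.comp tendsto_log_natCast).congr fun n => ?_
  simp only [Function.comp, Real.sqrt_eq_rpow]

lemma tendsto_correction_div_level (hk : 1 ≤ k) (y : ℝ) :
    Tendsto (fun n => correction k n y / level k n) atTop (𝓝 0) := by
  have hk' : (0 : ℝ) < k := by exact_mod_cast hk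
  set C := Real.log (k.factorial : ℝ) + Real.log (4 * Real.pi * k) / 2 - y with hC
  have h1 : Tendsto (fun n => C * (level k n)⁻¹ +
      Real.log (Real.log n) / √(Real.log n) * (2 * √(2 * k))⁻¹) atTop (𝓝 0) := by
    simpa using ((tendsto_inv_atTop_zero.comp (tendsto_level hk)).const_mul C).add
      (tendsto_loglog_div_sqrt_log.mul_const (2 * √(2 * k))⁻¹)
  refine h1.congr' ?_
  filter_upwards [tendsto_log_natCast.eventually_gt_atTop 0] with n hn
  have hx := level_pos hk hn
  have e : level k n = √(2 * k) * √(Real.log n) := by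
    rw [level, Real.sqrt_mul (by positivity)]
  rw [correction, Real.log_mul (by positivity) hn.ne', add_div, hC]
  have : √(2 * (k : ℝ)) ≠ 0 := by positivity
  have : √(Real.log n) ≠ 0 := by positivity
  rw [e]
  field_simp
  ring

variable {p : ℕ → ℝ}

/-- The standard deviation dominates the cube of the level. -/
lemma tendsto_level_pow_div_sdev (hk : 1 ≤ k) (hp : ∀ n, p n ∈ Set.Ioo (0 : ℝ) 1)
    (hL : Tendsto (fun n : ℕ => Real.log n ^ 3 / (n * p n ^ k * (1 - p n ^ k))) atTop (𝓝 0)) :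
    Tendsto (fun n => level k n ^ 3 / sdev k n (p n)) atTop (𝓝 0) := by
  have h := (hL.const_mul ((2 * k : ℝ) ^ 3)).sqrt
  rw [mul_zero, Real.sqrt_zero] at h
  refine h.congr fun n => ?_
  have hP0 : 0 < p n ^ k := pow_pos (hp n).1 k
  have hP1 : 0 < 1 - p n ^ k := sub_pos.2 (pow_lt_one₀ (hp n).1.le (hp n).2 (by omega))
  have hn := Real.log_natCast_nonneg n
  rw [← mul_div_assoc, Real.sqrt_div (by positivity), sdev, ← mul_pow, level]
  congr 1
  rw [Real.sqrt_eq_iff_mul_self_eq (by positivity) (by positivity), ← pow_two, ← pow_mul, mul_comm 3 2, pow_mul,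
    Real.sq_sqrt (by positivity)]

lemma tendsto_sdev (hk : 1 ≤ k) (hp : ∀ n, p n ∈ Set.Ioo (0 : ℝ) 1)
    (hL : Tendsto (fun n : ℕ => Real.log n ^ 3 / (n * p n ^ k * (1 - p n ^ k))) atTop (𝓝 0)) :
    Tendsto (fun n => sdev k n (p n)) atTop atTop := by
  have h := tendsto_level_pow_div_sdev hk hp hL
  refine tendsto_atTop_mono' _ ?_ (tendsto_level hk)
  filter_upwards [h.eventually (ge_mem_nhds one_pos), (tendsto_level hk).eventually_ge_atTop 1,
    eventually_gt_atTop 0] with n h1 h2 h3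
  have hP0 : 0 < p n ^ k := pow_pos (hp n).1 k
  have hP1 : 0 < 1 - p n ^ k := sub_pos.2 (pow_lt_one₀ (hp n).1.le (hp n).2 (by omega))
  have hs : 0 < sdev k n (p n) := by
    have : (0 : ℝ) < n := Nat.cast_pos.2 h3
    rw [sdev, Real.sqrt_pos]; positivity
  rw [div_le_one hs] at h1
  refine le_trans ?_ h1
  nlinarith [sq_nonneg (level k n)]

lemma tendsto_natCast_div_sub (c : ℕ) :
    Tendsto (fun n : ℕ => (n : ℝ) / (n - c : ℕ)) atTop (𝓝 1) := by
  have h : Tendsto (fun n : ℕ => 1 + (c : ℝ) / (n - c : ℕ)) atTop (𝓝 1) := by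
    simpa using ((tendsto_const_div_atTop_nhds_zero_nat (c : ℝ)).comp
      (tendsto_sub_atTop_nat c)).const_add 1
  refine h.congr' ?_
  filter_upwards [eventually_gt_atTop c] with n hn
  have : ((n - c : ℕ) : ℝ) = n - c := Nat.cast_sub hn.le
  have h2 : (0 : ℝ) < (n - c : ℕ) := Nat.cast_pos.2 (by omega)
  rw [this] at h2 ⊢
  field_simp
  ring

lemma tendsto_level_sq_div (c : ℕ) :
    Tendsto (fun n : ℕ => level k n ^ 2 / (n - c : ℕ)) atTop (𝓝 0) := by
  have h1 : Tendsto (fun n : ℕ => Real.log n / n) atTop (𝓝 0) :=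
    (Real.isLittleO_log_id_atTop.tendsto_div_nhds_zero).comp tendsto_natCast_atTop_atTop
  have h := ((h1.const_mul (2 * k : ℝ)).mul (tendsto_natCast_div_sub c))
  simp only [mul_zero, zero_mul] at h
  refine h.congr' ?_
  filter_upwards [eventually_gt_atTop 0] with n hn
  have : (n : ℝ) ≠ 0 := by positivity
  rw [level_sq]
  field_simp

/-- The expected number of exceedances, up to bounded changes of the number of trials and of the
threshold. -/
lemma tendsto_choose_mul_binTail (hk : 1 ≤ k) (hp : ∀ n, p n ∈ Set.Ioo (0 : ℝ) 1)
    (hL : Tendsto (fun n : ℕ => Real.log n ^ 3 / (n * p n ^ k * (1 - p n ^ k))) atTop (𝓝 0))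
    (c : ℕ) (d y : ℝ) :
    Tendsto (fun n : ℕ => (n.choose k : ℝ) *
      binTail (n - c) (p n ^ k) (threshold k n (p n) y - d)) atTop (𝓝 (Real.exp (-y))) := by
  have hk' : (0 : ℝ) < k := by exact_mod_cast hk
  have hP : ∀ n, 0 < p n ^ k ∧ p n ^ k < 1 := fun n =>
    ⟨pow_pos (hp n).1 k, pow_lt_one₀ (hp n).1.le (hp n).2 (by omega)⟩
  have hlev := tendsto_level hk
  have hsd := tendsto_sdev hk hp hL
  have hls3 := tendsto_level_pow_div_sdev hk hp hL
  have hls : Tendsto (fun n => level k n / sdev k n (p n)) atTop (𝓝 0) := by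
    refine tendsto_of_tendsto_of_tendsto_of_le_of_le' tendsto_const_nhds hls3 ?_ ?_
    · filter_upwards with n
      exact div_nonneg (Real.sqrt_nonneg _) (Real.sqrt_nonneg _)
    · filter_upwards [hlev.eventually_ge_atTop 1] with n h1
      have : 0 ≤ sdev k n (p n) := Real.sqrt_nonneg _
      have : level k n ≤ level k n ^ 3 := by nlinarith [sq_nonneg (level k n)]
      gcongr
  have hcor := tendsto_correction_div_level hk y
  set v : ℕ → ℝ := fun n => (n - c : ℕ) * p n ^ k * (1 - p n ^ k) with hv
  set w : ℕ → ℝ := fun n =>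
    (threshold k n (p n) y - d - (n - c : ℕ) * p n ^ k) / √(v n) with hw
  -- The effect, in standard deviations, of dropping `c` trials and lowering the threshold by `d`.
  -- It is a bounded quantity over `sdev`, so even its product with `level` vanishes, and the square
  -- of the height is unaffected in the limit.
  set e : ℕ → ℝ := fun n => (c * p n ^ k - d) / sdev k n (p n) with he
  set ζ : ℕ → ℝ := fun n => correction k n y / level k n - e n with hζ
  have hbdd : ∀ n, |c * p n ^ k - d| ≤ c + |d| := fun n => by
    refine (abs_sub _ _).trans ?_
    rw [abs_of_nonneg (mul_nonneg (Nat.cast_nonneg c) (hP n).1.le)]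
    have := mul_le_of_le_one_right (Nat.cast_nonneg (α := ℝ) c) (hP n).2.le
    linarith
  have hlev_e : Tendsto (fun n => level k n * e n) atTop (𝓝 0) := by
    have h0 : Tendsto (fun n => (c + |d|) * (level k n / sdev k n (p n))) atTop (𝓝 0) := by
      simpa using hls.const_mul (c + |d|)
    refine squeeze_zero_norm (fun n => ?_) h0
    have h1 : 0 ≤ sdev k n (p n) := Real.sqrt_nonneg _
    have h2 : 0 ≤ level k n := Real.sqrt_nonneg _
    rw [Real.norm_eq_abs, abs_mul, he, abs_div, abs_of_nonneg h1, abs_of_nonneg h2, mul_div_assoc',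
      mul_div_assoc', mul_comm]
    have := hbdd n
    gcongr
  have he0 : Tendsto e atTop (𝓝 0) := by
    refine squeeze_zero_norm' ?_ (by simpa only [norm_zero] using hlev_e.norm)
    filter_upwards [hlev.eventually_ge_atTop 1] with n hn
    rw [norm_mul]
    refine le_mul_of_one_le_left (norm_nonneg _) ?_
    rwa [Real.norm_eq_abs, abs_of_nonneg (by linarith)]
  have hζ0 : Tendsto ζ atTop (𝓝 0) := by simpa using hcor.sub he0
  have hnN := tendsto_natCast_div_sub c
  have hbasic : ∀ᶠ n : ℕ in atTop, c < n ∧ 0 < level k n ∧ 0 < sdev k n (p n) ∧ 0 < √(v n) ∧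
      w n = √((n : ℝ) / (n - c : ℕ)) * (level k n - ζ n) ∧
      √(v n) = sdev k n (p n) / √((n : ℝ) / (n - c : ℕ)) := by
    filter_upwards [eventually_gt_atTop c, hlev.eventually_gt_atTop 0, hsd.eventually_gt_atTop 0,
      tendsto_log_natCast.eventually_gt_atTop 0] with n h1 h2 h3 h4
    have hN : (0 : ℝ) < (n - c : ℕ) := Nat.cast_pos.2 (by omega)
    have hn : (0 : ℝ) < n := Nat.cast_pos.2 (by omega)
    have hN' : ((n - c : ℕ) : ℝ) = n - c := Nat.cast_sub h1.le
    have h5 := (hP n).1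
    have h6 := sub_pos.2 (hP n).2
    have h7 : √(v n) = sdev k n (p n) / √((n : ℝ) / (n - c : ℕ)) := by
      rw [sdev, ← Real.sqrt_div (by positivity)]
      congr 1
      simp only [hv]
      field_simp
    have h8 : 0 < √(v n) := by
      rw [h7]; positivity
    refine ⟨h1, h2, h3, h8, ?_, h7⟩
    simp only [hw]
    rw [threshold_eq hk h4 (hp n).1 (hp n).2, h7]
    have h9 : 0 < √((n : ℝ) / (n - c : ℕ)) := by positivity
    simp only [hζ, he]
    rw [hN'] at h9 ⊢
    field_simp
    ring
  have hv' : Tendsto v atTop atTop := by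
    have h1 : Tendsto (fun n => sdev k n (p n) * (√((n : ℝ) / (n - c : ℕ)))⁻¹) atTop atTop := by
      refine hsd.atTop_mul_pos one_pos ?_
      simpa using (hnN.sqrt).inv₀ (by norm_num)
    have h2 : Tendsto (fun n => √(v n)) atTop atTop :=
      h1.congr' (hbasic.mono fun n h =>
        (h.2.2.2.2.2.trans (div_eq_mul_inv _ _)).symm)
    have h3 := h2.atTop_mul_atTop₀ h2
    refine h3.congr fun n => ?_
    refine Real.mul_self_sqrt ?_
    have := (hP n).1.le
    have := sub_nonneg.2 (hP n).2.le
    positivity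
  have hwlev : Tendsto (fun n => w n / level k n) atTop (𝓝 1) := by
    have h := hnN.sqrt.mul ((hζ0.mul (tendsto_inv_atTop_zero.comp hlev)).const_sub 1)
    simp only [Real.sqrt_one, mul_zero, sub_zero, mul_one] at h
    refine h.congr' ?_
    filter_upwards [hbasic] with n ⟨h1, h2, h3, h4, h5, h6⟩
    rw [h5]
    simp only [Function.comp]
    field_simp
  have hw' : Tendsto w atTop atTop := by
    have h := hlev.atTop_mul_pos one_pos hwlev
    refine h.congr' ?_
    filter_upwards [hbasic] with n ⟨h1, h2, h3, h4, h5, h6⟩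
    field_simp
  have hwv : Tendsto (fun n => w n ^ 3 / √(v n)) atTop (𝓝 0) := by
    have h := ((hwlev.pow 3).mul hls3).mul hnN.sqrt
    simp only [mul_zero, zero_mul] at h
    refine h.congr' ?_
    filter_upwards [hbasic] with n ⟨h1, h2, h3, h4, h5, h6⟩
    rw [h6]
    have hn : (0 : ℝ) < n := Nat.cast_pos.2 (by omega)
    have hN : (0 : ℝ) < (n - c : ℕ) := Nat.cast_pos.2 (by omega)
    have h9 : 0 < √((n : ℝ) / (n - c : ℕ)) := by positivity
    field_simp
  have hsq : Tendsto (fun n => w n ^ 2 - (level k n ^ 2 - 2 * correction k n y)) atTop (𝓝 0) := by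
    have h1 := (((tendsto_level_sq_div (k := k) c).const_mul (c : ℝ)).mul
      (((hζ0.mul (tendsto_inv_atTop_zero.comp hlev)).const_sub 1).pow 2)).add
      ((hζ0.pow 2).add (hlev_e.const_mul 2))
    simp only [mul_zero, zero_mul, ne_eq, OfNat.ofNat_ne_zero, not_false_eq_true, zero_pow,
      add_zero] at h1
    refine h1.congr' ?_
    filter_upwards [hbasic] with n ⟨h1, h2, h3, h4, h5, h6⟩
    have hN : (0 : ℝ) < (n - c : ℕ) := Nat.cast_pos.2 (by omega)
    have hN' : ((n - c : ℕ) : ℝ) = n - c := Nat.cast_sub h1.le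
    rw [h5, mul_pow, Real.sq_sqrt (by positivity)]
    simp only [Function.comp]
    have hc : correction k n y = level k n * (ζ n + e n) := by
      simp only [hζ]; field_simp; ring
    rw [hc]
    rw [hN'] at hN ⊢
    field_simp
    ring
  have hmain := tendsto_binTail (N := fun n => n - c) (P := fun n => p n ^ k) (v := v) (w := w)
    (x := fun n => threshold k n (p n) y - d) hP (fun _ => rfl) (fun _ => rfl) hv' hw' hwv
  have hexp : Tendsto (fun n => Real.exp (-((w n ^ 2 - (level k n ^ 2 - 2 * correction k n y)) / 2)))
      atTop (𝓝 1) := by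
    rw [← Real.exp_zero]
    refine (Real.continuous_exp.tendsto 0).comp ?_
    simpa using (hsq.div_const 2).neg
  have hchoose : Tendsto (fun n : ℕ => (n.choose k : ℝ) / (n ^ k / k.factorial)) atTop (𝓝 1) := by
    refine (isEquivalent_iff_tendsto_one ?_).1 (isEquivalent_choose k)
    filter_upwards [eventually_gt_atTop 0] with n hn
    have : (0 : ℝ) < n := Nat.cast_pos.2 hn
    positivity
  have h := (((hmain.mul (hwlev.inv₀ one_ne_zero)).mul hexp).mul hchoose).mul_const (Real.exp (-y))
  simp only [inv_one, mul_one, one_mul] at h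
  refine h.congr' ?_
  filter_upwards [hbasic, hw'.eventually_gt_atTop 0, tendsto_log_natCast.eventually_gt_atTop 0]
    with n ⟨h1, h2, h3, h4, h5, h6⟩ h7 h8
  have hn : (0 : ℝ) < n := Nat.cast_pos.2 (by omega)
  -- The constants in `correction` act here: `exp (level² / 2) = n ^ k`, the factorial matches
  -- `n.choose k`, and `√(4 π k log n) = √(2 π) * level` is the prefactor of the Gaussian tail.
  have e1 : Real.exp (w n ^ 2 / 2) *
      Real.exp (-((w n ^ 2 - (level k n ^ 2 - 2 * correction k n y)) / 2)) =
      n ^ k * Real.exp y / (k.factorial * (√(2 * Real.pi) * level k n)) := by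
    rw [← Real.exp_add]
    have : w n ^ 2 / 2 + -((w n ^ 2 - (level k n ^ 2 - 2 * correction k n y)) / 2) =
        k * Real.log n + y - Real.log (k.factorial : ℝ) -
          Real.log (4 * Real.pi * k * Real.log n) / 2 := by
      rw [level_sq, correction]; ring
    rw [this, Real.exp_sub, Real.exp_sub, Real.exp_add, Real.exp_nat_mul, Real.exp_log hn,
      Real.exp_log (by positivity), div_div]
    congr 2
    rw [← Real.log_sqrt (by positivity), Real.exp_log (by positivity), level,
      ← Real.sqrt_mul (by positivity)]
    congr 1; ring
  have e2 : Real.exp (-y) * Real.exp y = 1 := by rw [← Real.exp_add]; simp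
  have hfac : (k.factorial : ℝ) ≠ 0 := by positivity
  have hs2 : √(2 * Real.pi) ≠ 0 := by positivity
  generalize binTail (n - c) (p n ^ k) (threshold k n (p n) y - d) = b
  calc _ = b * (n.choose k : ℝ) * (√(2 * Real.pi) * (Real.exp (w n ^ 2 / 2) *
        Real.exp (-((w n ^ 2 - (level k n ^ 2 - 2 * correction k n y)) / 2)))) *
        (w n * (w n / level k n)⁻¹) / (n ^ k / k.factorial) * Real.exp (-y) := by ring
    _ = b * (n.choose k : ℝ) * (Real.exp (-y) * Real.exp y) := by
      rw [e1]
      have : w n * (w n / level k n)⁻¹ = level k n := by field_simp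
      rw [this]
      generalize √(2 * Real.pi) = r at hs2 ⊢
      field_simp
    _ = _ := by rw [e2]; ring

end Threshold

/-! ### Exponential-moment bounds and the correlation gap. -/

section Chernoff

lemma exp_sub_one_le {β : ℝ} (h0 : 0 ≤ β) (h1 : β ≤ 1) : Real.exp β - 1 ≤ β + β ^ 2 := by
  have := (abs_le.1 (Real.abs_exp_sub_one_sub_id_le (x := β) (by rwa [abs_of_nonneg h0]))).2
  linarith

/-- The conditional Chernoff bound for the number of common neighbours of a subset. -/
lemma subset_mgf_le {N j : ℕ} {n P Q T g D π : ℝ} (hP : 0 < P) (hPQ : P < Q) (hQ : Q < 1)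
    (hNn : (N : ℝ) ≤ n) (hjN : j ≤ N) (hj : n * P ≤ j) (hjT : (j : ℝ) ≤ T)
    (hD : D = n * (Q - P)) (hD0 : 0 < D) (hg : 0 ≤ g) (hgD : g ≤ 2 * √D)
    (hπ : π = (Q - P) / (1 - P)) :
    (Real.exp (g / (2 * √D)) * P) ^ j *
        (Real.exp (g / (2 * √D)) * (Q - P) + (1 - Q)) ^ (N - j) *
        Real.exp (g / (2 * √D)) ^ (-(n * π + T * (1 - π) + g * √D)) ≤
      Real.exp (-(g ^ 2 / 4)) * (P ^ j * (1 - P) ^ (N - j)) := by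
  have hs : 0 < √D := Real.sqrt_pos.2 hD0
  have hsq : √D ^ 2 = D := Real.sq_sqrt hD0.le
  -- This minimizes `D β² - β g √D`, with value `-g² / 4`; the bound on `g` ensures `β ≤ 1`.
  set β := g / (2 * √D) with hβ
  have hβ0 : 0 ≤ β := by positivity
  have hβ1 : β ≤ 1 := by rw [hβ, div_le_one (by positivity)]; exact hgD
  have hP1 : 0 < 1 - P := by linarith
  have hπ0 : 0 ≤ π := by rw [hπ]; exact div_nonneg (by linarith) hP1.le
  have hπ1 : π ≤ 1 := by rw [hπ, div_le_one hP1]; linarith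
  have hπP : π * (1 - P) = Q - P := by rw [hπ, div_mul_cancel₀ _ hP1.ne']
  have hjN' : (j : ℝ) ≤ N := Nat.cast_le.2 hjN
  -- `π` is the probability that a vertex sees `W`, given that it does not see all of `U`.
  have hfac : Real.exp β * (Q - P) + (1 - Q) = (1 - P) * (1 + π * (Real.exp β - 1)) := by
    linear_combination (1 - Real.exp β) * hπP
  have he1 : 0 ≤ Real.exp β - 1 := by linarith [Real.add_one_le_exp β]
  have hle : 1 + π * (Real.exp β - 1) ≤ Real.exp (π * (β + β ^ 2)) := by
    have h1 : π * (Real.exp β - 1) ≤ π * (β + β ^ 2) :=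
      mul_le_mul_of_nonneg_left (exp_sub_one_le hβ0 hβ1) hπ0
    linarith [Real.add_one_le_exp (π * (β + β ^ 2))]
  have hpow : (1 + π * (Real.exp β - 1)) ^ (N - j) ≤
      Real.exp (((N : ℝ) - j) * (π * (β + β ^ 2))) := by
    rw [← Nat.cast_sub hjN, Real.exp_nat_mul]
    exact pow_le_pow_left₀ (by positivity) hle _
  have hexpo : j * β + ((N : ℝ) - j) * (π * (β + β ^ 2)) +
      β * (-(n * π + T * (1 - π) + g * √D)) ≤ -(g ^ 2 / 4) := by
    have h1 : ((N : ℝ) - j) * (π * (β + β ^ 2)) ≤ (n - j) * (π * (β + β ^ 2)) := by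
      gcongr
    -- As `j` is at least the mean `n P`, at most `n (1 - P)` vertices remain, and `n (1 - P) π =
    -- D`.
    have h2 : (n - j) * (π * β ^ 2) ≤ D * β ^ 2 := by
      have : (n - j) * π ≤ D := by
        have h3 : (n - j) * π ≤ (n - n * P) * π := by gcongr
        calc _ ≤ _ := h3
          _ = n * (π * (1 - P)) := by ring
          _ = D := by rw [hπP, hD]
      calc _ = ((n - j) * π) * β ^ 2 := by ring
        _ ≤ _ := by gcongr
    have h4 : (j : ℝ) * (1 - π) ≤ T * (1 - π) := by
      have : 0 ≤ 1 - π := by linarith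
      gcongr
    have h5 : β * (j * (1 - π)) ≤ β * (T * (1 - π)) := by gcongr
    have h6 : D * β ^ 2 = g ^ 2 / 4 := by
      rw [← hsq, hβ]; field_simp; norm_num
    have h7 : β * (g * √D) = g ^ 2 / 2 := by
      rw [hβ]; field_simp
    nlinarith
  rw [hfac, mul_pow, mul_pow, ← Real.exp_mul, ← Real.exp_nat_mul]
  have hnn : 0 ≤ P ^ j * (1 - P) ^ (N - j) := by positivity
  calc _ = (P ^ j * (1 - P) ^ (N - j)) * (Real.exp (j * β) * (1 + π * (Real.exp β - 1)) ^ (N - j) *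
        Real.exp (β * (-(n * π + T * (1 - π) + g * √D)))) := by ring
    _ ≤ (P ^ j * (1 - P) ^ (N - j)) * (Real.exp (j * β) *
        Real.exp (((N : ℝ) - j) * (π * (β + β ^ 2))) *
        Real.exp (β * (-(n * π + T * (1 - π) + g * √D)))) := by gcongr
    _ ≤ (P ^ j * (1 - P) ^ (N - j)) * Real.exp (-(g ^ 2 / 4)) := by
      rw [← Real.exp_add, ← Real.exp_add]
      gcongr
    _ = _ := mul_comm _ _

/-- A bound for the moment generating function of a Bernoulli variable, with the right variance. -/
lemma bernoulli_mgf_le {q α : ℝ} (hq0 : 0 ≤ q) (hq1 : q ≤ 1) (h0 : 0 ≤ α) (h1 : α ≤ 1) :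
    1 + q * (Real.exp α - 1) ≤
      Real.exp (q * α + q * (1 - q) * (α ^ 2 / 2) * (1 + α)) := by
  have hcub : ∀ u : ℝ, |u| ≤ 1 → Real.exp u ≤ 1 + u + u ^ 2 / 2 + |u| ^ 3 / 2 := by
    intro u hu
    have h := (abs_le.1 (Real.exp_bound hu (n := 3) (by norm_num))).2
    simp only [sum_range_succ, range_zero, sum_empty, Nat.factorial] at h
    norm_num at h
    have := pow_nonneg (abs_nonneg u) 3
    linarith
  have hA := hcub (-(q * α)) (by
    rw [abs_neg, abs_of_nonneg (by positivity)]
    exact mul_le_one₀ hq1 h0 h1)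
  have hB := hcub ((1 - q) * α) (by
    rw [abs_of_nonneg (mul_nonneg (by linarith) h0)]
    exact mul_le_one₀ (by linarith) h0 h1)
  rw [abs_neg, abs_of_nonneg (by positivity)] at hA
  rw [abs_of_nonneg (mul_nonneg (by linarith) h0)] at hB
  have hq1' : 0 ≤ 1 - q := by linarith
  -- After centring, the first-order terms cancel and the second-order ones give the variance `q (1
  -- - q)`, which a cruder bound on `exp α - 1` would miss.
  have hsplit : (1 + q * (Real.exp α - 1)) * Real.exp (-(q * α)) =
      (1 - q) * Real.exp (-(q * α)) + q * Real.exp ((1 - q) * α) := by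
    have : Real.exp ((1 - q) * α) = Real.exp α * Real.exp (-(q * α)) := by
      rw [← Real.exp_add]; congr 1; ring
    rw [this]; ring
  have hmain : (1 + q * (Real.exp α - 1)) * Real.exp (-(q * α)) ≤
      1 + q * (1 - q) * (α ^ 2 / 2) * (1 + α) := by
    rw [hsplit]
    have h2 := mul_le_mul_of_nonneg_left hA hq1'
    have h3 := mul_le_mul_of_nonneg_left hB hq0
    have h4 : q * (1 - q) * α ^ 3 * (q ^ 2 + (1 - q) ^ 2) ≤ q * (1 - q) * α ^ 3 := by
      refine mul_le_of_le_one_right (by positivity) ?_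
      nlinarith
    nlinarith
  have h5 : (1 + q * (Real.exp α - 1)) * Real.exp (-(q * α)) ≤
      Real.exp (q * (1 - q) * (α ^ 2 / 2) * (1 + α)) := by
    linarith [Real.add_one_le_exp (q * (1 - q) * (α ^ 2 / 2) * (1 + α))]
  rw [Real.exp_add]
  calc _ = Real.exp (q * α) * ((1 + q * (Real.exp α - 1)) * Real.exp (-(q * α))) := by
        rw [mul_comm (1 + q * (Real.exp α - 1)), ← mul_assoc, ← Real.exp_add]; simp
    _ ≤ _ := by gcongr

/-- The gap that makes overlapping sets asymptotically negligible. -/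
lemma overlap_gap {p : ℝ} (h0 : 0 < p) (h1 : p < 1) {r m : ℕ} (hr : 1 ≤ r) (hm : 1 ≤ m) :
    (1 - p) / (r + m) ≤ r - (r + m) * (p ^ m * ((1 - p ^ r) / (1 - p ^ (r + m)))) := by
  have hp1 : 0 < 1 - p := sub_pos.2 h1
  have hpm : 0 < p ^ m := pow_pos h0 m
  have hk : 0 < 1 - p ^ (r + m) := sub_pos.2 (pow_lt_one₀ h0.le h1 (by omega))
  have hr' : (1 : ℝ) ≤ r := by exact_mod_cast hr
  have hm' : (1 : ℝ) ≤ m := by exact_mod_cast hm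
  have hbern : ∀ i : ℕ, 1 - p ^ i ≤ i * (1 - p) := fun i => by
    have := one_add_mul_le_pow (a := p - 1) (by linarith) i
    rw [add_sub_cancel] at this
    linarith
  have hsum : 1 + (m - 1) * p ^ m ≤ ∑ i ∈ range m, p ^ i := by
    obtain ⟨l, rfl⟩ : ∃ l, m = l + 1 := ⟨m - 1, by omega⟩
    rw [sum_range_succ', pow_zero, add_comm]
    refine add_le_add ?_ le_rfl
    have : ∑ i ∈ range l, p ^ (i + 1) ≥ ∑ _i ∈ range l, p ^ (l + 1) :=
      sum_le_sum fun i hi => pow_le_pow_of_le_one h0.le h1.le (by rw [mem_range] at hi; omega)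
    rw [sum_const, card_range, nsmul_eq_mul] at this
    push_cast
    linarith
  have hgeom := mul_neg_geom_sum p m
  have hpm1 : p ^ m ≤ p := pow_le_of_le_one h0.le h1.le (by omega)
  have h2 : (1 - p) * (1 + (m - 1) * p ^ m) ≤ 1 - p ^ m := by
    rw [← hgeom]; gcongr
  -- The right side equals `r (1 - p ^ m) - m p ^ m (1 - p ^ r)`. The geometric sum bounds the first
  -- term below and Bernoulli's inequality bounds the second above, leaving at least `r (1 - p) (1 -
  -- p ^ m)`. Dividing by `1 - p ^ (r + m) ≤ (r + m) (1 - p)` then gives the gap.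
  have h3 : (1 - p) ^ 2 ≤ r * (1 - p ^ (r + m)) - (r + m) * (p ^ m * (1 - p ^ r)) := by
    have e : r * (1 - p ^ (r + m)) - (r + m) * (p ^ m * (1 - p ^ r)) =
        r * (1 - p ^ m) - m * p ^ m * (1 - p ^ r) := by rw [pow_add]; ring
    have h4 : m * p ^ m * (1 - p ^ r) ≤ m * p ^ m * (r * (1 - p)) := by
      have := hbern r
      gcongr
    have h5 : r * ((1 - p) * (1 + (m - 1) * p ^ m)) ≤ r * (1 - p ^ m) := by gcongr
    have h6 : (1 - p) ^ 2 ≤ (1 - p) * (1 - p ^ m) := by rw [pow_two]; gcongr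
    have h7 : 0 ≤ (1 - p) * (1 - p ^ m) := (sq_nonneg _).trans h6
    rw [e]
    nlinarith
  have e2 : r - (r + m) * (p ^ m * ((1 - p ^ r) / (1 - p ^ (r + m)))) =
      (r * (1 - p ^ (r + m)) - (r + m) * (p ^ m * (1 - p ^ r))) / (1 - p ^ (r + m)) := by
    field_simp
  rw [e2, div_le_div_iff₀ (by positivity) hk]
  have h8 := hbern (r + m)
  push_cast at h8
  have h9 : (0 : ℝ) ≤ r + m := by positivity
  nlinarith [mul_le_mul_of_nonneg_right h3 h9, mul_le_mul_of_nonneg_left h8 hp1.le]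

end Chernoff

/-! ### Asymptotic negligibility of overlapping exceedances. -/

section Limits

/-- In the application `q = p ^ (k - r)`, `Q = p ^ r`, and `ρ` is the correlation of the two counts.
To leading order the capped mean of the second count lies `(1 - ρ) x s` below `t`, and its variance
is `(1 - ρ) s²`. The quotient `x / s` is therefore the right exponent and yields `-(1 - ρ) x² / 2`.
The remaining terms come to at most `2 x + x g + 6`, hence the `9 x g`. -/
lemma pair_mgf_le {n q Q P s x h l g D π t T ρ K : ℝ} (hn : 0 < n) (hq0 : 0 < q)
    (hq1 : q < 1) (hQ0 : 0 < Q) (hQ1 : Q < 1) (hP : P = q * Q) (hs : s = √(n * P * (1 - P)))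
    (hx : 1 ≤ x) (hh : |h| ≤ x) (hl0 : 0 ≤ l) (hl : l ≤ x) (hg1 : 1 ≤ g) (hgx : g ≤ x)
    (hxs : x ^ 3 / s ≤ 1) (hK : x / s * K ≤ 1) (hD : D = n * (Q - P))
    (hπ : π = (Q - P) / (1 - P)) (ht : t = n * P + s * (x - h / x))
    (hT : T = n * P + s * (x - (h - l) / x)) (hρ : ρ = q * ((1 - Q) / (1 - P))) :
    Real.exp (-(x / s * (t - K))) *
        (1 + q * (Real.exp (x / s) - 1)) ^ (n * π + T * (1 - π) + g * √D) ≤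
      Real.exp (-((1 - ρ) * (x ^ 2 / 2)) + 9 * (x * g)) := by
  have hP0 : 0 < P := by rw [hP]; positivity
  have hPq : P < q := by rw [hP]; exact mul_lt_of_lt_one_right hq0 hQ1
  have hPQ : P < Q := by rw [hP]; exact mul_lt_of_lt_one_left hQ0 hq1
  have hP1 : 0 < 1 - P := by linarith
  have hs2pos : 0 < n * P * (1 - P) := by positivity
  have hs0 : 0 < s := by rw [hs]; exact Real.sqrt_pos.2 hs2pos
  have hs2 : s ^ 2 = n * P * (1 - P) := by rw [hs, Real.sq_sqrt hs2pos.le]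
  have hx0 : 0 < x := by linarith
  have hD0 : 0 ≤ D := by rw [hD]; exact mul_nonneg hn.le (by linarith)
  set α := x / s with hα
  have hα0 : 0 < α := by positivity
  have hαs : α * s = x := div_mul_cancel₀ _ hs0.ne'
  have hx3 : α * x ^ 2 ≤ 1 := by
    refine le_trans (le_of_eq ?_) hxs
    rw [hα]; ring
  have hα1 : α ≤ 1 := (le_mul_of_one_le_right hα0.le (one_le_pow₀ hx)).trans hx3
  have hπP : π * (1 - P) = Q - P := by rw [hπ, div_mul_cancel₀ _ hP1.ne']
  have hπ1 : 1 - π = (1 - Q) / (1 - P) := by rw [hπ]; field_simp; ring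
  have hρ' : ρ = q * (1 - π) := by rw [hρ, hπ1]
  have hπ01 : 0 ≤ 1 - π := by rw [hπ1]; exact div_nonneg (by linarith) hP1.le
  have hπ0 : 0 ≤ π := by rw [hπ]; exact div_nonneg (by linarith) hP1.le
  have hρ0 : 0 ≤ ρ := by rw [hρ']; positivity
  have h1ρ : (1 - ρ) * (1 - P) = 1 - q := by
    have : (1 - Q) / (1 - P) * (1 - P) = 1 - Q := div_mul_cancel₀ _ hP1.ne'
    rw [hρ]
    linear_combination -q * this - hP
  have hρ1' : 0 ≤ 1 - ρ :=
    le_of_mul_le_mul_right (by rw [h1ρ, zero_mul]; linarith) hP1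
  have hρ1 : ρ ≤ 1 := sub_nonneg.1 hρ1'
  have hhl := abs_le.1 hh
  set θ := s * (x - (h - l) / x) with hθ
  have hhx : -1 ≤ h / x ∧ h / x ≤ 1 := by
    rw [le_div_iff₀ hx0, div_le_one hx0]; constructor <;> linarith
  have hlx : 0 ≤ l / x ∧ l / x ≤ 1 := by
    rw [div_le_one hx0]; exact ⟨by positivity, hl⟩
  have hθ0 : 0 ≤ θ := by
    refine mul_nonneg hs0.le ?_
    rw [sub_div]; linarith
  have hθ1 : θ ≤ 3 * (s * x) := by
    have : x - (h - l) / x ≤ 3 * x := by rw [sub_div]; linarith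
    calc θ ≤ s * (3 * x) := mul_le_mul_of_nonneg_left this hs0.le
      _ = _ := by ring
  have hDq : √D * q ≤ s := by
    rw [hs]
    refine Real.le_sqrt_of_sq_le ?_
    rw [mul_pow, Real.sq_sqrt hD0, hD]
    have e : n * (Q - P) * q ^ 2 = n * P * (q * (1 - q)) := by rw [hP]; ring
    have : q * (1 - q) ≤ 1 - P :=
      (mul_le_of_le_one_left (by linarith) hq1.le).trans (by linarith)
    rw [e]
    gcongr
  set b := n * π + T * (1 - π) + g * √D with hb
  have hT0 : 0 ≤ T := by rw [hT]; positivity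
  have hb0 : 0 ≤ b := by positivity
  have hbq : b * q = n * P + θ * ρ + g * (√D * q) := by
    have e : n * q * (π * (1 - P)) = n * q * (Q - P) := by rw [hπP]
    rw [hb, hT, hρ']
    linear_combination e - n * hP
  -- The identity `(1 - ρ) (1 - P) = 1 - q` makes the variance carry the same factor `1 - ρ` as the
  -- gap in the mean.
  have hvar : n * P * (1 - q) * α ^ 2 = (1 - ρ) * x ^ 2 := by
    have : n * P * (1 - q) = (1 - ρ) * s ^ 2 := by rw [hs2, ← h1ρ]; ring
    rw [this, ← hαs]; ring
  have hαt : α * t = α * (n * P) + x ^ 2 - h := by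
    rw [ht, hα]; field_simp; ring
  have hαθ : α * θ = x ^ 2 - h + l := by
    rw [hθ, hα]; field_simp; ring
  have hpow : (1 + q * (Real.exp α - 1)) ^ b ≤
      Real.exp ((q * α + q * (1 - q) * (α ^ 2 / 2) * (1 + α)) * b) := by
    rw [Real.exp_mul]
    refine Real.rpow_le_rpow ?_ (bernoulli_mgf_le hq0.le hq1.le hα0.le hα1) hb0
    have : 0 ≤ Real.exp α - 1 := by linarith [Real.add_one_le_exp α]
    positivity
  refine (mul_le_mul_of_nonneg_left hpow (Real.exp_pos _).le).trans ?_
  rw [← Real.exp_add, Real.exp_le_exp]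
  have hmean : α * (b * q) = α * (n * P) + ρ * (x ^ 2 - h + l) + g * (α * (√D * q)) := by
    rw [hbq, ← hαθ]; ring
  have hgs : g * (α * (√D * q)) ≤ x * g := by
    have : α * (√D * q) ≤ α * s := by gcongr
    rw [hαs] at this
    rw [mul_comm x]
    exact mul_le_mul_of_nonneg_left this (by linarith)
  have hquad : b * q * ((1 - q) * (α ^ 2 / 2) * (1 + α)) ≤ (1 - ρ) * (x ^ 2 / 2) + 5 := by
    have h1 : n * P * ((1 - q) * (α ^ 2 / 2) * (1 + α)) = (1 - ρ) * (x ^ 2 / 2) * (1 + α) := by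
      linear_combination (1 + α) / 2 * hvar
    have h2 : (1 - ρ) * (x ^ 2 / 2) * α ≤ 1 := by
      have : (1 - ρ) * (α * x ^ 2) ≤ 1 * 1 := by
        apply mul_le_mul (by linarith) hx3 (by positivity) (by norm_num)
      linarith
    have h3 : θ * ρ + g * (√D * q) ≤ 4 * (s * x) := by
      have : θ * ρ ≤ θ := mul_le_of_le_one_right hθ0 hρ1
      have : g * (√D * q) ≤ x * s := by gcongr
      linarith
    have h4 : (1 - q) * (α ^ 2 / 2) * (1 + α) ≤ α ^ 2 := by
      have : (1 - q) * (1 + α) ≤ 1 * 2 :=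
        mul_le_mul (by linarith) (by linarith) (by linarith) (by norm_num)
      have := mul_le_mul_of_nonneg_right this (show 0 ≤ α ^ 2 / 2 by positivity)
      linarith
    have h5 : (θ * ρ + g * (√D * q)) * ((1 - q) * (α ^ 2 / 2) * (1 + α)) ≤
        4 * (s * x) * α ^ 2 := by
      have : 0 ≤ (1 - q) * (α ^ 2 / 2) * (1 + α) :=
        mul_nonneg (mul_nonneg (by linarith) (by positivity)) (by linarith)
      gcongr
    have h6 : 4 * (s * x) * α ^ 2 = 4 * (α * x ^ 2) := by
      rw [← hαs]; ring
    rw [hbq, add_assoc, add_mul, h1]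
    linarith
  have hh' : (1 - ρ) * h ≤ x := by
    have h1 : (1 - ρ) * h ≤ (1 - ρ) * x := mul_le_mul_of_nonneg_left hhl.2 hρ1'
    have h2 : (1 - ρ) * x ≤ x := mul_le_of_le_one_left hx0.le (by linarith)
    exact h1.trans h2
  have hl' : ρ * l ≤ x := (mul_le_of_le_one_left hl0 hρ1).trans hl
  have hxg : x ≤ x * g := le_mul_of_one_le_right hx0.le hg1
  have e : -(α * (t - K)) + (q * α + q * (1 - q) * (α ^ 2 / 2) * (1 + α)) * b =
      -(α * t) + α * K + α * (b * q) + b * q * ((1 - q) * (α ^ 2 / 2) * (1 + α)) := by ring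
  rw [e, hαt, hmean]
  linarith

variable {k : ℕ} {p : ℕ → ℝ}

lemma one_sub_le_one_sub_pow {p : ℝ} (h0 : 0 ≤ p) (h1 : p ≤ 1) (hk : 1 ≤ k) :
    1 - p ≤ 1 - p ^ k := by
  have := pow_le_of_le_one h0 h1 (by omega : k ≠ 0); linarith

/-- For `p ≤ 1 / 2` the factor `1 - p ^ k` is at least `1 / 2` and the lower bound on `p` decides.
For larger `p`, `p ^ k` is bounded below and `1 - p ≥ 1 / log n` leaves `log⁴ n / n`. -/
lemma tendsto_log_cube_div (hk : 1 ≤ k) (hp : ∀ n, p n ∈ Set.Ioo (0 : ℝ) 1)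
    (hp_low : (fun n : ℕ => Real.log n ^ 3 / n) =o[atTop] fun n : ℕ => p n ^ k)
    (hp_high : (fun n : ℕ => √(Real.log (Real.log n) / Real.log n)) =o[atTop]
      fun n : ℕ => 1 - p n) :
    Tendsto (fun n : ℕ => Real.log n ^ 3 / (n * p n ^ k * (1 - p n ^ k))) atTop (𝓝 0) := by
  have h1 : Tendsto (fun n : ℕ => Real.log n ^ 3 / n / p n ^ k) atTop (𝓝 0) :=
    hp_low.tendsto_div_nhds_zero
  have h2 : Tendsto (fun n : ℕ => Real.log n ^ 4 / n) atTop (𝓝 0) :=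
    ((Real.isLittleO_pow_log_id_atTop (n := 4)).tendsto_div_nhds_zero).comp tendsto_natCast_atTop_atTop
  have h3 : Tendsto (fun n : ℕ => 2 * (Real.log n ^ 3 / n / p n ^ k) +
      2 ^ k * (Real.log n ^ 4 / n)) atTop (𝓝 0) := by
    simpa using (h1.const_mul 2).add (h2.const_mul (2 ^ k))
  refine tendsto_of_tendsto_of_tendsto_of_le_of_le' tendsto_const_nhds h3 ?_ ?_
  · filter_upwards with n
    have := Real.log_natCast_nonneg n
    have := pow_pos (hp n).1 k
    have := sub_pos.2 (pow_lt_one₀ (hp n).1.le (hp n).2 (by omega : k ≠ 0))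
    positivity
  · filter_upwards [hp_high.bound one_pos, tendsto_loglog.eventually_ge_atTop 1,
      tendsto_log_natCast.eventually_ge_atTop 1, eventually_gt_atTop 0] with n h4 h5 h6 h7
    have hn : (0 : ℝ) < n := Nat.cast_pos.2 h7
    obtain ⟨hp0, hp1⟩ := hp n
    have hP := pow_pos hp0 k
    have hP1 := one_sub_le_one_sub_pow hp0.le hp1.le hk
    have hL : 0 < Real.log n := by linarith
    rw [one_mul, Real.norm_eq_abs, Real.norm_eq_abs, abs_of_nonneg (Real.sqrt_nonneg _),
      abs_of_pos (sub_pos.2 hp1)] at h4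
    have h8 : 1 / Real.log n ≤ 1 - p n := by
      refine le_trans (Real.le_sqrt_of_sq_le ?_) h4
      rw [div_pow, one_pow, div_le_div_iff₀ (by positivity) hL]
      nlinarith
    have hA : 0 ≤ Real.log n ^ 3 / n / p n ^ k := by positivity
    have hB : 0 ≤ 2 ^ k * (Real.log n ^ 4 / n) := by positivity
    by_cases hhalf : p n ≤ 1 / 2
    · have : Real.log n ^ 3 / (n * p n ^ k * (1 - p n ^ k)) ≤
          2 * (Real.log n ^ 3 / n / p n ^ k) := by
        have h9 : 1 / 2 ≤ 1 - p n ^ k := by linarith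
        calc _ ≤ Real.log n ^ 3 / (n * p n ^ k * (1 / 2)) := by gcongr
          _ = _ := by field_simp
      linarith
    · have h9 : (1 / 2 : ℝ) ^ k ≤ p n ^ k := by
        have := not_le.1 hhalf; gcongr
      have : Real.log n ^ 3 / (n * p n ^ k * (1 - p n ^ k)) ≤
          2 ^ k * (Real.log n ^ 4 / n) := by
        calc _ ≤ Real.log n ^ 3 / (n * (1 / 2) ^ k * (1 / Real.log n)) := by
              have := h8.trans hP1
              gcongr
          _ = _ := by rw [one_div, inv_pow]; field_simp
      linarith

/-- The truncation level for the number of common neighbours of an `r`-element set. -/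
noncomputable def subThreshold (k n : ℕ) (p y : ℝ) (r : ℕ) : ℝ :=
  n * ((p ^ r - p ^ k) / (1 - p ^ k)) +
    threshold k n p (y + Real.log (Real.log n)) * (1 - (p ^ r - p ^ k) / (1 - p ^ k)) +
    √(Real.log (Real.log n)) * √(n * (p ^ r - p ^ k))

/-- The conditional probability bound for a second exceedance. -/
noncomputable def pairBound (k n : ℕ) (p y : ℝ) (r : ℕ) : ℝ :=
  Real.exp (-(level k n / sdev k n p * (threshold k n p y - k))) *
    (1 + p ^ (k - r) * (Real.exp (level k n / sdev k n p) - 1)) ^ subThreshold k n p y r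

lemma pairBound_nonneg {p : ℝ} (h0 : 0 ≤ p) (n : ℕ) (y : ℝ) (r : ℕ) : 0 ≤ pairBound k n p y r := by
  unfold pairBound
  have : 0 ≤ Real.exp (level k n / sdev k n p) - 1 := by
    have : 0 ≤ level k n / sdev k n p := div_nonneg (Real.sqrt_nonneg _) (Real.sqrt_nonneg _)
    linarith [Real.add_one_le_exp (level k n / sdev k n p)]
  positivity

/-- The conditions on `n` under which the finite estimates apply. -/
lemma eventually_regular (hk : 1 ≤ k) (hp : ∀ n, p n ∈ Set.Ioo (0 : ℝ) 1)
    (hL : Tendsto (fun n : ℕ => Real.log n ^ 3 / (n * p n ^ k * (1 - p n ^ k))) atTop (𝓝 0))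
    (y : ℝ) :
    ∀ᶠ n : ℕ in atTop, 0 < Real.log n ∧ k ≤ level k n ∧ 1 ≤ level k n ∧
      |correction k n y| ≤ level k n ∧ 1 ≤ Real.log (Real.log n) ∧
      Real.log (Real.log n) ≤ level k n ∧ level k n ^ 3 / sdev k n (p n) ≤ 1 := by
  have hk' : (1 : ℝ) ≤ k := by exact_mod_cast hk
  have hlev := tendsto_level hk
  filter_upwards [tendsto_log_natCast.eventually_gt_atTop 0, hlev.eventually_ge_atTop (k : ℝ),
    hlev.eventually_ge_atTop 1,
    ((tendsto_correction_div_level hk y).abs).eventually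
      (ge_mem_nhds (by simp : |(0 : ℝ)| < 1)), tendsto_loglog.eventually_ge_atTop 1,
    tendsto_loglog_div_sqrt_log.eventually (ge_mem_nhds one_pos),
    (tendsto_level_pow_div_sdev hk hp hL).eventually (ge_mem_nhds one_pos)]
    with n h1 h2 h3 h4 h5 h6 h7
  have hx : 0 < level k n := by linarith
  refine ⟨h1, h2, h3, ?_, h5, ?_, h7⟩
  · rwa [abs_div, abs_of_pos hx, div_le_one hx] at h4
  · rw [div_le_one (Real.sqrt_pos.2 h1)] at h6
    refine h6.trans (Real.sqrt_le_sqrt ?_)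
    nlinarith

/-- The exponent is at most `-(r - k ρ) log n + 9 x g` with `x = level` and `g = √(log log n)`. The
gap is at least `(1 - p) / k`, and the assumption on `1 - p` turns it into a surplus. -/
lemma tendsto_pow_mul_pairBound (hp : ∀ n, p n ∈ Set.Ioo (0 : ℝ) 1)
    (hL : Tendsto (fun n : ℕ => Real.log n ^ 3 / (n * p n ^ k * (1 - p n ^ k))) atTop (𝓝 0))
    (hp_high : (fun n : ℕ => √(Real.log (Real.log n) / Real.log n)) =o[atTop]
      fun n : ℕ => 1 - p n) (y : ℝ) {r : ℕ} (hr : r ∈ Ico 1 k) :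
    Tendsto (fun n : ℕ => (n : ℝ) ^ (k - r) * pairBound k n (p n) y r) atTop (𝓝 0) := by
  rw [mem_Ico] at hr
  have hk : 1 ≤ k := by omega
  have hk' : (1 : ℝ) ≤ k := by exact_mod_cast hk
  have hlev := tendsto_level hk
  refine tendsto_of_tendsto_of_tendsto_of_le_of_le' tendsto_const_nhds
    (Real.tendsto_exp_neg_atTop_nhds_zero.comp hlev) ?_ ?_
  · filter_upwards with n
    exact mul_nonneg (by positivity) (pairBound_nonneg (hp n).1.le n y r)
  -- Chosen to give `10 x g ≤ (1 - p) / k * log n`: nine parts absorb the error of `pair_mgf_le`,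
  -- and the tenth leaves the decay `exp (-x)`.
  have hc : (0 : ℝ) < 1 / (10 * k * √(2 * k)) := by positivity
  filter_upwards [eventually_regular hk hp hL y, hp_high.bound hc, eventually_gt_atTop 0]
    with n ⟨h1, h2, h3, h4, h5, h6, h7⟩ h8 h9
  have hn : (0 : ℝ) < n := Nat.cast_pos.2 h9
  obtain ⟨hp0, hp1⟩ := hp n
  have hp1' : 0 < 1 - p n := sub_pos.2 hp1
  set x := level k n with hx
  set s := sdev k n (p n) with hs
  have hs0 : 0 < s := by
    have := sub_pos.2 (pow_lt_one₀ hp0.le hp1 (by omega : k ≠ 0))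
    rw [hs, sdev, Real.sqrt_pos]; positivity
  set g := √(Real.log (Real.log n)) with hg
  have hg1 : 1 ≤ g := Real.one_le_sqrt.2 h5
  have hgx : g ≤ x := by
    refine le_trans ?_ h6
    rw [hg]
    exact Real.sqrt_le_self_iff.2 (Or.inr h5)
  have hxs : x ^ 3 ≤ s := (div_le_one hs0).1 h7
  have hPeq : p n ^ k = p n ^ (k - r) * p n ^ r := by rw [← pow_add]; congr 1; omega
  have hcorr : correction k n (y + Real.log (Real.log n)) =
      correction k n y - Real.log (Real.log n) := by simp only [correction]; ring
  have hmgf := pair_mgf_le (n := n) (q := p n ^ (k - r)) (Q := p n ^ r) (P := p n ^ k) (s := s)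
    (x := x) (h := correction k n y) (l := Real.log (Real.log n)) (g := g) (K := k)
    (t := threshold k n (p n) y) (T := threshold k n (p n) (y + Real.log (Real.log n)))
    hn (pow_pos hp0 _) (pow_lt_one₀ hp0.le hp1 (by omega)) (pow_pos hp0 _)
    (pow_lt_one₀ hp0.le hp1 (by omega)) hPeq rfl h3 h4 (by linarith) h6 hg1 hgx h7
    (by
      rw [div_mul_eq_mul_div, div_le_one hs0]
      refine le_trans ?_ hxs
      nlinarith [mul_le_mul_of_nonneg_left h2 (by linarith : (0 : ℝ) ≤ x)]) rfl rfl
    (threshold_eq hk h1 hp0 hp1 y) (by rw [threshold_eq hk h1 hp0 hp1, hcorr]) rfl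
  have hgap := overlap_gap hp0 hp1 hr.1 (by omega : 1 ≤ k - r)
  have hrk : (r : ℝ) + (k - r : ℕ) = k := by
    have : r + (k - r) = k := by omega
    exact_mod_cast this
  rw [hrk, show r + (k - r) = k by omega] at hgap
  have hpow : (n : ℝ) ^ (k - r) = Real.exp ((k - r : ℕ) * Real.log n) := by
    rw [Real.exp_nat_mul, Real.exp_log hn]
  have hx2 : x ^ 2 / 2 = k * Real.log n := by rw [hx, level_sq]; ring
  have hxg : 10 * (x * g) ≤ (1 - p n) / k * Real.log n := by
    rw [Real.norm_eq_abs, Real.norm_eq_abs, abs_of_nonneg (Real.sqrt_nonneg _),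
      abs_of_pos hp1'] at h8
    have e : x * g = √(2 * k) * (Real.log n * √(Real.log (Real.log n) / Real.log n)) := by
      rw [hx, hg, level, Real.sqrt_mul (by positivity), Real.sqrt_div (by linarith)]
      have h10 : Real.log n = √(Real.log n) * √(Real.log n) := (Real.mul_self_sqrt h1.le).symm
      have : √(Real.log n) ≠ 0 := by positivity
      generalize √(Real.log n) = a at this h10 ⊢
      rw [h10]; field_simp
    rw [e]
    calc _ ≤ 10 * (√(2 * k) * (Real.log n * (1 / (10 * k * √(2 * k)) * (1 - p n)))) := by gcongr
      _ = _ := by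
        have : √(2 * (k : ℝ)) ≠ 0 := by positivity
        generalize √(2 * (k : ℝ)) = a at this ⊢
        field_simp
  rw [hpow]
  refine (mul_le_mul_of_nonneg_left hmgf (Real.exp_pos _).le).trans ?_
  simp only [Function.comp]
  rw [← Real.exp_add, Real.exp_le_exp, hx2]
  have hgapL := mul_le_mul_of_nonneg_right hgap h1.le
  have hkr : ((k - r : ℕ) : ℝ) = k - r := by linarith
  have hxg' : x ≤ x * g := le_mul_of_one_le_right (by linarith) hg1
  rw [hkr]
  nlinarith

lemma binTail_nonneg {N : ℕ} {P x : ℝ} (h0 : 0 ≤ P) (h1 : P ≤ 1) : 0 ≤ binTail N P x := by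
  have := sub_nonneg.2 h1
  exact sum_nonneg fun _ _ => by positivity

lemma binTail_anti {N : ℕ} {P x x' : ℝ} (h0 : 0 ≤ P) (h1 : P ≤ 1) (h : x ≤ x') :
    binTail N P x' ≤ binTail N P x := by
  have := sub_nonneg.2 h1
  refine sum_le_sum_of_subset_of_nonneg ?_ fun _ _ _ => by positivity
  intro j hj
  rw [mem_filter] at hj ⊢
  exact ⟨hj.1, h.trans_lt hj.2⟩

/-- The growing level `y + log log n` eventually passes every fixed `z`, and the expected number of
exceedances at `z` tends to `exp (-z)`. -/
lemma tendsto_choose_mul_binTail_shift (hk : 1 ≤ k) (hp : ∀ n, p n ∈ Set.Ioo (0 : ℝ) 1)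
    (hL : Tendsto (fun n : ℕ => Real.log n ^ 3 / (n * p n ^ k * (1 - p n ^ k))) atTop (𝓝 0))
    (c : ℕ) (y : ℝ) :
    Tendsto (fun n : ℕ => (n.choose k : ℝ) *
      binTail (n - c) (p n ^ k) (threshold k n (p n) (y + Real.log (Real.log n)))) atTop (𝓝 0) := by
  have hP : ∀ n, 0 < p n ^ k ∧ p n ^ k < 1 := fun n =>
    ⟨pow_pos (hp n).1 k, pow_lt_one₀ (hp n).1.le (hp n).2 (by omega)⟩
  rw [Metric.tendsto_atTop']
  intro ε hε
  obtain ⟨z, hz⟩ : ∃ z, Real.exp (-z) < ε :=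
    (Real.tendsto_exp_neg_atTop_nhds_zero.eventually (gt_mem_nhds hε)).exists
  have h := (tendsto_choose_mul_binTail hk hp hL c 0 z).eventually (gt_mem_nhds hz)
  obtain ⟨N, hN⟩ := eventually_atTop.1 (h.and (tendsto_loglog.eventually_ge_atTop (z - y)))
  refine ⟨N, fun n hn => ?_⟩
  obtain ⟨h1, h2⟩ := hN n hn.le
  rw [Real.dist_eq, sub_zero, abs_of_nonneg (mul_nonneg (by positivity) (binTail_nonneg (hP n).1.le (hP n).2.le))]
  refine lt_of_le_of_lt ?_ h1
  refine mul_le_mul_of_nonneg_left (binTail_anti (hP n).1.le (hP n).2.le ?_) (by positivity)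
  rw [sub_zero, threshold, threshold]
  have : 0 ≤ scaling k n (p n) := Real.sqrt_nonneg _
  gcongr
  linarith

end Limits

/-! ### The total error in the Poisson recursion. -/

section Assembly

variable {k : ℕ} {p : ℕ → ℝ}

/-- Compares the variance of the count of `U` with the variance proxy `D = n (p ^ r - p ^ k)` of the
truncation step, so that `D` is large as soon as `sdev` is. -/
lemma pow_mul_one_sub_pow_le {p : ℝ} (h0 : 0 < p) (h1 : p < 1) {r : ℕ} (hr : r < k) :
    p ^ k * (1 - p ^ k) ≤ k * (p ^ r - p ^ k) := by
  have hbern := one_add_mul_le_pow (a := p - 1) (by linarith) k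
  rw [add_sub_cancel] at hbern
  have h2 : p ^ k ≤ p ^ r * p := by
    rw [← pow_succ]; exact pow_le_pow_of_le_one h0.le h1.le hr
  have h3 : p ^ k ≤ p ^ r := pow_le_pow_of_le_one h0.le h1.le hr.le
  have h4 : p ^ k * (1 - p) ≤ p ^ r - p ^ k := by
    have : p ^ k * (1 - p) ≤ p ^ r * (1 - p) :=
      mul_le_mul_of_nonneg_right h3 (by linarith)
    linarith
  calc _ ≤ p ^ k * (k * (1 - p)) := by
        have := pow_pos h0 k
        gcongr; linarith
    _ = k * (p ^ k * (1 - p)) := by ring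
    _ ≤ _ := by gcongr

/-- The loss in the truncation step. -/
noncomputable def truncationBound (k n : ℕ) (p y : ℝ) : ℝ :=
  binTail (n - k) (p ^ k) (threshold k n p (y + Real.log (Real.log n))) +
    Real.exp (-(√(Real.log (Real.log n)) ^ 2 / 4)) * binTail (n - k) (p ^ k) (threshold k n p y)

lemma mul_pow_le_threshold (hk : 1 ≤ k) {n : ℕ} {p y : ℝ} (h0 : 0 < p) (h1 : p < 1)
    (hn : 0 < Real.log n) (hx : 1 ≤ level k n) (hc : |correction k n y| ≤ level k n) :
    n * p ^ k ≤ threshold k n p y := by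
  rw [threshold_eq hk hn h0 h1]
  have h2 : correction k n y / level k n ≤ 1 := by
    rw [div_le_one (by linarith)]; exact (abs_le.1 hc).2
  have : 0 ≤ sdev k n p * (level k n - correction k n y / level k n) :=
    mul_nonneg (Real.sqrt_nonneg _) (by linarith)
  linarith

lemma bprob_truncation_le {V : Type*} [DecidableEq V] [Fintype V] {n : ℕ} {p y : ℝ}
    (hk : 1 ≤ k) (h0 : 0 < p) (h1 : p < 1) (hV : Fintype.card V = n)
    (hn : 0 < Real.log n) (hkx : k ≤ level k n) (hx : 1 ≤ level k n)
    (hc : |correction k n y| ≤ level k n) (hl : 1 ≤ Real.log (Real.log n))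
    (hlx : Real.log (Real.log n) ≤ level k n) (hxs : level k n ^ 3 / sdev k n p ≤ 1)
    {U W : Finset V} (hU : #U = k) (hWU : W ⊆ U) (hW : #W ∈ Ico 1 k) :
    bprob p (pairs V) (fun S => threshold k n p y < #(cn S U Uᶜ) ∧
      subThreshold k n p y #W < #(cn S W Uᶜ)) ≤ truncationBound k n p y := by
  rw [mem_Ico] at hW
  have hk' : (1 : ℝ) ≤ k := by exact_mod_cast hk
  have hn0 : (0 : ℝ) < n := by
    rcases Nat.eq_zero_or_pos n with rfl | h
    · simp at hn
    · exact Nat.cast_pos.2 h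
  have hcard : #Uᶜ = n - k := by rw [card_compl, hV, hU]
  have hPQ : p ^ k < p ^ #W := pow_lt_pow_right_of_lt_one₀ h0 h1 hW.2
  have hP1 : 0 < 1 - p ^ k := sub_pos.2 (pow_lt_one₀ h0.le h1 (by omega))
  set D := n * (p ^ #W - p ^ k) with hD
  have hD0 : 0 < D := mul_pos hn0 (sub_pos.2 hPQ)
  have hs2 : sdev k n p ^ 2 = n * p ^ k * (1 - p ^ k) := Real.sq_sqrt (by positivity)
  have hs0 : 0 < sdev k n p := Real.sqrt_pos.2 (by positivity)
  -- From `k level² ≤ level⁶ ≤ sdev² ≤ k D`. This is what keeps the tilting parameter of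
  -- `subset_mgf_le` at most `1`.
  have hxD : level k n ≤ √D := by
    refine Real.le_sqrt_of_sq_le ?_
    have h2 : level k n ^ 3 ≤ sdev k n p := (div_le_one hs0).1 hxs
    have h3 : sdev k n p ^ 2 ≤ k * D := by
      rw [hs2, hD]
      have := mul_le_mul_of_nonneg_left (pow_mul_one_sub_pow_le h0 h1 hW.2) hn0.le
      linarith
    have h4 : (level k n ^ 3) ^ 2 ≤ sdev k n p ^ 2 := by gcongr
    have h5 : k * level k n ^ 2 ≤ (level k n ^ 3) ^ 2 := by
      have : k ≤ level k n ^ 4 := hkx.trans (le_self_pow₀ hx (by norm_num))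
      calc _ ≤ level k n ^ 4 * level k n ^ 2 := by gcongr
        _ = _ := by ring
    exact le_of_mul_le_mul_left (h5.trans (h4.trans h3)) (by linarith)
  have hgD : √(Real.log (Real.log n)) ≤ 2 * √D := by
    have := Real.sqrt_le_self_iff.2 (Or.inr hl)
    linarith
  have h := bprob_large_subset_le (p := p) (O := Uᶜ) (t := threshold k n p y)
    (T := threshold k n p (y + Real.log (Real.log n))) (b := subThreshold k n p y #W)
    (z := Real.exp (√(Real.log (Real.log n)) / (2 * √D)))
    (δ := Real.exp (-(√(Real.log (Real.log n)) ^ 2 / 4))) h0.le h1.le hWU disjoint_compl_right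
    (Real.one_le_exp (by positivity)) (Real.exp_pos _).le
    (fun j hj htj hjT => by
      rw [hcard] at hj ⊢
      rw [hU]
      exact subset_mgf_le (n := n) (pow_pos h0 k) hPQ
        (pow_lt_one₀ h0.le h1 (by omega)) (Nat.cast_le.2 (Nat.sub_le n k)) hj
        ((mul_pow_le_threshold hk h0 h1 hn hx hc).trans htj.le) hjT hD hD0
        (Real.sqrt_nonneg _) hgD rfl)
  rwa [hcard, hU] at h

/-- The error in the Poisson recursion. -/
noncomputable def recursionError (k n : ℕ) (p y : ℝ) : ℝ :=
  let τ := binTail (n - k) (p ^ k) (threshold k n p y)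
  let δ := binTail (n - 2 * k) (p ^ k) (threshold k n p y - k) -
    binTail (n - 2 * k) (p ^ k) (threshold k n p y)
  n.choose k * (∑ r ∈ Ico 1 k, k.choose r *
      (truncationBound k n p y + (n : ℝ) ^ (k - r) * (τ * pairBound k n p y r)) +
        τ * (n.choose k * δ) + τ * (k * (n : ℝ) ^ (k - 1) * τ + n.choose k * δ))

lemma sum_bprob_exceedance {n : ℕ} {p t : ℝ} :
    ∑ U ∈ (univ : Finset (Fin n)).powersetCard k,
      bprob p (pairs (Fin n)) (fun S => t < #(cn S U Uᶜ)) =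
      n.choose k * binTail (n - k) (p ^ k) t := by
  rw [sum_congr rfl fun U hU => bprob_lt_card_cn_compl (mem_powersetCard_univ.1 hU), sum_const,
    card_powersetCard, card_univ, Fintype.card_fin, nsmul_eq_mul]

lemma abs_recursion_le {n : ℕ} {p y : ℝ}
    (hk : 1 ≤ k) (h0 : 0 < p) (h1 : p < 1)
    (hn : 0 < Real.log n) (hkx : k ≤ level k n) (hx : 1 ≤ level k n)
    (hc : |correction k n y| ≤ level k n) (hl : 1 ≤ Real.log (Real.log n))
    (hlx : Real.log (Real.log n) ≤ level k n) (hxs : level k n ^ 3 / sdev k n p ≤ 1) (i : ℕ) :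
    |((i + 1 : ℕ) : ℝ) * bprob p (pairs (Fin n))
        (fun S => exceedances (threshold k n p y) k S = i + 1) -
      n.choose k * binTail (n - k) (p ^ k) (threshold k n p y) *
        bprob p (pairs (Fin n)) (fun S => exceedances (threshold k n p y) k S = i)| ≤
      recursionError k n p y := by
  have hP0 : 0 ≤ p ^ k := by positivity
  have hP1 : p ^ k ≤ 1 := pow_le_one₀ h0.le h1.le
  have hV : Fintype.card (Fin n) = n := Fintype.card_fin n
  rw [← sum_bprob_exceedance]
  refine (abs_mul_bprob_exceedances_sub_le h0.le h1.le i).trans ?_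
  have hτ0 := binTail_nonneg (N := n - k) (x := threshold k n p y) hP0 hP1
  have hδ0 : 0 ≤ binTail (n - 2 * k) (p ^ k) (threshold k n p y - k) -
      binTail (n - 2 * k) (p ^ k) (threshold k n p y) :=
    sub_nonneg.2 (binTail_anti hP0 hP1 (sub_le_self _ (Nat.cast_nonneg k)))
  unfold recursionError
  have hcard : (n.choose k : ℝ) = #((univ : Finset (Fin n)).powersetCard k) := by
    rw [card_powersetCard, card_univ, Fintype.card_fin]
  dsimp only
  rw [hcard, ← nsmul_eq_mul (#((univ : Finset (Fin n)).powersetCard k)) (_ + _), ← sum_const, ← hcard]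
  refine sum_le_sum fun U hU => add_le_add ?_ ?_
  · have hU' := mem_powersetCard_univ.1 hU
    have h := bprob_exceedance_and_ne_le (V := Fin n) (p := p) (t := threshold k n p y)
      hk hU' h0.le h1.le rfl rfl (by rwa [hV]) (by rwa [hV])
      (α := level k n / sdev k n p) (div_nonneg (Real.sqrt_nonneg _) (Real.sqrt_nonneg _))
      (subThreshold k n p y) (fun _ => truncationBound k n p y) (pairBound k n p y)
      (fun W hW hWk => bprob_truncation_le hk h0 h1 hV hn hkx hx hc hl hlx hxs hU' hW hWk)
      (fun r _ => le_rfl) (fun r => pairBound_nonneg h0.le n y r)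
    rwa [hV] at h
  · have hU' := mem_powersetCard_univ.1 hU
    have h := bprob_exceedances_ne_le (V := Fin n) (p := p) (t := threshold k n p y)
      hU' h0.le h1.le rfl rfl (by rwa [hV]) (by rwa [hV])
    rw [bprob_lt_card_cn_compl hU', hV]
    rw [hV] at h
    exact mul_le_mul_of_nonneg_left h hτ0

/-- With `M = n.choose k`, every term is a product of convergent quantities with a vanishing factor.
`M τ` converges; `M δ` vanishes because shifts by `k` do not change the limit; `M` times
`truncationBound` vanishes because both `y + log log n` and `√(log log n)` grow; and the sets
meeting `U` contribute `(M τ)²` times a multiple of `n ^ (k - 1) / M`. -/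
lemma tendsto_recursionError (hk : 1 ≤ k) (hp : ∀ n, p n ∈ Set.Ioo (0 : ℝ) 1)
    (hL : Tendsto (fun n : ℕ => Real.log n ^ 3 / (n * p n ^ k * (1 - p n ^ k))) atTop (𝓝 0))
    (hp_high : (fun n : ℕ => √(Real.log (Real.log n) / Real.log n)) =o[atTop]
      fun n : ℕ => 1 - p n) (y : ℝ) :
    Tendsto (fun n => recursionError k n (p n) y) atTop (𝓝 0) := by
  set τ : ℕ → ℝ := fun n => binTail (n - k) (p n ^ k) (threshold k n (p n) y) with hτ
  set δ : ℕ → ℝ := fun n => binTail (n - 2 * k) (p n ^ k) (threshold k n (p n) y - k) -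
    binTail (n - 2 * k) (p n ^ k) (threshold k n (p n) y) with hδ
  have hMτ : Tendsto (fun n : ℕ => n.choose k * τ n) atTop (𝓝 (Real.exp (-y))) := by
    simpa using tendsto_choose_mul_binTail hk hp hL k 0 y
  have hMδ : Tendsto (fun n : ℕ => n.choose k * δ n) atTop (𝓝 0) := by
    have h := (tendsto_choose_mul_binTail hk hp hL (2 * k) k y).sub
      (tendsto_choose_mul_binTail hk hp hL (2 * k) 0 y)
    simpa only [sub_self, sub_zero, ← mul_sub] using h
  have hMε : Tendsto (fun n : ℕ => n.choose k * truncationBound k n (p n) y) atTop (𝓝 0) := by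
    have hexp : Tendsto (fun n : ℕ => Real.exp (-(√(Real.log (Real.log n)) ^ 2 / 4))) atTop
        (𝓝 0) := by
      refine Real.tendsto_exp_neg_atTop_nhds_zero.comp ?_
      exact ((tendsto_pow_atTop two_ne_zero).comp
        (Real.tendsto_sqrt_atTop.comp tendsto_loglog)).atTop_div_const (by norm_num)
    have h := (tendsto_choose_mul_binTail_shift hk hp hL k y).add (hexp.mul hMτ)
    simp only [zero_mul, add_zero] at h
    refine h.congr fun n => ?_
    simp only [truncationBound, hτ]
    ring
  have hratio : Tendsto (fun n : ℕ => (n : ℝ) ^ (k - 1) / n.choose k) atTop (𝓝 0) := by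
    have hchoose : Tendsto (fun n : ℕ => (n.choose k : ℝ) / (n ^ k / k.factorial)) atTop (𝓝 1) := by
      refine (isEquivalent_iff_tendsto_one ?_).1 (isEquivalent_choose k)
      filter_upwards [eventually_gt_atTop 0] with n hn
      have : (0 : ℝ) < n := Nat.cast_pos.2 hn
      positivity
    have h := (hchoose.inv₀ one_ne_zero).mul
      (tendsto_const_div_atTop_nhds_zero_nat (k.factorial : ℝ))
    simp only [mul_zero] at h
    refine h.congr' ?_
    filter_upwards [eventually_ge_atTop k, eventually_gt_atTop 0] with n hn hn0
    have h1 : (0 : ℝ) < n := Nat.cast_pos.2 hn0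
    have h2 : (0 : ℝ) < n.choose k := Nat.cast_pos.2 (Nat.choose_pos hn)
    have h3 : (n : ℝ) ^ k = n ^ (k - 1) * n := by rw [← pow_succ]; congr 1; omega
    rw [h3]
    field_simp
  have hpair : ∀ r ∈ Ico 1 k, Tendsto (fun n : ℕ => k.choose r *
      (n.choose k * truncationBound k n (p n) y +
        n.choose k * τ n * ((n : ℝ) ^ (k - r) * pairBound k n (p n) y r))) atTop (𝓝 0) := by
    intro r hr
    simpa using ((hMε.add (hMτ.mul (tendsto_pow_mul_pairBound hp hL hp_high y hr))).const_mul
      (k.choose r : ℝ))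
  have hsum := tendsto_finsetSum (Ico 1 k) hpair
  rw [sum_const_zero] at hsum
  have h := (hsum.add (hMτ.mul hMδ)).add
    ((((hMτ.mul hMτ).mul hratio).const_mul (k : ℝ)).add (hMτ.mul hMδ))
  simp only [mul_zero, add_zero] at h
  refine h.congr' ?_
  filter_upwards [eventually_ge_atTop k] with n hn
  have h2 : (n.choose k : ℝ) ≠ 0 := Nat.cast_ne_zero.2 (Nat.choose_pos hn).ne'
  unfold recursionError
  dsimp only
  rw [mul_add, mul_add, mul_sum]
  congr 1
  · congr 1
    · refine sum_congr rfl fun r _ => ?_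
      simp only [hτ]
      ring
    · simp only [hτ, hδ]
      ring
  · simp only [hτ, hδ]
    generalize (n : ℝ) ^ (k - 1) = a
    field_simp

end Assembly
end CommonNeighbors

/-! ### The limit law. -/

open CommonNeighbors in
theorem theorem1 (k m : ℕ) (hk : 1 ≤ k) (hm : 1 ≤ m) (y : ℝ)
    (p : ℕ → ℝ) (hp : ∀ n, p n ∈ Set.Ioo (0 : ℝ) 1)
    (hp_low : (fun n : ℕ => Real.log n ^ 3 / n) =o[atTop] fun n : ℕ => p n ^ k)
    (hp_high : (fun n : ℕ => √(Real.log (Real.log n) / Real.log n)) =o[atTop]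
      fun n : ℕ => 1 - p n) :
    Tendsto
      (fun n : ℕ =>
        (SimpleGraph.binomialRandom (Fin n) ⟨p n, (hp n).1.le, (hp n).2.le⟩).real
          {G : SimpleGraph (Fin n) |
            ((CommonNeighbors.mthMaxCommonNbrs k m G : ℝ) -
              CommonNeighbors.centring k n (p n)) / CommonNeighbors.scaling k n (p n) ≤ y})
      atTop
      (𝓝 (Real.exp (-Real.exp (-y)) *
        ∑ i ∈ Finset.range m, Real.exp (-(y * i)) / (i.factorial : ℝ))) := by
  have hL := tendsto_log_cube_div hk hp hp_low hp_high
  have hreg := eventually_regular hk hp hL y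
  have hpoisson := tendsto_poisson_of_recursion (μ := Real.exp (-y))
    (q := fun n i => bprob (p n) (pairs (Fin n))
      fun S => exceedances (threshold k n (p n) y) k S = i)
    (lam := fun n => n.choose k * binTail (n - k) (p n ^ k) (threshold k n (p n) y))
    (Real.exp_pos _).le (fun n _ => bprob_nonneg (hp n).1.le (hp n).2.le)
    (fun n K => sum_bprob_le_one (V := Fin n) (hp n).1.le (hp n).2.le K)
    (fun n K hK => by
      rw [← sum_bprob_exceedance]
      exact one_sub_le_sum_bprob (hp n).1.le (hp n).2.le hK)
    (by simpa using tendsto_choose_mul_binTail hk hp hL k 0 y)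
    (fun i => by
      refine squeeze_zero_norm' ?_ (tendsto_recursionError hk hp hL hp_high y)
      filter_upwards [hreg] with n ⟨h1, h2, h3, h4, h5, h6, h7⟩
      exact abs_recursion_le hk (hp n).1 (hp n).2 h1 h2 h3 h4 h5 h6 h7 i) m
  have hsum : ∀ i : ℕ, Real.exp (-y) ^ i = Real.exp (-(y * i)) := fun i => by
    rw [← Real.exp_nat_mul]; congr 1; ring
  simp only [hsum] at hpoisson
  refine hpoisson.congr' ?_
  filter_upwards [hreg] with n ⟨h1, h2, h3, h4, h5, h6, h7⟩
  have hn : (0 : ℝ) < n := by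
    rcases Nat.eq_zero_or_pos n with rfl | h
    · simp at h1
    · exact Nat.cast_pos.2 h
  have hP0 := pow_pos (hp n).1 k
  have hP1 : 0 < 1 - p n ^ k := sub_pos.2 (pow_lt_one₀ (hp n).1.le (hp n).2 (by omega))
  have hk' : (0 : ℝ) < k := by exact_mod_cast hk
  refine (binomialRandom_real_mthMaxCommonNbrs_le (V := Fin n) (k := k)
    (a := centring k n (p n)) (σ := scaling k n (p n)) (y := y) hm
    ⟨p n, (hp n).1.le, (hp n).2.le⟩ ?_ ?_).symm
  · rw [scaling, Real.sqrt_pos]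
    positivity
  -- The threshold lies above the mean `n p ^ k`, hence is nonnegative, as the passage to integer
  -- counts requires.
  · exact (by positivity : (0 : ℝ) ≤ n * p n ^ k).trans
      (mul_pow_le_threshold hk (hp n).1 (hp n).2 h1 h3 h4)
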